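/- **Setting.** Alice is sender and Bob is receiver; keys and MACs lie in $\{0,1\}^\kappa$. Bob holds the global key $\Delta_A$, Alice holds $\Delta_B$. $[x]_A$ means that Alice holds a bit $x$ and a MAC $M_x$ and Bob holds a key $K_x$ with $M_x=K_x\oplus x\Delta_A$; $[c]_B$ is the same with the roles exchanged and $\Delta_B$ in place of $\Delta_A$. *Boxes.* The box $\mathrm{aOT}(\ell)$ outputs, under uniformly random global keys, $\ell$ uniformly random quadruples $[x_0]_A,[x_1]_A,[c]_B,[z]_B$ with $z=c(x_0\oplus x_1)\oplus x_0$. A corrupted party chooses all of her (his) own values: Alice chooses $\Delta_B$ and all $x_0,x_1$, their MACs and $K_c,K_z$; Bob chooses $\Delta_A$ and all $c,z$, their MACs and $K_{x_0},K_{x_1}$; the remaining values are random subject to the relations above. At any point the adversary may ask whether a string equals $\Delta_A$, or equals $\Delta_B$. The adversary schedules the delivery of outputs, and if a party is corrupted it may make the honest party output `fail` instead. The leaky box $\mathrm{LaOT}(n)$ outputs $n$ such quadruples in the same way, but instead of the abort command a corrupted Alice may, as often as she likes before Bob receives his outputs, guess a choice bit $c^i$: a wrong guess makes the box fail (Bob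 then gets `fail`), after a right one it continues and Alice knows that the guess was right. *Protocol*, with parameters $B,\ell\ge 1$ and a random permutation $\pi$ of the $B\ell$ indices which is $B$-wise independent (the images of any $B$ distinct points are uniform over the $B$-tuples of distinct points). (1) The parties call $\mathrm{LaOT}(B\ell)$, and output `fail` if it fails. (2) Bob samples $\pi$ and sends it to Alice; for $0\le j<\ell$, bucket $j$ consists of the quadruples with indices $\pi(jB+1),\dots,\pi(jB+B)$. (3) The quadruples of each bucket are combined one after the other: to combine $[x_0^1]_A,[x_1^1]_A,[c^1]_B,[z^1]_B$ with $[x_0^2]_A,[x_1^2]_A,[c^2]_B,[z^2]_B$, Alice reveals $d=x_0^1\oplus x_1^1\oplus x_0^2\oplus x_1^2$ with its MAC, Bob checks the MAC and outputs `fail` if it is wrong, and the parties locally compute $[c]_B=[c^1]_B\oplus[c^2]_B$, $[z]_B=[z^1]_B\oplus[z^2]_B\oplus d[c^1]_B$, $[x_0]_A=[x_0^1]_A\oplus[x_0^2]_A$, $[x_1]_A=[x_0^1]_A\oplus[x_1^2]_A$. The parties output their global keys and their parts of the $\ell$ results. Channels are authenticated, and the adversary sees messages and schedules their delivery. *Security.*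 The adversary statically and actively corrupts nobody, Alice, or Bob. The protocol *securely implements* $\mathrm{aOT}(\ell)$ in the $\mathrm{LaOT}(B\ell)$-hybrid model *with security parameter* $\psi$, with respect to a polynomial $p$, if for each of these three cases there is a simulator whose memory, randomness, number of steps per activation, and Boolean circuit size per step are at most $p(\kappa+\ell+B)$ (it may also sample from the distribution of $\pi$), such that every environment, even computationally unbounded, which also plays the adversary and interacts for $q$ rounds, has advantage at most $p(q)\,2^{-\psi}$ in distinguishing the protocol with $\mathrm{LaOT}(B\ell)$ from the box $\mathrm{aOT}(\ell)$ with the simulator. **Theorem.** There is a polynomial $p$ such that for all integers $\ell,B\ge1$, $\kappa\ge\psi\ge0$ and every distribution of $B$-wise independent permutations of the $B\ell$ indices: if $$(\log_2\ell+1)(B-1)\ \ge\ \psi ,$$ then the above protocol securely implements $\mathrm{aOT}(\ell)$ in the $\mathrm{LaOT}(B\ell)$-hybrid model with security parameter $\psi$, with respect to $p$. -/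

import Mathlib

namespace AOT

/-! ## Authenticated bits and authenticated OTs -/

/-- Alice is the OT sender, Bob the OT receiver. -/
inductive Party where
  | alice
  | bob
  deriving DecidableEq

/-- Static corruption: nobody, Alice, or Bob. -/
abbrev Corruption := Option Party

/-- Bits; `+` is exclusive or. -/
abbrev Bit := ZMod 2

/-- Strings of `κ` bits: global keys, local keys and MACs. `x • Δ` is `x Δ`. -/
abbrev Key (κ : ℕ) := Fin κ → Bit

/-- Alice's part of a quadruple `[x₀]_A, [x₁]_A, [c]_B, [z]_B`: her two message bits with
their MACs, and the local keys for `c` and `z`. -/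
structure SenderView (κ : ℕ) where
  x₀ : Bit
  x₁ : Bit
  m₀ : Key κ
  m₁ : Key κ
  kc : Key κ
  kz : Key κ

/-- Bob's part of such a quadruple: the local keys for `x₀` and `x₁`, and his bits `c` and `z`
with their MACs. -/
structure ReceiverView (κ : ℕ) where
  k₀ : Key κ
  k₁ : Key κ
  c : Bit
  mc : Key κ
  z : Bit
  mz : Key κ

instance (κ : ℕ) : Inhabited (SenderView κ) := ⟨⟨0, 0, 0, 0, 0, 0⟩⟩

instance (κ : ℕ) : Inhabited (ReceiverView κ) := ⟨⟨0, 0, 0, 0, 0, 0⟩⟩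

def SenderView.toTuple {κ : ℕ} (v : SenderView κ) :
    Bit × Bit × Key κ × Key κ × Key κ × Key κ :=
  (v.x₀, v.x₁, v.m₀, v.m₁, v.kc, v.kz)

theorem SenderView.toTuple_injective {κ : ℕ} :
    Function.Injective (SenderView.toTuple (κ := κ)) := by
  rintro ⟨⟩ ⟨⟩ h
  simpa [SenderView.toTuple] using h

def ReceiverView.toTuple {κ : ℕ} (v : ReceiverView κ) :
    Key κ × Key κ × Bit × Key κ × Bit × Key κ :=
  (v.k₀, v.k₁, v.c, v.mc, v.z, v.mz)

theorem ReceiverView.toTuple_injective {κ : ℕ} :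
    Function.Injective (ReceiverView.toTuple (κ := κ)) := by
  rintro ⟨⟩ ⟨⟩ h
  simpa [ReceiverView.toTuple] using h

noncomputable instance (κ : ℕ) : Fintype (SenderView κ) :=
  Fintype.ofInjective _ SenderView.toTuple_injective

/-- Bob's part, given Alice's part, the global keys, and the choice bit `c`: every MAC is the
local key plus the bit times the global key, and `z = c (x₀ + x₁) + x₀`. -/
def receiverOf {κ : ℕ} (ΔA ΔB : Key κ) (a : SenderView κ) (c : Bit) : ReceiverView κ where
  k₀ := a.m₀ + a.x₀ • ΔA
  k₁ := a.m₁ + a.x₁ • ΔA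
  c := c
  mc := a.kc + c • ΔB
  z := c * (a.x₀ + a.x₁) + a.x₀
  mz := a.kz + (c * (a.x₀ + a.x₁) + a.x₀) • ΔB

/-- Alice's part, given Bob's part, the global keys, and the message bit `y` that Bob did not
select: `x_c = z` and `x_{1-c} = y`. -/
def senderOf {κ : ℕ} (ΔA ΔB : Key κ) (b : ReceiverView κ) (y : Bit) : SenderView κ where
  x₀ := if b.c = 0 then b.z else y
  x₁ := if b.c = 0 then y else b.z
  m₀ := b.k₀ + (if b.c = 0 then b.z else y) • ΔA
  m₁ := b.k₁ + (if b.c = 0 then y else b.z) • ΔA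
  kc := b.mc + b.c • ΔB
  kz := b.mz + b.z • ΔB

/-- What Alice gets from a box producing `n` quadruples: `Δ_B` and her parts. -/
abbrev SenderOut (κ n : ℕ) := Key κ × (Fin n → SenderView κ)

/-- What Bob gets from a box producing `n` quadruples: `Δ_A` and his parts. -/
abbrev ReceiverOut (κ n : ℕ) := Key κ × (Fin n → ReceiverView κ)

/-- Outputs of an honest party. -/
inductive Output (κ n : ℕ) where
  | sender (o : SenderOut κ n)
  | receiver (o : ReceiverOut κ n)
  | fail (P : Party)

/-! ## The boxes `LaOT(n)` and `aOT(n)`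

Both boxes are the state machine `Box`. Values chosen by a corrupted party replace the
corresponding random ones. The adversary schedules delivery of outputs. The commands `guess`
(only `LaOT`) and `abort` (only `aOT`) are the sole difference. -/

/-- All random values that a box may need, sampled uniformly when it is created. -/
structure Tape (κ n : ℕ) where
  ΔA : Key κ
  ΔB : Key κ
  /-- Alice's parts (used if Alice is honest and Bob is honest). -/
  sender : Fin n → SenderView κ
  /-- Bob's choice bits (used if Bob is honest). -/
  choice : Fin n → Bit
  /-- the unselected message bits (used if Bob is corrupted). -/
  other : Fin n → Bit

noncomputable instance (κ n : ℕ) : Fintype (Tape κ n) :=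
  Fintype.ofInjective (fun t => (t.ΔA, t.ΔB, t.sender, t.choice, t.other)) (by
    rintro ⟨⟩ ⟨⟩ h
    simpa using h)

instance (κ n : ℕ) : Inhabited (Tape κ n) := ⟨⟨0, 0, fun _ => default, 0, 0⟩⟩

structure Box (κ n : ℕ) where
  tape : Tape κ n
  /-- which honest parties have activated the box -/
  started : Party → Bool
  /-- the values chosen by a corrupted Alice -/
  choiceA : Option (SenderOut κ n)
  /-- the values chosen by a corrupted Bob -/
  choiceB : Option (ReceiverOut κ n)
  /-- which honest parties have received their outputs -/
  delivered : Party → Bool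
  failed : Bool

namespace Box

variable {κ n : ℕ}

def create (t : Tape κ n) : Box κ n where
  tape := t
  started := fun _ => false
  choiceA := none
  choiceB := none
  delivered := fun _ => false
  failed := false

def start (cor : Corruption) (b : Box κ n) (P : Party) : Box κ n :=
  if cor = some P then b else { b with started := Function.update b.started P true }

/-- A corrupted Alice chooses `Δ_B` and all her values (once). -/
def chooseA (cor : Corruption) (b : Box κ n) (v : SenderOut κ n) : Box κ n :=
  if cor = some .alice ∧ b.choiceA.isNone then { b with choiceA := some v } else b

/-- A corrupted Bob chooses `Δ_A` and all his values (once). -/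
def chooseB (cor : Corruption) (b : Box κ n) (v : ReceiverOut κ n) : Box κ n :=
  if cor = some .bob ∧ b.choiceB.isNone then { b with choiceB := some v } else b

/-- The global key held by a party: `Δ_B` for Alice and `Δ_A` for Bob. The key of a corrupted
party is undefined until she or he has chosen it. -/
def globalKey (cor : Corruption) (b : Box κ n) : Party → Option (Key κ)
  | .alice => if cor = some .alice then b.choiceA.map Prod.fst else some b.tape.ΔB
  | .bob => if cor = some .bob then b.choiceB.map Prod.fst else some b.tape.ΔA

/-- Global key query `(P, Δ)`. -/
def keyQuery (cor : Corruption) (b : Box κ n) (P : Party) (Δ : Key κ) : Bool :=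
  decide (b.globalKey cor P = some Δ)

/-- The outputs to Alice and Bob, once every honest party has activated the box and the corrupted
party, if any, has chosen. -/
def values (cor : Corruption) (b : Box κ n) : Option (SenderOut κ n × ReceiverOut κ n) :=
  match cor with
  | none =>
    if b.started .alice && b.started .bob then
      some ((b.tape.ΔB, b.tape.sender),
        (b.tape.ΔA, fun i => receiverOf b.tape.ΔA b.tape.ΔB (b.tape.sender i) (b.tape.choice i)))
    else none
  | some .alice =>
    if b.started .bob then
      b.choiceA.map fun a =>
        (a, (b.tape.ΔA, fun i => receiverOf b.tape.ΔA a.1 (a.2 i) (b.tape.choice i)))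
    else none
  | some .bob =>
    if b.started .alice then
      b.choiceB.map fun v =>
        ((b.tape.ΔB, fun i => senderOf v.1 b.tape.ΔB (v.2 i) (b.tape.other i)), v)
    else none

/-- The adversary lets the box deliver its output to the honest party `P`. -/
def deliver (cor : Corruption) (b : Box κ n) (P : Party) : Box κ n × Option (Output κ n) :=
  if cor ≠ some P ∧ b.started P = true ∧ b.delivered P = false then
    let b' : Box κ n := { b with delivered := Function.update b.delivered P true }
    if b.failed then (b', some (.fail P))
    else
      match b.values cor, P with
      | none, _ => (b, none)
      | some o, .alice => (b', some (.sender o.1))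
      | some o, .bob => (b', some (.receiver o.2))
  else (b, none)

/-- `LaOT` only: before Bob has received his outputs, a corrupted Alice may guess his choice bit
`c i`; the result says whether the guess was right, and a wrong guess makes the box fail. -/
def guess (cor : Corruption) (b : Box κ n) (i : Fin n) (g : Bit) : Box κ n × Option Bool :=
  if cor = some .alice ∧ b.delivered .bob = false ∧ b.failed = false then
    if b.tape.choice i = g then (b, some true) else ({ b with failed := true }, some false)
  else (b, none)

/-- `aOT` only: if some party is corrupted, the adversary may make the honest party's output be
`fail`, unless it has been delivered already (security with abort). -/
def abort (cor : Corruption) (b : Box κ n) : Box κ n :=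
  if cor.isSome then { b with failed := true } else b

end Box

/-! ## The protocol -/

/-- The bit that Alice reveals when two OTs are combined, with its MAC. -/
def revealed {κ : ℕ} (a a' : SenderView κ) : Bit × Key κ :=
  (a.x₀ + a.x₁ + a'.x₀ + a'.x₁, a.m₀ + a.m₁ + a'.m₀ + a'.m₁)

/-- Bob's local key for the revealed bit. -/
def revealedKey {κ : ℕ} (b b' : ReceiverView κ) : Key κ :=
  b.k₀ + b.k₁ + b'.k₀ + b'.k₁

/-- The combiner `c = c¹ + c²`, `z = z¹ + z² + d c¹`, `x₀ = x₀¹ + x₀²`, `x₁ = x₀¹ + x₁²`,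
on Alice's side. -/
def combineA {κ : ℕ} (a a' : SenderView κ) (d : Bit) : SenderView κ where
  x₀ := a.x₀ + a'.x₀
  x₁ := a.x₀ + a'.x₁
  m₀ := a.m₀ + a'.m₀
  m₁ := a.m₀ + a'.m₁
  kc := a.kc + a'.kc
  kz := a.kz + a'.kz + d • a.kc

/-- The same combiner on Bob's side. -/
def combineB {κ : ℕ} (b b' : ReceiverView κ) (d : Bit) : ReceiverView κ where
  k₀ := b.k₀ + b'.k₀
  k₁ := b.k₀ + b'.k₁
  c := b.c + b'.c
  mc := b.mc + b'.mc
  z := b.z + b'.z + d * b.c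
  mz := b.mz + b'.mz + d • b.mc

/-- The result of combining the OTs `0, …, k` of a bucket, on Alice's side. -/
def foldA {κ : ℕ} (v : ℕ → SenderView κ) : ℕ → SenderView κ
  | 0 => v 0
  | k + 1 => combineA (foldA v k) (v (k + 1)) (revealed (foldA v k) (v (k + 1))).1

/-- The result of combining the OTs `0, …, k` of a bucket, on Bob's side, where `d k` is the bit
revealed when OT `k + 1` is combined into the result so far. -/
def foldB {κ : ℕ} (v : ℕ → ReceiverView κ) (d : ℕ → Bit) : ℕ → ReceiverView κ
  | 0 => v 0
  | k + 1 => combineB (foldB v d k) (v (k + 1)) (d k)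

/-- Bucket `j` consists of the OTs `π (j B), …, π (j B + B - 1)` (counting from `0`). -/
def bucket {α : Type} [Inhabited α] {ℓ B : ℕ} (π : Equiv.Perm (Fin (ℓ * B)))
    (v : Fin (ℓ * B) → α) (j : Fin ℓ) (i : ℕ) : α :=
  if h : i < B then v (π (finProdFinEquiv (j, ⟨i, h⟩))) else default

/-- All revealed bits with their MACs, `B - 1` for every bucket. They do not depend on anything
that Bob sends after `π`, so they form one message. -/
abbrev Reveals (κ ℓ B : ℕ) := Fin ℓ → Fin (B - 1) → Bit × Key κ

section Protocol

variable {κ ℓ B : ℕ}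

def aliceReveals (π : Equiv.Perm (Fin (ℓ * B))) (v : Fin (ℓ * B) → SenderView κ) :
    Reveals κ ℓ B :=
  fun j k => revealed (foldA (bucket π v j) k) (bucket π v j (k + 1))

def aliceResult (π : Equiv.Perm (Fin (ℓ * B))) (v : Fin (ℓ * B) → SenderView κ) :
    Fin ℓ → SenderView κ :=
  fun j => foldA (bucket π v j) (B - 1)

/-- The bits revealed for bucket `j`. -/
def revealedBits (r : Reveals κ ℓ B) (j : Fin ℓ) (k : ℕ) : Bit :=
  if h : k < B - 1 then (r j ⟨k, h⟩).1 else 0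

/-- Bob's check of the MACs of all revealed bits. -/
def BobAccepts (ΔA : Key κ) (π : Equiv.Perm (Fin (ℓ * B))) (v : Fin (ℓ * B) → ReceiverView κ)
    (r : Reveals κ ℓ B) : Prop :=
  ∀ j k, (r j k).2 =
    revealedKey (foldB (bucket π v j) (revealedBits r j) k) (bucket π v j (k + 1))
      + (r j k).1 • ΔA

instance (ΔA : Key κ) (π : Equiv.Perm (Fin (ℓ * B))) (v : Fin (ℓ * B) → ReceiverView κ)
    (r : Reveals κ ℓ B) : Decidable (BobAccepts ΔA π v r) := by
  unfold BobAccepts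
  infer_instance

def bobResult (π : Equiv.Perm (Fin (ℓ * B))) (v : Fin (ℓ * B) → ReceiverView κ)
    (r : Reveals κ ℓ B) : Fin ℓ → ReceiverView κ :=
  fun j => foldB (bucket π v j) (revealedBits r j) (B - 1)

end Protocol

/-! ## What the environment can do and see -/

/-- Attacks of the environment (which also plays the adversary) on the protocol. -/
inductive AdvCmd (κ ℓ B : ℕ) where
  /-- corrupted Alice inputs her values to `LaOT` -/
  | chooseA (v : SenderOut κ (ℓ * B))
  /-- corrupted Bob inputs his values to `LaOT` -/
  | chooseB (v : ReceiverOut κ (ℓ * B))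
  /-- corrupted Alice guesses a choice bit in `LaOT` -/
  | guess (i : Fin (ℓ * B)) (g : Bit)
  | keyQuery (P : Party) (Δ : Key κ)
  /-- let `LaOT` deliver its output to an honest party -/
  | deliverBox (P : Party)
  /-- deliver honest Bob's permutation to honest Alice -/
  | deliverPerm
  /-- deliver honest Alice's revealed bits to honest Bob -/
  | deliverReveals
  /-- corrupted Bob sends a permutation to Alice -/
  | sendPerm (π : Equiv.Perm (Fin (ℓ * B)))
  /-- corrupted Alice sends revealed bits to Bob -/
  | sendReveals (r : Reveals κ ℓ B)

/-- The environment gives an input to an honest party, or attacks. -/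
inductive EnvQuery (κ ℓ B : ℕ) where
  | start (P : Party)
  | attack (c : AdvCmd κ ℓ B)

/-- What the adversary sees in reaction: nothing, an answer of the box, or a message sent by an
honest party over the (authenticated, but not private) channel. -/
inductive Reply (κ ℓ B : ℕ) where
  | silent
  | answer (b : Bool)
  | perm (π : Equiv.Perm (Fin (ℓ * B)))
  | reveals (r : Reveals κ ℓ B)

/-- The reaction to a query: the adversary's view, and the outputs of honest parties. -/
structure Response (κ ℓ B : ℕ) where
  reply : Reply κ ℓ B
  outputs : List (Output κ ℓ)

/-- A probabilistic reactive system. -/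
structure World (Q R : Type) where
  State : Type
  init : PMF State
  step : State → Q → PMF (State × R)

/-- A computationally unbounded probabilistic environment. -/
structure Env (Q R : Type) where
  next : List (Q × R) → PMF Q
  decision : List (Q × R) → PMF Bool

/-- `q` rounds of interaction, starting from state `s` and transcript `h` (latest first). -/
noncomputable def interact {Q R : Type} (Z : Env Q R) (W : World Q R) :
    ℕ → W.State → List (Q × R) → PMF (List (Q × R))
  | 0, _, h => PMF.pure h
  | q + 1, s, h =>
    (Z.next h).bind fun x => (W.step s x).bind fun sr => interact Z W q sr.1 ((x, sr.2) :: h)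

/-- The probability that `Z` outputs `1` after `q` rounds of interaction with `W`. -/
noncomputable def acceptProb {Q R : Type} (Z : Env Q R) (W : World Q R) (q : ℕ) : ℝ :=
  ((W.init.bind fun s => (interact Z W q s []).bind Z.decision) true).toReal

/-! ## The real world: the protocol with the box `LaOT(ℓ B)` -/

structure RealState (κ ℓ B : ℕ) where
  box : Box κ (ℓ * B)
  /-- the permutation that an honest Bob samples -/
  perm : Equiv.Perm (Fin (ℓ * B))
  /-- what honest Alice received from `LaOT` -/
  gotA : Option (SenderOut κ (ℓ * B))
  /-- what honest Bob received from `LaOT`; he then sends `perm` -/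
  gotB : Option (ReceiverOut κ (ℓ * B))
  /-- the message sent by honest Alice -/
  sent : Option (Reveals κ ℓ B)
  doneA : Bool
  doneB : Bool

namespace RealState

variable {κ ℓ B : ℕ}

/-- Honest Alice receives a permutation: she reveals the bits and outputs her results. -/
def receivePerm (s : RealState κ ℓ B) (π : Equiv.Perm (Fin (ℓ * B))) :
    RealState κ ℓ B × Response κ ℓ B :=
  match s.gotA, s.doneA with
  | some (ΔB, v), false =>
    ({ s with sent := some (aliceReveals π v), doneA := true },
      ⟨.reveals (aliceReveals π v), [.sender (ΔB, aliceResult π v)]⟩)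
  | _, _ => (s, ⟨.silent, []⟩)

/-- Honest Bob receives the revealed bits: he checks the MACs, and aborts or outputs his
results. -/
def receiveReveals (s : RealState κ ℓ B) (r : Reveals κ ℓ B) :
    RealState κ ℓ B × Response κ ℓ B :=
  match s.gotB, s.doneB with
  | some (ΔA, v), false =>
    ({ s with doneB := true },
      ⟨.silent, [if BobAccepts ΔA s.perm v r then .receiver (ΔA, bobResult s.perm v r)
        else .fail .bob]⟩)
  | _, _ => (s, ⟨.silent, []⟩)

def attack (cor : Corruption) (s : RealState κ ℓ B) :
    AdvCmd κ ℓ B → RealState κ ℓ B × Response κ ℓ B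
  | .chooseA v => ({ s with box := s.box.chooseA cor v }, ⟨.silent, []⟩)
  | .chooseB v => ({ s with box := s.box.chooseB cor v }, ⟨.silent, []⟩)
  | .guess i g =>
    ({ s with box := (s.box.guess cor i g).1 },
      ⟨((s.box.guess cor i g).2.map Reply.answer).getD .silent, []⟩)
  | .keyQuery P Δ => (s, ⟨.answer (s.box.keyQuery cor P Δ), []⟩)
  | .deliverBox P =>
    let s' : RealState κ ℓ B := { s with box := (s.box.deliver cor P).1 }
    match (s.box.deliver cor P).2 with
    | none => (s', ⟨.silent, []⟩)
    | some (.sender o) => ({ s' with gotA := some o }, ⟨.silent, []⟩)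
    | some (.receiver o) => ({ s' with gotB := some o }, ⟨.perm s.perm, []⟩)
    | some (.fail P') => (s', ⟨.silent, [.fail P']⟩)
  | .deliverPerm =>
    if cor = none ∧ s.gotB.isSome then s.receivePerm s.perm else (s, ⟨.silent, []⟩)
  | .sendPerm π => if cor = some .bob then s.receivePerm π else (s, ⟨.silent, []⟩)
  | .deliverReveals =>
    match cor, s.sent with
    | none, some r => s.receiveReveals r
    | _, _ => (s, ⟨.silent, []⟩)
  | .sendReveals r => if cor = some .alice then s.receiveReveals r else (s, ⟨.silent, []⟩)

def step (cor : Corruption) (s : RealState κ ℓ B) :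
    EnvQuery κ ℓ B → RealState κ ℓ B × Response κ ℓ B
  | .start P => ({ s with box := s.box.start cor P }, ⟨.silent, []⟩)
  | .attack c => s.attack cor c

end RealState

/-- The protocol in the `LaOT(ℓ B)`-hybrid model; honest Bob samples his permutation from `D`. -/
noncomputable def realWorld (κ ℓ B : ℕ) (D : PMF (Equiv.Perm (Fin (ℓ * B)))) (cor : Corruption) :
    World (EnvQuery κ ℓ B) (Response κ ℓ B) where
  State := RealState κ ℓ B
  init := (PMF.uniformOfFintype (Tape κ (ℓ * B))).bind fun t => D.map fun π =>
    ⟨Box.create t, π, none, none, none, false, false⟩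
  step s x := PMF.pure (s.step cor x)

/-! ## Simulators and the ideal world -/

/-- The adversary's commands to the box `aOT(ℓ)`. -/
inductive BoxCmd (κ ℓ : ℕ) where
  | chooseA (v : SenderOut κ ℓ)
  | chooseB (v : ReceiverOut κ ℓ)
  | keyQuery (P : Party) (Δ : Key κ)
  | deliver (P : Party)
  | abort

/-- The reaction of `aOT(ℓ)` to the adversary: new state, answer, and output to an honest party
(which the simulator does not see). -/
def Box.command {κ ℓ : ℕ} (cor : Corruption) (b : Box κ ℓ) :
    BoxCmd κ ℓ → Box κ ℓ × Bool × List (Output κ ℓ)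
  | .chooseA v => (b.chooseA cor v, false, [])
  | .chooseB v => (b.chooseB cor v, false, [])
  | .keyQuery P Δ => (b, b.keyQuery cor P Δ, [])
  | .deliver P => ((b.deliver cor P).1, false, (b.deliver cor P).2.toList)
  | .abort => (b.abort cor, false, [])

/-- What activates the simulator: `aOT` reporting the input of an honest party, an attack of the
environment, or the answer of `aOT` to its last command. -/
inductive SimInput (κ ℓ B : ℕ) where
  | started (P : Party)
  | attack (c : AdvCmd κ ℓ B)
  | answer (b : Bool)

/-- The simulator gives a command to `aOT`, or replies to the environment. -/
inductive SimAction (κ ℓ B : ℕ) where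
  | call (c : BoxCmd κ ℓ)
  | reply (r : Reply κ ℓ B)

/-- A simulator: its state is a string of bits, and in every step it may use fair coins and a
fresh sample of the distribution of permutations used by the protocol. -/
structure Simulator (κ ℓ B : ℕ) where
  Mem : Type
  fin : Fintype Mem
  coins : ℕ
  /-- bound on the number of steps per activation by the environment -/
  steps : ℕ
  init : Mem → Bool
  next : (Mem → Bool) × SimInput κ ℓ B × (Fin coins → Bool) × Equiv.Perm (Fin (ℓ * B)) →
    (Mem → Bool) × SimAction κ ℓ B

/-- One activation of the simulator, with at most `k` steps left. -/
noncomputable def Simulator.activate {κ ℓ B : ℕ} (S : Simulator κ ℓ B)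
    (D : PMF (Equiv.Perm (Fin (ℓ * B)))) (cor : Corruption) :
    ℕ → (S.Mem → Bool) × Box κ ℓ → SimInput κ ℓ B →
      PMF (((S.Mem → Bool) × Box κ ℓ) × Response κ ℓ B)
  | 0, s, _ => PMF.pure (s, ⟨.silent, []⟩)
  | k + 1, (m, b), i =>
    (PMF.uniformOfFintype (Fin S.coins → Bool)).bind fun ρ => D.bind fun π =>
      match S.next (m, i, ρ, π) with
      | (m', .reply r) => PMF.pure ((m', b), ⟨r, []⟩)
      | (m', .call c) =>
        (S.activate D cor k (m', (b.command cor c).1) (.answer (b.command cor c).2.1)).map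
          fun sr => (sr.1, ⟨sr.2.reply, (b.command cor c).2.2 ++ sr.2.outputs⟩)

/-- The box `aOT(ℓ)` together with a simulator. -/
noncomputable def idealWorld {κ ℓ B : ℕ} (S : Simulator κ ℓ B)
    (D : PMF (Equiv.Perm (Fin (ℓ * B)))) (cor : Corruption) :
    World (EnvQuery κ ℓ B) (Response κ ℓ B) where
  State := (S.Mem → Bool) × Box κ ℓ
  init := (PMF.uniformOfFintype (Tape κ ℓ)).map fun t => (S.init, Box.create t)
  step s x :=
    match x with
    | .start P =>
      if cor = some P then PMF.pure (s, ⟨.silent, []⟩)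
      else S.activate D cor S.steps (s.1, s.2.start cor P) (.started P)
    | .attack c => S.activate D cor S.steps s (.attack c)

/-! ## Computational cost of a simulator: Boolean circuits -/

/-- An encoding of the elements of a type by the values on finitely many wires. -/
class Wired (α : Type) where
  Wire : Type
  fin : Fintype Wire
  enc : α → Wire → Bool
  enc_injective : Function.Injective enc

/-- Encode through an injection. -/
@[reducible] def Wired.via {α β : Type} [Wired β] (f : α → β) (hf : Function.Injective f) :
    Wired α where
  Wire := Wired.Wire β
  fin := Wired.fin
  enc := fun a => Wired.enc (f a)
  enc_injective := Wired.enc_injective.comp hf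

instance : Wired Unit where
  Wire := Empty
  fin := inferInstance
  enc := fun _ w => w.elim
  enc_injective := fun _ _ _ => rfl

instance : Wired Bool where
  Wire := Unit
  fin := inferInstance
  enc := fun b _ => b
  enc_injective := fun _ _ h => congrFun h ()

instance : Wired Bit := Wired.via (fun x : Bit => decide (x = 1)) (by decide)

instance : Wired Party := Wired.via (fun P => decide (P = .bob)) (by
  rintro ⟨⟩ ⟨⟩ h <;> simp_all)

/-- Numbers below `n` are encoded in unary. -/
instance (n : ℕ) : Wired (Fin n) where
  Wire := Fin n
  fin := inferInstance
  enc := fun i j => decide (i = j)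
  enc_injective := fun i i' h => by
    have := congrFun h i'
    simpa using this

instance {α β : Type} [Wired α] [Wired β] : Wired (α × β) where
  Wire := Wired.Wire α ⊕ Wired.Wire β
  fin := @instFintypeSum _ _ Wired.fin Wired.fin
  enc := fun p => Sum.elim (Wired.enc p.1) (Wired.enc p.2)
  enc_injective := fun _ _ h => Prod.ext
    (Wired.enc_injective (funext fun w => congrFun h (Sum.inl w)))
    (Wired.enc_injective (funext fun w => congrFun h (Sum.inr w)))

/-- One wire tells the two summands apart; the wires of the other summand carry `false`. -/
instance {α β : Type} [Wired α] [Wired β] : Wired (α ⊕ β) where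
  Wire := Unit ⊕ (Wired.Wire α ⊕ Wired.Wire β)
  fin := @instFintypeSum _ _ inferInstance (@instFintypeSum _ _ Wired.fin Wired.fin)
  enc := fun s => match s with
    | .inl a => Sum.elim (fun _ => false) (Sum.elim (Wired.enc a) (fun _ => false))
    | .inr b => Sum.elim (fun _ => true) (Sum.elim (fun _ => false) (Wired.enc b))
  enc_injective := by
    rintro (a | b) (a' | b') h
    · exact congrArg Sum.inl
        (Wired.enc_injective (funext fun w => congrFun h (Sum.inr (Sum.inl w))))
    · simpa using congrFun h (Sum.inl ())
    · simpa using congrFun h (Sum.inl ())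
    · exact congrArg Sum.inr
        (Wired.enc_injective (funext fun w => congrFun h (Sum.inr (Sum.inr w))))

instance {ι α : Type} [Fintype ι] [Wired α] : Wired (ι → α) where
  Wire := ι × Wired.Wire α
  fin := @instFintypeProd _ _ _ Wired.fin
  enc := fun f w => Wired.enc (f w.1) w.2
  enc_injective := fun _ _ h => funext fun i =>
    Wired.enc_injective (funext fun w => congrFun h (i, w))

instance (n : ℕ) : Wired (Equiv.Perm (Fin n)) :=
  Wired.via (fun π : Equiv.Perm (Fin n) => (π : Fin n → Fin n)) DFunLike.coe_injective

instance (κ : ℕ) : Wired (SenderView κ) := Wired.via _ SenderView.toTuple_injective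

instance (κ : ℕ) : Wired (ReceiverView κ) := Wired.via _ ReceiverView.toTuple_injective

def AdvCmd.toSum {κ ℓ B : ℕ} : AdvCmd κ ℓ B →
    SenderOut κ (ℓ * B) ⊕ ReceiverOut κ (ℓ * B) ⊕ (Fin (ℓ * B) × Bit) ⊕ (Party × Key κ) ⊕ Party ⊕
      Unit ⊕ Unit ⊕ Equiv.Perm (Fin (ℓ * B)) ⊕ Reveals κ ℓ B
  | .chooseA v => .inl v
  | .chooseB v => .inr (.inl v)
  | .guess i g => .inr (.inr (.inl (i, g)))
  | .keyQuery P Δ => .inr (.inr (.inr (.inl (P, Δ))))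
  | .deliverBox P => .inr (.inr (.inr (.inr (.inl P))))
  | .deliverPerm => .inr (.inr (.inr (.inr (.inr (.inl ())))))
  | .deliverReveals => .inr (.inr (.inr (.inr (.inr (.inr (.inl ()))))))
  | .sendPerm π => .inr (.inr (.inr (.inr (.inr (.inr (.inr (.inl π)))))))
  | .sendReveals r => .inr (.inr (.inr (.inr (.inr (.inr (.inr (.inr r)))))))

instance (κ ℓ B : ℕ) : Wired (AdvCmd κ ℓ B) := Wired.via AdvCmd.toSum (by
  rintro ⟨⟩ ⟨⟩ h <;> simp_all [AdvCmd.toSum])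

def BoxCmd.toSum {κ ℓ : ℕ} : BoxCmd κ ℓ →
    SenderOut κ ℓ ⊕ ReceiverOut κ ℓ ⊕ (Party × Key κ) ⊕ Party ⊕ Unit
  | .chooseA v => .inl v
  | .chooseB v => .inr (.inl v)
  | .keyQuery P Δ => .inr (.inr (.inl (P, Δ)))
  | .deliver P => .inr (.inr (.inr (.inl P)))
  | .abort => .inr (.inr (.inr (.inr ())))

instance (κ ℓ : ℕ) : Wired (BoxCmd κ ℓ) := Wired.via BoxCmd.toSum (by
  rintro ⟨⟩ ⟨⟩ h <;> simp_all [BoxCmd.toSum])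

def Reply.toSum {κ ℓ B : ℕ} : Reply κ ℓ B →
    Unit ⊕ Bool ⊕ Equiv.Perm (Fin (ℓ * B)) ⊕ Reveals κ ℓ B
  | .silent => .inl ()
  | .answer b => .inr (.inl b)
  | .perm π => .inr (.inr (.inl π))
  | .reveals r => .inr (.inr (.inr r))

instance (κ ℓ B : ℕ) : Wired (Reply κ ℓ B) := Wired.via Reply.toSum (by
  rintro ⟨⟩ ⟨⟩ h <;> simp_all [Reply.toSum])

def SimInput.toSum {κ ℓ B : ℕ} : SimInput κ ℓ B → Party ⊕ AdvCmd κ ℓ B ⊕ Bool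
  | .started P => .inl P
  | .attack c => .inr (.inl c)
  | .answer b => .inr (.inr b)

instance (κ ℓ B : ℕ) : Wired (SimInput κ ℓ B) := Wired.via SimInput.toSum (by
  rintro ⟨⟩ ⟨⟩ h <;> simp_all [SimInput.toSum])

def SimAction.toSum {κ ℓ B : ℕ} : SimAction κ ℓ B → BoxCmd κ ℓ ⊕ Reply κ ℓ B
  | .call c => .inl c
  | .reply r => .inr r

instance (κ ℓ B : ℕ) : Wired (SimAction κ ℓ B) := Wired.via SimAction.toSum (by
  rintro ⟨⟩ ⟨⟩ h <;> simp_all [SimAction.toSum])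

/-- The input wires of `α`, as Boolean functions. -/
def inputs (α : Type) [Wired α] : Set (α → Bool) :=
  Set.range fun (w : Wired.Wire α) (a : α) => Wired.enc a w

/-- `gs` lists, last gate first, the functions computed by the gates of a Boolean circuit with
constants and NAND gates, whose gates may use the functions in `I` and earlier gates. -/
inductive IsCircuit {α : Type} (I : Set (α → Bool)) : List (α → Bool) → Prop where
  | nil : IsCircuit I []
  | const {gs : List (α → Bool)} (h : IsCircuit I gs) (b : Bool) :
      IsCircuit I ((fun _ => b) :: gs)
  | nand {gs : List (α → Bool)} (h : IsCircuit I gs) {u v : α → Bool}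
      (hu : u ∈ gs ∨ u ∈ I) (hv : v ∈ gs ∨ v ∈ I) :
      IsCircuit I ((fun a => !(u a && v a)) :: gs)

/-- `f` is computed by a Boolean circuit with at most `N` gates. -/
def HasCircuit {α β : Type} [Wired α] [Wired β] (f : α → β) (N : ℕ) : Prop :=
  ∃ gs : List (α → Bool), IsCircuit (inputs α) gs ∧ gs.length ≤ N ∧
    ∀ w : Wired.Wire β, (fun a => Wired.enc (f a) w) ∈ gs ∨ (fun a => Wired.enc (f a) w) ∈ inputs α

/-- The memory, the coins per step, the steps per activation, and the circuit size of a step are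
all at most `N`. -/
def Simulator.CostAtMost {κ ℓ B : ℕ} (S : Simulator κ ℓ B) (N : ℕ) : Prop :=
  letI := S.fin
  Fintype.card S.Mem ≤ N ∧ S.coins ≤ N ∧ S.steps ≤ N ∧ HasCircuit S.next N

/-! ## The security notion -/

/-- `k`-wise independence of a random permutation: the images of any `k` distinct points are
uniformly distributed over all `k`-tuples of distinct points. -/
def IsWiseIndependent {n : ℕ} (k : ℕ) (D : PMF (Equiv.Perm (Fin n))) : Prop :=
  ∀ f g : Fin k ↪ Fin n,
    (D.map fun π => f.trans π.toEmbedding) g = (Fintype.card (Fin k ↪ Fin n) : ENNReal)⁻¹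

/-- The protocol with permutations from `D` securely implements `aOT(ℓ)` in the
`LaOT(ℓ B)`-hybrid model with security parameter `ψ`, where the polynomial `p` bounds the cost of
the simulators, and `p(q) 2^(-ψ)` the advantage of environments that interact for `q` rounds. -/
def SecurelyImplements (κ ℓ B : ℕ) (D : PMF (Equiv.Perm (Fin (ℓ * B)))) (ψ : ℕ)
    (p : Polynomial ℕ) : Prop :=
  ∀ cor : Corruption, ∃ S : Simulator κ ℓ B, S.CostAtMost (p.eval (κ + ℓ + B)) ∧
    ∀ (Z : Env (EnvQuery κ ℓ B) (Response κ ℓ B)) (q : ℕ),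
      |acceptProb Z (realWorld κ ℓ B D cor) q - acceptProb Z (idealWorld S D cor) q| ≤
        ((p.eval q : ℕ) : ℝ) / 2 ^ ψ

end AOT

/-! The algebra of the combiner. Put s = x₀ + x₁ for a quadruple. The combination of two quadruples
has difference s², the revealed bit is d = s¹ + s², and the correction d c¹ turns c¹s¹ into c¹s², so
the result is again a valid OT (`combineB_receiverOf`). The bit x₁ of the first quadruple and its
MAC occur only in the revealed pair and not in the result. Hence the map from a bucket to its result
together with all revealed bits and MACs carries the uniform distribution to the uniform one
(`regular_foldTuple`, `regular_alice`).

Nobody corrupted: by this uniformity the transcript is independent of the outputs, so a simulator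
that sends a random permutation and random revealed pairs is perfect.

Bob corrupted: he knows his keys and Δ_A, so a revealed bit determines its MAC. The simulator draws
the revealed bits at random, computes the MACs (`forge`) and inputs Bob's combined values to aOT.
Alice's unselected bits in a bucket correspond bijectively to the revealed bits and the unselected
result bit (`bijective_revealed`), so the simulated joint distribution is right.

Alice corrupted: the simulator answers guesses by lazily sampled choice bits, computes the only
correct revealed pairs from Alice's inputs, and aborts on any others. Two things can go wrong.
First, a wrong bit with an accepted MAC determines Δ_A, which is uniform; this costs 2^(-κ), like a
key query. Second, some bucket may have all its choice bits leaked; otherwise each combined choice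
bit contains a fresh uniform summand (`regular_bucketSum`). Leaking k bits succeeds with probability
2^(-k), and afterwards B-wise independence and a union bound give at most ℓ C(k,B) / C(ℓB,B) for a
bad bucket. The product is largest at k = 2B, where it is at most ℓ 4^(-B) (2/ℓ)^B = (2ℓ)^(-(B-1))/2
if ℓ ≥ 2, and ℓ = 1 is checked directly (`mul_descFactorial_le`). The hypothesis says exactly that
(2ℓ)^(B-1) ≥ 2^ψ.

The environment is adaptive, so these estimates are organised by `Coupling`. Its states are what the
environment knows; both worlds are mixtures over hidden data given that knowledge, with a common
secret key θ. Each round may be wrong for few values of θ, and a potential Φ that does not grow on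
average accounts for the remaining failures. For Alice, Φ is 2^k/2^ψ before the permutation is known
and the indicator of a bad bucket afterwards. `sum_outcome_sub_le` turns such data into a bound on
the advantage.

The complexity claims use a calculus of circuit sizes (`Cx`), where every wire costs at most a fixed
power of κ + ℓ + B + 2. Simulators are written as `Strategy` on structured memory, and encodings
that exhaust all bit strings make the passage to bits free. -/

namespace AOT

/-! ## Circuit complexity of Boolean functions -/

section Circuits

variable {α : Type} {I : Set (α → Bool)}

theorem IsCircuit.append {gs hs : List (α → Bool)} (hg : IsCircuit I gs) (hh : IsCircuit I hs) :
    IsCircuit I (gs ++ hs) := by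
  induction hg with
  | nil => exact hh
  | const _ b ih => exact ih.const b
  | nand _ hu hv ih =>
    refine ih.nand (hu.imp_left fun h => ?_) (hv.imp_left fun h => ?_) <;>
    exact List.mem_append_left _ h

/-- `f` is computed by a circuit with at most `N` gates over the functions in `I`. -/
def Computes (I : Set (α → Bool)) (f : α → Bool) (N : ℕ) : Prop :=
  ∃ gs, IsCircuit I gs ∧ gs.length ≤ N ∧ (f ∈ gs ∨ f ∈ I)

namespace Computes

variable {f g c : α → Bool} {N M K : ℕ}

theorem mono (h : Computes I f N) (hNM : N ≤ M) : Computes I f M := by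
  obtain ⟨gs, h1, h2, h3⟩ := h
  exact ⟨gs, h1, h2.trans hNM, h3⟩

theorem input (h : f ∈ I) : Computes I f 0 := ⟨[], .nil, le_rfl, Or.inr h⟩

theorem const (b : Bool) : Computes I (fun _ => b) 1 :=
  ⟨_, IsCircuit.nil.const b, le_rfl, Or.inl (by simp)⟩

theorem nand (hf : Computes I f N) (hg : Computes I g M) :
    Computes I (fun a => !(f a && g a)) (N + M + 1) := by
  obtain ⟨gs, h1, h2, h3⟩ := hf
  obtain ⟨hs, k1, k2, k3⟩ := hg
  refine ⟨_, (h1.append k1).nand (h3.imp_left fun h => List.mem_append_left _ h)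
    (k3.imp_left fun h => List.mem_append_right _ h), ?_, Or.inl (by simp)⟩
  simp only [List.length_cons, List.length_append]
  omega

theorem not (hf : Computes I f N) : Computes I (fun a => !f a) (N + 1) := by
  obtain ⟨gs, h1, h2, h3⟩ := hf
  refine ⟨_, h1.nand h3 h3, by simpa using h2, Or.inl ?_⟩
  simp

theorem and (hf : Computes I f N) (hg : Computes I g M) :
    Computes I (fun a => f a && g a) (N + M + 2) := by
  simpa using (hf.nand hg).not

theorem or (hf : Computes I f N) (hg : Computes I g M) :
    Computes I (fun a => f a || g a) (N + M + 3) := by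
  have h := (hf.not.nand hg.not).mono (M := N + M + 3) (by omega)
  simpa using h

/-- Subcircuits are concatenated without sharing, so the condition, which is used twice, is counted
twice. -/
theorem ite (hc : Computes I c K) (hf : Computes I f N) (hg : Computes I g M) :
    Computes I (fun a => if c a = true then f a else g a) (2 * K + N + M + 8) := by
  have h := ((hc.and hf).or (hc.not.and hg)).mono (M := 2 * K + N + M + 8) (by omega)
  convert h using 2 with a
  cases c a <;> simp

theorem xor (hf : Computes I f N) (hg : Computes I g M) :
    Computes I (fun a => Bool.xor (f a) (g a)) (2 * N + 2 * M + 9) := by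
  have h := (hf.ite hg.not hg).mono (M := 2 * N + 2 * M + 9) (by omega)
  convert h using 2 with a
  cases f a <;> simp

theorem any {ι : Type} (s : Finset ι) {u : ι → α → Bool} (h : ∀ i ∈ s, Computes I (u i) N)
    (hf : ∀ a, f a = true ↔ ∃ i ∈ s, u i a = true) : Computes I f (s.card * (N + 3) + 1) := by
  classical
  induction s using Finset.induction_on generalizing f with
  | empty =>
    obtain rfl : f = fun _ => false := funext fun a => by simpa using hf a
    simpa using const (I := I) false
  | insert i s hi ih =>
    have h1 := (h i (by simp)).or (ih (f := fun a => decide (∃ i ∈ s, u i a = true))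
      (fun j hj => h j (by simp [hj])) (by simp))
    refine (Eq.subst (motive := fun f => Computes I f _) ?_ h1).mono
      (M := (insert i s).card * (N + 3) + 1) ?_
    · funext a
      rw [Bool.eq_iff_iff, hf]
      simp
    · rw [Finset.card_insert_of_notMem hi]; ring_nf; omega

theorem all {ι : Type} (s : Finset ι) {u : ι → α → Bool} (h : ∀ i ∈ s, Computes I (u i) N)
    (hf : ∀ a, f a = true ↔ ∀ i ∈ s, u i a = true) : Computes I f (s.card * (N + 4) + 2) := by
  have := (any s (f := fun a => !f a) (fun i hi => (h i hi).not) fun a => by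
    rw [Bool.not_eq_true', ← Bool.not_eq_true, hf]; simp).not
  simpa using this

end Computes

/-- Substitution of inputs in a circuit: `R a a'` says that the inputs `e w` at `a'` have the
values of the inputs `σ w` at `a`. -/
theorem IsCircuit.transfer {β W : Type} {e : W → β → Bool} {σ : W → α → Bool}
    (hσ : ∀ w, σ w ∈ I) {gs : List (β → Bool)} (h : IsCircuit (Set.range e) gs) :
    ∃ hs, IsCircuit I hs ∧ hs.length = gs.length ∧ ∀ g, (g ∈ gs ∨ g ∈ Set.range e) →
      ∃ g', (g' ∈ hs ∨ g' ∈ I) ∧ ∀ a b, (∀ w, e w b = σ w a) → g b = g' a := by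
  induction h with
  | nil =>
    refine ⟨[], .nil, rfl, fun g hg => ?_⟩
    obtain ⟨w, rfl⟩ : g ∈ Set.range e := by simpa using hg
    exact ⟨σ w, Or.inr (hσ w), fun a b h => h w⟩
  | @const gs _ b ih =>
    obtain ⟨hs, h1, h2, h3⟩ := ih
    refine ⟨_, h1.const b, by simp [h2], fun g hg => ?_⟩
    rcases hg with hg | hg
    · rcases List.mem_cons.1 hg with rfl | hg
      · exact ⟨fun _ => b, Or.inl (by simp), fun _ _ _ => rfl⟩
      · obtain ⟨g', hg', h⟩ := h3 g (Or.inl hg)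
        exact ⟨g', hg'.imp_left fun h => List.mem_cons_of_mem _ h, h⟩
    · obtain ⟨g', hg', h⟩ := h3 g (Or.inr hg)
      exact ⟨g', hg'.imp_left fun h => List.mem_cons_of_mem _ h, h⟩
  | @nand gs _ u v hu hv ih =>
    obtain ⟨hs, h1, h2, h3⟩ := ih
    obtain ⟨u', hu', eu⟩ := h3 u hu
    obtain ⟨v', hv', ev⟩ := h3 v hv
    refine ⟨_, h1.nand hu' hv', by simp [h2], fun g hg => ?_⟩
    rcases hg with hg | hg
    · rcases List.mem_cons.1 hg with rfl | hg
      · exact ⟨fun a => !(u' a && v' a), Or.inl (by simp), fun a b h => by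
          simp only [eu a b h, ev a b h]⟩
      · obtain ⟨g', hg', h⟩ := h3 g (Or.inl hg)
        exact ⟨g', hg'.imp_left fun h => List.mem_cons_of_mem _ h, h⟩
    · obtain ⟨g', hg', h⟩ := h3 g (Or.inr hg)
      exact ⟨g', hg'.imp_left fun h => List.mem_cons_of_mem _ h, h⟩

end Circuits

/-! ## Circuits between encoded types

Sizes are counted per output wire, as powers of a base `s + 2`. -/

/-- Every output wire of `f` has a circuit with at most `(s + 2) ^ k` gates. -/
def Cx (s k : ℕ) {α β : Type} [Wired α] [Wired β] (f : α → β) : Prop :=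
  ∀ w : Wired.Wire β, Computes (inputs α) (fun a => Wired.enc (f a) w) ((s + 2) ^ k)

/-- Every output wire of `h` is an input wire. -/
def IsWiring {α β : Type} [Wired α] [Wired β] (h : α → β) : Prop :=
  ∀ w : Wired.Wire β, (fun a => Wired.enc (h a) w) ∈ inputs α

theorem pow_bound (s k c j : ℕ) (hc : c ≤ 2 ^ j) : c * (s + 2) ^ k ≤ (s + 2) ^ (k + j) := by
  rw [pow_add, mul_comm]
  exact Nat.mul_le_mul_left _ (hc.trans (Nat.pow_le_pow_left (by omega) _))

theorem one_le_base_pow (s k : ℕ) : 1 ≤ (s + 2) ^ k := Nat.one_le_pow _ _ (by omega)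

theorem base_pow_mono (s : ℕ) {k k' : ℕ} (h : k ≤ k') : (s + 2) ^ k ≤ (s + 2) ^ k' :=
  Nat.pow_le_pow_right (by omega) h

/-- The overheads 4 per term and 2 in total are those of `Computes.all`; they also dominate those of
`Computes.any`. -/
theorem card_mul_bound {s k c m j : ℕ} (hm : m ≤ (s + 2) ^ j) (hc : c ≤ 2) :
    m * ((s + 2) ^ k + 4) + c ≤ (s + 2) ^ (j + k + 4) := by
  have h1 := one_le_base_pow s k
  have h2 : m * ((s + 2) ^ k + 4) ≤ (s + 2) ^ j * ((s + 2) ^ k * 5) :=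
    Nat.mul_le_mul hm (by omega)
  have h3 := pow_bound s (j + k) 7 4 (by norm_num)
  have h4 := one_le_base_pow s (j + k)
  have h5 : (s + 2) ^ j * ((s + 2) ^ k * 5) = 5 * (s + 2) ^ (j + k) := by rw [pow_add]; ring
  omega

section Wiring

variable {α β γ δ : Type} [Wired α] [Wired β] [Wired γ] [Wired δ]

theorem IsWiring.comp {g : β → γ} {f : α → β} (hg : IsWiring g) (hf : IsWiring f) :
    IsWiring (fun a => g (f a)) := by
  intro w
  obtain ⟨v, hv⟩ := hg w
  obtain ⟨u, hu⟩ := hf v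
  refine ⟨u, ?_⟩
  funext a
  exact (congrFun hu a).trans (congrFun hv (f a))

theorem isWiring_fst : IsWiring (Prod.fst : α × β → α) := fun w => ⟨Sum.inl w, rfl⟩

theorem isWiring_snd : IsWiring (Prod.snd : α × β → β) := fun w => ⟨Sum.inr w, rfl⟩

theorem IsWiring.fst {f : α → β × γ} (h : IsWiring f) : IsWiring (fun a => (f a).1) :=
  isWiring_fst.comp h

theorem IsWiring.snd {f : α → β × γ} (h : IsWiring f) : IsWiring (fun a => (f a).2) :=
  isWiring_snd.comp h

theorem IsWiring.prodMk {f : α → β} {g : α → γ} (hf : IsWiring f) (hg : IsWiring g) :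
    IsWiring (fun a => (f a, g a)) := by
  rintro (w | w)
  · exact hf w
  · exact hg w

theorem IsWiring.apply {ι : Type} [Fintype ι] {f : α → ι → β} (hf : IsWiring f) (i : ι) :
    IsWiring fun a => f a i := fun w => hf (i, w)

end Wiring

namespace Cx

variable {s : ℕ} {α β γ δ : Type} [Wired α] [Wired β] [Wired γ] [Wired δ] {k k' k'' : ℕ}

theorem mono {f : α → β} (h : Cx s k f) (hk : k ≤ k') : Cx s k' f :=
  fun w => (h w).mono (base_pow_mono s hk)

theorem of_isWiring {f : α → β} (h : IsWiring f) : Cx s 0 f :=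
  fun w => (Computes.input (h w)).mono (Nat.zero_le _)

theorem const (b : β) : Cx s 0 (fun _ : α => b) :=
  fun w => (Computes.const (Wired.enc b w)).mono (one_le_base_pow s 0)

/-- A wiring only renames inputs, so no gate is added. -/
theorem comp_wiring {g : β → γ} {f : α → β} (hg : Cx s k g) (hf : IsWiring f) :
    Cx s k (fun a => g (f a)) := by
  intro w
  obtain ⟨gs, h1, h2, h3⟩ := hg w
  obtain ⟨hs, k1, k2, k3⟩ := h1.transfer (I := inputs α)
    (σ := fun v a => Wired.enc (f a) v) hf
  obtain ⟨g', hg', h⟩ := k3 _ h3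
  refine ⟨hs, k1, k2.le.trans h2, ?_⟩
  have : (fun a => Wired.enc (g (f a)) w) = g' := by
    funext a
    exact h a (f a) fun _ => rfl
  rwa [this]

theorem fst {f : α → β × γ} (h : Cx s k f) : Cx s k (fun a => (f a).1) :=
  fun w => h (Sum.inl w)

theorem snd {f : α → β × γ} (h : Cx s k f) : Cx s k (fun a => (f a).2) :=
  fun w => h (Sum.inr w)

theorem prodMk {f : α → β} {g : α → γ} (hf : Cx s k f) (hg : Cx s k' g) :
    Cx s (max k k') (fun a => (f a, g a)) := by
  rintro (w | w)
  · exact hf.mono (le_max_left _ _) w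
  · exact hg.mono (le_max_right _ _) w

theorem pi {ι : Type} [Fintype ι] {f : α → ι → β} (h : ∀ i, Cx s k (fun a => f a i)) :
    Cx s k f := fun w => h w.1 w.2

theorem apply {ι : Type} [Fintype ι] {f : α → ι → β} (h : Cx s k f) (i : ι) :
    Cx s k (fun a => f a i) := fun w => h (i, w)

theorem inl {f : α → β} (h : Cx s k f) : Cx s k (fun a => (Sum.inl (f a) : β ⊕ γ)) := by
  rintro (w | w | w)
  · exact (Computes.const false).mono (one_le_base_pow s k)
  · exact h w
  · exact (Computes.const false).mono (one_le_base_pow s k)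

theorem inr {f : α → γ} (h : Cx s k f) : Cx s k (fun a => (Sum.inr (f a) : β ⊕ γ)) := by
  rintro (w | w | w)
  · exact (Computes.const true).mono (one_le_base_pow s k)
  · exact (Computes.const false).mono (one_le_base_pow s k)
  · exact h w

theorem ite {c : α → Bool} {f g : α → β} (hc : Cx s k c) (hf : Cx s k' f) (hg : Cx s k'' g) :
    Cx s (max k (max k' k'') + 4) (fun a => if c a = true then f a else g a) := by
  intro w
  set K := max k (max k' k'')
  have h := (hc.mono (le_max_left k _ : k ≤ K) ()).ite
    (hf.mono ((le_max_left k' k'').trans (le_max_right k _) : k' ≤ K) w)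
    (hg.mono ((le_max_right k' k'').trans (le_max_right k _) : k'' ≤ K) w)
  have e : (fun a => Wired.enc (if c a = true then f a else g a) w) =
      fun a => if Wired.enc (c a) () = true then Wired.enc (f a) w else Wired.enc (g a) w := by
    funext a
    change _ = if c a = true then _ else _
    split <;> rfl
  rw [e]
  refine h.mono ?_
  have h1 := one_le_base_pow s K
  have h2 := pow_bound s K 12 4 (by norm_num)
  change 2 * (s + 2) ^ K + (s + 2) ^ K + (s + 2) ^ K + 8 ≤ (s + 2) ^ (K + 4)
  omega

theorem not {f : α → Bool} (hf : Cx s k f) : Cx s (k + 1) (fun a => !f a) := by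
  intro w
  refine (hf w).not.mono ?_
  have h1 := one_le_base_pow s k
  have h2 := pow_bound s k 2 1 (by norm_num)
  omega

theorem and {f g : α → Bool} (hf : Cx s k f) (hg : Cx s k' g) :
    Cx s (max k k' + 2) (fun a => f a && g a) := by
  intro w
  refine ((hf.mono (le_max_left k k') w).and (hg.mono (le_max_right k k') w)).mono ?_
  have h1 := one_le_base_pow s (max k k')
  have h2 := pow_bound s (max k k') 4 2 (by norm_num)
  omega

theorem add {f g : α → Bit} (hf : Cx s k f) (hg : Cx s k' g) :
    Cx s (max k k' + 4) (fun a => f a + g a) := by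
  intro w
  have h := (hf.mono (le_max_left k k') w).xor (hg.mono (le_max_right k k') w)
  have e : (fun a => Wired.enc (f a + g a) w) =
      fun a => Bool.xor (Wired.enc (f a) w) (Wired.enc (g a) w) := by
    funext a
    have : ∀ x y : Bit, decide (x + y = 1) = Bool.xor (decide (x = 1)) (decide (y = 1)) := by
      decide
    exact this _ _
  rw [e]
  refine h.mono ?_
  have h1 := one_le_base_pow s (max k k')
  have h2 := pow_bound s (max k k') 13 4 (by norm_num)
  omega

theorem mul {f g : α → Bit} (hf : Cx s k f) (hg : Cx s k' g) :
    Cx s (max k k' + 2) (fun a => f a * g a) := by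
  intro w
  have h := (hf.mono (le_max_left k k') w).and (hg.mono (le_max_right k k') w)
  have e : (fun a => Wired.enc (f a * g a) w) =
      fun a => (Wired.enc (f a) w && Wired.enc (g a) w) := by
    funext a
    have : ∀ x y : Bit, decide (x * y = 1) = (decide (x = 1) && decide (y = 1)) := by
      decide
    exact this _ _
  rw [e]
  refine h.mono ?_
  have h1 := one_le_base_pow s (max k k')
  have h2 := pow_bound s (max k k') 4 2 (by norm_num)
  omega

theorem add_key {ι : Type} [Fintype ι] {f g : α → ι → Bit} (hf : Cx s k f) (hg : Cx s k' g) :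
    Cx s (max k k' + 4) (fun a => f a + g a) :=
  pi fun i => (hf.apply i).add (hg.apply i)

theorem smul_key {ι : Type} [Fintype ι] {f : α → Bit} {g : α → ι → Bit} (hf : Cx s k f)
    (hg : Cx s k' g) : Cx s (max k k' + 2) (fun a => f a • g a) :=
  pi fun i => hf.mul (hg.apply i)

/-- Iterating `Computes.xor` would double the size with every summand. Here the two circuits are
written down once and joined by four NAND gates that share intermediate results, so sizes add up. -/
theorem sum {ι : Type} (t : Finset ι) {j : ℕ} (ht : t.card ≤ (s + 2) ^ j) {f : ι → α → Bit}
    (hf : ∀ i ∈ t, Cx s k (f i)) : Cx s (j + k + 5) (fun a => ∑ i ∈ t, f i a) := by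
  classical
  have main : ∀ t : Finset ι, (∀ i ∈ t, Cx s k (f i)) →
      Computes (inputs α) (fun a => Wired.enc (∑ i ∈ t, f i a) ())
        (t.card * (2 * (s + 2) ^ k + 17) + 1) := by
    intro t
    induction t using Finset.induction_on with
    | empty =>
      intro _
      simpa using Computes.const (I := inputs α) (Wired.enc (0 : Bit) ())
    | insert i t hi ih =>
      intro h
      obtain ⟨gs, a1, a2, a3⟩ := h i (by simp) ()
      obtain ⟨hs, b1, b2, b3⟩ := ih fun j hj => h j (by simp [hj])
      set u := fun a => Wired.enc (f i a) ()
      set v := fun a => Wired.enc (∑ i ∈ t, f i a) ()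
      have hu : u ∈ gs ++ hs ∨ u ∈ inputs α := a3.imp_left fun h => List.mem_append_left _ h
      have hv : v ∈ gs ++ hs ∨ v ∈ inputs α := b3.imp_left fun h => List.mem_append_right _ h
      have c1 := (a1.append b1).nand hu hv
      have c2 := c1.nand (hu.imp_left fun h => List.mem_cons_of_mem _ h)
        (Or.inl (List.mem_cons_self ..))
      have c3 := c2.nand (v := fun a => !(u a && v a))
        (hv.imp_left fun h => List.mem_cons_of_mem _ (List.mem_cons_of_mem _ h))
        (Or.inl (List.mem_cons_of_mem _ (List.mem_cons_self ..)))
      have c4 := c3.nand (u := fun a => !(u a && !(u a && v a)))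
        (v := fun a => !(v a && !(u a && v a)))
        (Or.inl (List.mem_cons_of_mem _ (List.mem_cons_self ..)))
        (Or.inl (List.mem_cons_self ..))
      refine ⟨_, c4, ?_, Or.inl ?_⟩
      · rw [Finset.card_insert_of_notMem hi]
        simp only [List.length_cons, List.length_append]
        have h1 := one_le_base_pow s k
        ring_nf at a2 b2 ⊢
        omega
      · refine List.mem_cons.2 (Or.inl ?_)
        funext a
        have key : ∀ x y : Bit, decide (x + y = 1) =
            !((!(decide (x = 1) && !(decide (x = 1) && decide (y = 1)))) &&
              !(decide (y = 1) && !(decide (x = 1) && decide (y = 1)))) := by decide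
        simp only [Finset.sum_insert hi]
        exact key _ _
  intro w
  refine (main t hf).mono ?_
  have h1 := one_le_base_pow s k
  have h2 : t.card * (2 * (s + 2) ^ k + 17) ≤ (s + 2) ^ j * ((s + 2) ^ k * 19) :=
    Nat.mul_le_mul ht (by omega)
  have h3 := pow_bound s (j + k) 20 5 (by norm_num)
  have h4 := one_le_base_pow s (j + k)
  have h5 : (s + 2) ^ j * ((s + 2) ^ k * 19) = 19 * (s + 2) ^ (j + k) := by rw [pow_add]; ring
  omega

theorem sum_key {ι κ : Type} [Fintype κ] (t : Finset ι) {j : ℕ} (ht : t.card ≤ (s + 2) ^ j)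
    {f : ι → α → κ → Bit} (hf : ∀ i ∈ t, Cx s k (f i)) :
    Cx s (j + k + 5) (fun a => ∑ i ∈ t, f i a) := by
  refine pi fun x => ?_
  simp only [Finset.sum_apply]
  exact sum t ht fun i hi => (hf i hi).apply x

theorem eq {f g : α → β} {j : ℕ} (hj : @Fintype.card (Wired.Wire β) Wired.fin ≤ (s + 2) ^ j)
    [DecidableEq β] (hf : Cx s k f) (hg : Cx s k' g) :
    Cx s (j + (max k k' + 5) + 4) (fun a => decide (f a = g a)) := by
  let _ : Fintype (Wired.Wire β) := Wired.fin
  intro w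
  have h := Computes.all (I := inputs α) (Finset.univ : Finset (Wired.Wire β))
    (f := fun a => Wired.enc (decide (f a = g a)) w) (fun v _ =>
    ((hf.mono (le_max_left k k') v).xor (hg.mono (le_max_right k k') v)).not.mono
      (M := (s + 2) ^ (max k k' + 5)) (by
        have h1 := one_le_base_pow s (max k k')
        have h2 := pow_bound s (max k k') 14 5 (by norm_num)
        omega)) fun a => by
    change decide _ = true ↔ _
    rw [decide_eq_true_iff]
    constructor
    · intro h; simp [h]
    · intro h
      refine Wired.enc_injective (funext fun v => ?_)
      have := h v (Finset.mem_univ _)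
      revert this
      cases Wired.enc (f a) v <;> cases Wired.enc (g a) v <;> simp
  exact h.mono (card_mul_bound hj le_rfl)

/-- Indices are encoded in unary, so the selected value is the disjunction over x of the wire "the
index is x" and the entry at x. -/
theorem lookup {m j : ℕ} (hm : m ≤ (s + 2) ^ j) {f : α → Fin m → β} {i : α → Fin m}
    (hf : Cx s k f) (hi : Cx s k' i) :
    Cx s (j + (max k k' + 2) + 4) (fun a => f a (i a)) := by
  intro w
  have h := Computes.any (I := inputs α) (Finset.univ : Finset (Fin m))
    (f := fun a => Wired.enc (f a (i a)) w) (fun x _ =>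
    ((hi.mono (le_max_right k k') x).and (hf.mono (le_max_left k k') (x, w))).mono
      (M := (s + 2) ^ (max k k' + 2)) (by
        have h1 := one_le_base_pow s (max k k')
        have h2 := pow_bound s (max k k') 4 2 (by norm_num)
        omega)) fun a => by
    have h1 : ∀ x, Wired.enc (i a) x = decide (i a = x) := fun _ => rfl
    have h2 : ∀ x, Wired.enc (f a) (x, w) = Wired.enc (f a x) w := fun _ => rfl
    simp [h1, h2]
  refine h.mono (le_trans ?_ (card_mul_bound hm (c := 1) (by norm_num)))
  rw [Finset.card_univ, Fintype.card_fin]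
  gcongr
  norm_num

/-- Elimination of a sum. -/
theorem sum_elim {F : α × (β ⊕ γ) → δ} (hl : Cx s k fun p : α × β => F (p.1, .inl p.2))
    (hr : Cx s k' fun p : α × γ => F (p.1, .inr p.2)) : Cx s (max k k' + 4) F := by
  intro w
  obtain ⟨gs, a1, a2, a3⟩ := hl.mono (le_max_left k k') w
  obtain ⟨hs, b1, b2, b3⟩ := hr.mono (le_max_right k k') w
  have hwl : ∀ v : Wired.Wire (α × β), Sum.elim
      (fun u (p : α × (β ⊕ γ)) => Wired.enc p (Sum.inl u))
      (fun u p => Wired.enc p (Sum.inr (Sum.inr (Sum.inl u)))) v ∈ inputs (α × (β ⊕ γ)) := by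
    rintro (u | u)
    · exact ⟨Sum.inl u, rfl⟩
    · exact ⟨Sum.inr (.inr (.inl u)), rfl⟩
  have hwr : ∀ v : Wired.Wire (α × γ), Sum.elim
      (fun u (p : α × (β ⊕ γ)) => Wired.enc p (Sum.inl u))
      (fun u p => Wired.enc p (Sum.inr (Sum.inr (Sum.inr u)))) v ∈ inputs (α × (β ⊕ γ)) := by
    rintro (u | u)
    · exact ⟨Sum.inl u, rfl⟩
    · exact ⟨Sum.inr (.inr (.inr u)), rfl⟩
  obtain ⟨gs', c1, c2, c3⟩ := a1.transfer hwl
  obtain ⟨hs', d1, d2, d3⟩ := b1.transfer hwr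
  obtain ⟨f, f1, f2⟩ := c3 _ a3
  obtain ⟨g, g1, g2⟩ := d3 _ b3
  have hf : Computes (inputs (α × (β ⊕ γ))) f ((s + 2) ^ max k k') := ⟨gs', c1, c2.le.trans a2, f1⟩
  have hg : Computes (inputs (α × (β ⊕ γ))) g ((s + 2) ^ max k k') := ⟨hs', d1, d2.le.trans b2, g1⟩
  have htag : Computes (inputs (α × (β ⊕ γ)))
      (fun p => Wired.enc p (Sum.inr (Sum.inl ()))) 0 := .input ⟨_, rfl⟩
  have h := htag.ite hg hf
  have e : (fun p => Wired.enc (F p) w) =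
      fun p => if Wired.enc p (Sum.inr (Sum.inl ())) = true then g p else f p := by
    funext p
    obtain ⟨x, y | y⟩ := p
    · have : Wired.enc (x, (Sum.inl y : β ⊕ γ)) (Sum.inr (Sum.inl ())) = false := rfl
      rw [this, if_neg (by simp)]
      exact f2 (x, .inl y) (x, y) (by rintro (u | u) <;> rfl)
    · have : Wired.enc (x, (Sum.inr y : β ⊕ γ)) (Sum.inr (Sum.inl ())) = true := rfl
      rw [this, if_pos rfl]
      exact g2 (x, .inr y) (x, y) (by rintro (u | u) <;> rfl)
  rw [e]
  refine h.mono ?_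
  have h1 := one_le_base_pow s (max k k')
  have h2 := pow_bound s (max k k') 10 4 (by norm_num)
  omega

/-- All output wires together. -/
theorem hasCircuit {f : α → β} (hf : Cx s k f) {j : ℕ}
    (hj : @Fintype.card (Wired.Wire β) Wired.fin ≤ (s + 2) ^ j) :
    HasCircuit f ((s + 2) ^ (j + k)) := by
  classical
  let _ : Fintype (Wired.Wire β) := Wired.fin
  have main : ∀ t : Finset (Wired.Wire β), ∃ gs, IsCircuit (inputs α) gs ∧
      gs.length ≤ t.card * (s + 2) ^ k ∧ ∀ w ∈ t, (fun a => Wired.enc (f a) w) ∈ gs ∨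
        (fun a => Wired.enc (f a) w) ∈ inputs α := by
    intro t
    induction t using Finset.induction_on with
    | empty => exact ⟨[], .nil, by simp, by simp⟩
    | insert i t hi ih =>
      obtain ⟨gs, a1, a2, a3⟩ := ih
      obtain ⟨hs, b1, b2, b3⟩ := hf i
      refine ⟨_, b1.append a1, ?_, fun w hw => ?_⟩
      · rw [Finset.card_insert_of_notMem hi, List.length_append]
        ring_nf at a2 b2 ⊢
        omega
      · rcases Finset.mem_insert.1 hw with rfl | hw
        · exact b3.imp_left fun h => List.mem_append_left _ h
        · exact (a3 w hw).imp_left fun h => List.mem_append_right _ h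
  obtain ⟨gs, a1, a2, a3⟩ := main Finset.univ
  refine ⟨gs, a1, a2.trans ?_, fun w => a3 w (Finset.mem_univ _)⟩
  rw [pow_add]
  exact Nat.mul_le_mul_right _ hj

end Cx

open scoped ENNReal

/-! ## Uniform distributions and regular maps -/

section Regular

variable {A B C : Type} [Fintype A] [Nonempty A] [Fintype B] [Nonempty B] [Fintype C] [Nonempty C]

/-- `f` maps the uniform distribution to the uniform distribution. -/
def Regular (f : A → B) : Prop :=
  (PMF.uniformOfFintype A).map f = PMF.uniformOfFintype B

/-- Division-free form of the fact that uniformity of the image means equal fibres. It reduces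
products and powers of maps to multiplying fibre sizes. -/
theorem regular_iff_card [DecidableEq B] {f : A → B} :
    Regular f ↔ ∀ b, (Finset.univ.filter fun a => f a = b).card * Fintype.card B =
      Fintype.card A := by
  have key : ∀ b, (PMF.uniformOfFintype A).map f b =
      ((Finset.univ.filter fun a => f a = b).card : ℝ≥0∞) * (Fintype.card A : ℝ≥0∞)⁻¹ := by
    intro b
    rw [PMF.map_apply, tsum_fintype]
    simp only [PMF.uniformOfFintype_apply]
    rw [← Finset.sum_filter, Finset.sum_const, nsmul_eq_mul]
    simp only [eq_comm]
  have hA : (Fintype.card A : ℝ≥0∞) ≠ 0 := by simp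
  have hA' : (Fintype.card A : ℝ≥0∞) ≠ ∞ := by simp
  have hB : (Fintype.card B : ℝ≥0∞) ≠ 0 := by simp
  have hB' : (Fintype.card B : ℝ≥0∞) ≠ ∞ := by simp
  constructor
  · intro h b
    have h1 := key b
    rw [show (PMF.uniformOfFintype A).map f = _ from h, PMF.uniformOfFintype_apply] at h1
    have h2 : ((Finset.univ.filter fun a => f a = b).card : ℝ≥0∞) * (Fintype.card B : ℝ≥0∞) =
        Fintype.card A := by
      calc _ = (((Finset.univ.filter fun a => f a = b).card : ℝ≥0∞) *
            (Fintype.card A : ℝ≥0∞)⁻¹) * Fintype.card A * Fintype.card B := by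
            rw [mul_assoc (_ * _), mul_comm (Fintype.card A : ℝ≥0∞), ← mul_assoc, mul_assoc,
              mul_assoc, mul_comm (Fintype.card B : ℝ≥0∞), ← mul_assoc (_⁻¹),
              ENNReal.inv_mul_cancel hA hA', one_mul]
        _ = _ := by
            rw [← h1, mul_assoc, mul_comm (Fintype.card A : ℝ≥0∞), ← mul_assoc,
              ENNReal.inv_mul_cancel hB hB', one_mul]
    exact_mod_cast h2
  · intro h
    ext b
    rw [key b, PMF.uniformOfFintype_apply, ← h b, Nat.cast_mul]
    have h0 : (Finset.univ.filter fun a => f a = b).card ≠ 0 := by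
      intro h0
      have := h b
      rw [h0, zero_mul] at this
      exact Fintype.card_ne_zero this.symm
    rw [ENNReal.mul_inv (Or.inr hB') (Or.inr hB), ← mul_assoc, ENNReal.mul_inv_cancel, one_mul]
    · exact_mod_cast h0
    · simp

theorem Regular.comp {g : B → C} {f : A → B} (hg : Regular g) (hf : Regular f) :
    Regular (fun a => g (f a)) := by
  unfold Regular at *
  rw [← hg, ← hf, PMF.map_comp]
  rfl

theorem Regular.of_bijective {f : A → B} (hf : Function.Bijective f) : Regular f := by
  classical
  rw [regular_iff_card]
  intro b
  obtain ⟨a, rfl⟩ := hf.2 b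
  have : (Finset.univ.filter fun x => f x = f a) = {a} := by
    ext x; simp [hf.1.eq_iff]
  rw [this, Finset.card_singleton, one_mul]
  exact (Fintype.card_of_bijective hf).symm

theorem regular_prodMap {A' B' : Type} [Fintype A'] [Nonempty A'] [Fintype B'] [Nonempty B']
    {f : A → B} {g : A' → B'} (hf : Regular f) (hg : Regular g) : Regular (Prod.map f g) := by
  classical
  rw [regular_iff_card] at *
  rintro ⟨b, b'⟩
  have : (Finset.univ.filter fun x => Prod.map f g x = (b, b')) =
      (Finset.univ.filter fun x => f x = b) ×ˢ (Finset.univ.filter fun x => g x = b') := by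
    ext x; simp [Prod.map, Prod.ext_iff]
  rw [this, Finset.card_product, Fintype.card_prod, Fintype.card_prod, ← hf b, ← hg b']
  ring

theorem regular_fst : Regular (Prod.fst : A × B → A) := by
  classical
  rw [regular_iff_card]
  intro a
  have : (Finset.univ.filter fun x : A × B => x.1 = a) = {a} ×ˢ Finset.univ := by
    ext x; simp [-Finset.singleton_product]
  rw [this, Finset.card_product, Fintype.card_prod]
  simp [mul_comm]

theorem regular_pi {ι : Type} [Fintype ι] [DecidableEq ι] {f : ι → A → B}
    (hf : ∀ i, Regular (f i)) : Regular (fun (a : ι → A) i => f i (a i)) := by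
  classical
  simp only [regular_iff_card] at *
  intro b
  have : (Finset.univ.filter fun a : ι → A => (fun i => f i (a i)) = b) =
      Fintype.piFinset fun i => Finset.univ.filter fun x => f i x = b i := by
    ext x; simp [funext_iff]
  rw [this, Fintype.card_piFinset, Fintype.card_fun, Fintype.card_fun]
  have h : ∀ i, (Finset.univ.filter fun x => f i x = b i).card * Fintype.card B =
    Fintype.card A := fun i => hf i (b i)
  rw [← Finset.card_univ (α := ι), ← Finset.prod_const, ← Finset.prod_const,
    ← Finset.prod_mul_distrib]
  exact Finset.prod_congr rfl fun i _ => h i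

theorem uniform_prod : PMF.uniformOfFintype (A × B) =
    (PMF.uniformOfFintype A).bind fun a => (PMF.uniformOfFintype B).map fun b => (a, b) := by
  classical
  ext ⟨a, b⟩
  rw [PMF.bind_apply, tsum_fintype, Finset.sum_eq_single a]
  · rw [PMF.map_apply, tsum_fintype, Finset.sum_eq_single b]
    · simp only [PMF.uniformOfFintype_apply, Fintype.card_prod, Nat.cast_mul, if_true]
      exact ENNReal.mul_inv (by simp) (by simp)
    · intro c _ hc
      rw [if_neg]
      simpa using hc.symm
    · simp
  · intro c _ hc
    rw [PMF.map_apply, ENNReal.tsum_eq_zero.2, mul_zero]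
    intro i
    rw [if_neg]
    simp [hc.symm]
  · simp

theorem Regular.bind_comp {D : Type} {f : A → B} (hf : Regular f) (g : B → PMF D) :
    (PMF.uniformOfFintype A).bind (fun a => g (f a)) = (PMF.uniformOfFintype B).bind g := by
  rw [← show _ = PMF.uniformOfFintype B from hf, PMF.bind_map]
  rfl

theorem Regular.map_comp {D : Type} {f : A → B} (hf : Regular f) (g : B → D) :
    (PMF.uniformOfFintype A).map (fun a => g (f a)) = (PMF.uniformOfFintype B).map g :=
  hf.bind_comp fun b => PMF.pure (g b)

/-- The uniform distribution of the domain, given the value of a regular map. -/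
theorem Regular.exists_kernel {f : A → B} (hf : Regular f) :
    ∃ K : B → PMF A, PMF.uniformOfFintype A = (PMF.uniformOfFintype B).bind K ∧
      ∀ b, ∀ a ∈ (K b).support, f a = b := by
  classical
  have hc := regular_iff_card.1 hf
  have hne : ∀ b, (Finset.univ.filter fun a => f a = b).Nonempty := by
    intro b
    rw [← Finset.card_pos, Nat.pos_iff_ne_zero]
    intro h0
    have := hc b
    rw [h0, zero_mul] at this
    exact Fintype.card_ne_zero this.symm
  refine ⟨fun b => PMF.uniformOfFinset _ (hne b), ?_, fun b a ha => ?_⟩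
  · ext a
    rw [PMF.bind_apply, tsum_fintype, Finset.sum_eq_single (f a)]
    · rw [PMF.uniformOfFinset_apply_of_mem _ (by simp), PMF.uniformOfFintype_apply,
        PMF.uniformOfFintype_apply, ← hc (f a), Nat.cast_mul, mul_comm]
      exact ENNReal.mul_inv (by simp) (by simp)
    · intro b _ hb
      rw [PMF.uniformOfFinset_apply_of_notMem, mul_zero]
      simpa using hb.symm
    · simp
  · simpa using ha

end Regular

theorem bind_congr_support {A B : Type} (p : PMF A) {f g : A → PMF B}
    (h : ∀ a ∈ p.support, f a = g a) : p.bind f = p.bind g := by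
  ext b
  rw [PMF.bind_apply, PMF.bind_apply]
  refine tsum_congr fun a => ?_
  by_cases ha : a ∈ p.support
  · rw [h a ha]
  · rw [(PMF.apply_eq_zero_iff _ _).2 ha, zero_mul, zero_mul]

/-! ## Comparing two worlds -/

section Compare

variable {Q R : Type}

/-- The distribution of the output of `Z` after `q` more rounds. -/
noncomputable def outcome (Z : Env Q R) (W : World Q R) (q : ℕ) (t : W.State)
    (h : List (Q × R)) : PMF Bool :=
  (interact Z W q t h).bind Z.decision

theorem outcome_succ (Z : Env Q R) (W : World Q R) (q : ℕ) (t : W.State) (h : List (Q × R)) :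
    outcome Z W (q + 1) t h = (Z.next h).bind fun x => (W.step t x).bind fun sr =>
      outcome Z W q sr.1 ((x, sr.2) :: h) := by
  simp [outcome, interact, PMF.bind_bind]

/-- Truncated subtraction is convex. One-sided differences in [0, ∞] avoid all summability
questions; the other side of the absolute value comes from `Coupling.symm`. -/
theorem weighted_sub_le {A : Type} (p f g : A → ℝ≥0∞) :
    ∑' a, p a * f a - ∑' a, p a * g a ≤ ∑' a, p a * (f a - g a) := by
  rw [tsub_le_iff_right, ← ENNReal.tsum_add]
  refine ENNReal.tsum_le_tsum fun a => ?_
  rw [← mul_add]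
  exact mul_le_mul_right le_tsub_add _

/-- A deterministic bisimulation is invisible to every environment. -/
theorem outcome_eq_of_match {W₁ W₂ : World Q R} (Match : W₁.State → W₂.State → Prop)
    (hMatch : ∀ t₁ t₂ x, Match t₁ t₂ → ∃ t₁' t₂' r, W₁.step t₁ x = PMF.pure (t₁', r) ∧
      W₂.step t₂ x = PMF.pure (t₂', r) ∧ Match t₁' t₂')
    (Z : Env Q R) (q : ℕ) : ∀ t₁ t₂ h, Match t₁ t₂ →
      outcome Z W₁ q t₁ h = outcome Z W₂ q t₂ h := by
  induction q with
  | zero => intro t₁ t₂ h _; simp [outcome, interact]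
  | succ q ih =>
    intro t₁ t₂ h hm
    rw [outcome_succ, outcome_succ]
    congr 1
    funext x
    obtain ⟨t₁', t₂', r, h1, h2, h3⟩ := hMatch t₁ t₂ x hm
    rw [h1, h2, PMF.pure_bind, PMF.pure_bind]
    exact ih _ _ _ h3

/-- `μ` describes the reaction of `W` to `x`, when the state of `W` is distributed according to
`K s`, by the knowledge `s` of the environment. -/
def Reacts (W : World Q R) {S : Type} (K : S → PMF W.State) (s : S) (x : Q) (μ : PMF (S × R)) :
    Prop :=
  ((K s).bind fun t => W.step t x) = μ.bind fun p => (K p.1).map fun t => (t, p.2)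

/-- Two worlds with a common uniform secret `θ` are close: from a state of knowledge they react
in the same way, independently of `θ` apart from at most `c` values of `θ`, or pass to matching
states. The function `Φ` bounds the probability of failure. -/
structure Coupling {Θ S : Type} {W₁ W₂ : World Q R} (K₁ : Θ → S → PMF W₁.State)
    (K₂ : Θ → S → PMF W₂.State) (Match : W₁.State → W₂.State → Prop) (Φ : S → ℝ≥0∞) (c : ℕ) :
    Prop where
  matched : ∀ t₁ t₂ x, Match t₁ t₂ → ∃ t₁' t₂' r, W₁.step t₁ x = PMF.pure (t₁', r) ∧
    W₂.step t₂ x = PMF.pure (t₂', r) ∧ Match t₁' t₂'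
  react : ∀ s x, 1 ≤ Φ s ∨
    (∃ (X : Finset Θ) (μ : PMF (S × R)), X.card ≤ c ∧ ∑' p, μ p * Φ p.1 ≤ Φ s ∧
      ∀ θ ∉ X, Reacts W₁ (K₁ θ) s x μ ∧ Reacts W₂ (K₂ θ) s x μ) ∨
    (∀ θ, ∃ ν : PMF ((W₁.State × W₂.State) × R),
      (∀ p ∈ ν.support, Match p.1.1 p.1.2) ∧
      ((K₁ θ s).bind fun t => W₁.step t x) = ν.map (fun p => (p.1.1, p.2)) ∧
      ((K₂ θ s).bind fun t => W₂.step t x) = ν.map (fun p => (p.1.2, p.2)))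

theorem Coupling.symm {Θ S : Type} {W₁ W₂ : World Q R} {K₁ : Θ → S → PMF W₁.State}
    {K₂ : Θ → S → PMF W₂.State} {Match : W₁.State → W₂.State → Prop} {Φ : S → ℝ≥0∞} {c : ℕ}
    (h : Coupling K₁ K₂ Match Φ c) : Coupling K₂ K₁ (fun t₂ t₁ => Match t₁ t₂) Φ c where
  matched t₂ t₁ x hm := by
    obtain ⟨t₁', t₂', r, h1, h2, h3⟩ := h.matched t₁ t₂ x hm
    exact ⟨t₂', t₁', r, h2, h1, h3⟩
  react s x := by
    rcases h.react s x with h1 | ⟨X, μ, hX, hΦ, h2⟩ | h3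
    · exact Or.inl h1
    · exact Or.inr (Or.inl ⟨X, μ, hX, hΦ, fun θ hθ => (h2 θ hθ).symm⟩)
    · refine Or.inr (Or.inr fun θ => ?_)
      obtain ⟨ν, n1, n2, n3⟩ := h3 θ
      refine ⟨ν.map fun p => ((p.1.2, p.1.1), p.2), fun p hp => ?_, ?_, ?_⟩
      · rw [PMF.support_map] at hp
        obtain ⟨p', hp', rfl⟩ := hp
        exact n1 p' hp'
      · rw [n3, PMF.map_comp]; rfl
      · rw [n2, PMF.map_comp]; rfl

/-- Induction on the number of rounds. Summing over θ, instead of fixing it, lets each round charge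
at most 1 for each of at most `c` exceptional values. All other θ share one law μ of the new
knowledge, along which Φ does not grow on average. Passing to matched states costs nothing more, and
if Φ ≥ 1 the bound is trivial. -/
theorem sum_outcome_sub_le {Θ S : Type} [Fintype Θ] {W₁ W₂ : World Q R}
    {K₁ : Θ → S → PMF W₁.State} {K₂ : Θ → S → PMF W₂.State}
    {Match : W₁.State → W₂.State → Prop} {Φ : S → ℝ≥0∞} {c : ℕ} (hK : Coupling K₁ K₂ Match Φ c)
    (Z : Env Q R) (q : ℕ) : ∀ s h,
      ∑ θ, (((K₁ θ s).bind fun t => outcome Z W₁ q t h) true -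
        ((K₂ θ s).bind fun t => outcome Z W₂ q t h) true) ≤
      c * q + Fintype.card Θ * Φ s := by
  classical
  induction q with
  | zero =>
    intro s h
    refine le_trans (le_of_eq ?_) zero_le
    refine Finset.sum_eq_zero fun θ _ => ?_
    simp [outcome, interact]
  | succ q ih =>
    intro s h
    set a : Θ → Q → ℝ≥0∞ := fun θ x => (((K₁ θ s).bind fun t => W₁.step t x).bind fun sr =>
      outcome Z W₁ q sr.1 ((x, sr.2) :: h)) true with ha
    set b : Θ → Q → ℝ≥0∞ := fun θ x => (((K₂ θ s).bind fun t => W₂.step t x).bind fun sr =>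
      outcome Z W₂ q sr.1 ((x, sr.2) :: h)) true with hb
    have e₁ : ∀ θ, ((K₁ θ s).bind fun t => outcome Z W₁ (q + 1) t h) true =
        ∑' x, Z.next h x * a θ x := by
      intro θ
      simp only [outcome_succ]
      rw [PMF.bind_comm, PMF.bind_apply]
      simp only [ha, PMF.bind_bind]
    have e₂ : ∀ θ, ((K₂ θ s).bind fun t => outcome Z W₂ (q + 1) t h) true =
        ∑' x, Z.next h x * b θ x := by
      intro θ
      simp only [outcome_succ]
      rw [PMF.bind_comm, PMF.bind_apply]
      simp only [hb, PMF.bind_bind]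
    have bound : ∀ x, ∑ θ, (a θ x - b θ x) ≤ c * (q + 1 : ℕ) + Fintype.card Θ * Φ s := by
      intro x
      have hle : ∀ θ, a θ x - b θ x ≤ 1 := fun θ => tsub_le_self.trans (PMF.coe_le_one _ _)
      rcases hK.react s x with h1 | ⟨X, μ, hX, hΦ, h2⟩ | h3
      · calc ∑ θ, (a θ x - b θ x) ≤ ∑ _θ : Θ, 1 := Finset.sum_le_sum fun θ _ => hle θ
          _ = Fintype.card Θ * 1 := by simp
          _ ≤ Fintype.card Θ * Φ s := by gcongr
          _ ≤ _ := le_add_self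
      · set A : Θ → S × R → ℝ≥0∞ := fun θ p => ((K₁ θ p.1).bind fun t =>
          outcome Z W₁ q t ((x, p.2) :: h)) true with hA
        set B : Θ → S × R → ℝ≥0∞ := fun θ p => ((K₂ θ p.1).bind fun t =>
          outcome Z W₂ q t ((x, p.2) :: h)) true with hB
        have ea : ∀ θ ∉ X, a θ x = ∑' p, μ p * A θ p := by
          intro θ hθ
          simp only [ha]
          rw [show ((K₁ θ s).bind fun t => W₁.step t x) = _ from (h2 θ hθ).1, PMF.bind_bind,
            PMF.bind_apply]
          simp only [PMF.bind_map, hA]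
          rfl
        have eb : ∀ θ ∉ X, b θ x = ∑' p, μ p * B θ p := by
          intro θ hθ
          simp only [hb]
          rw [show ((K₂ θ s).bind fun t => W₂.step t x) = _ from (h2 θ hθ).2, PMF.bind_bind,
            PMF.bind_apply]
          simp only [PMF.bind_map, hB]
          rfl
        have hd : ∀ θ, a θ x - b θ x ≤ (if θ ∈ X then 1 else 0) +
            ∑' p, μ p * (A θ p - B θ p) := by
          intro θ
          by_cases hθ : θ ∈ X
          · rw [if_pos hθ]; exact (hle θ).trans le_self_add
          · rw [ea θ hθ, eb θ hθ, if_neg hθ, zero_add]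
            exact weighted_sub_le _ _ _
        calc ∑ θ, (a θ x - b θ x) ≤ ∑ θ, ((if θ ∈ X then 1 else 0) +
              ∑' p, μ p * (A θ p - B θ p)) := Finset.sum_le_sum fun θ _ => hd θ
          _ = X.card + ∑' p, μ p * ∑ θ, (A θ p - B θ p) := by
              rw [Finset.sum_add_distrib]
              congr 1
              · simp
              -- The two sums can be exchanged because μ does not depend on θ; this is what makes
              -- the induction hypothesis, a bound for the sum over θ, applicable.
              · rw [← tsum_fintype (L := .unconditional Θ), ENNReal.tsum_comm]
                refine tsum_congr fun p => ?_
                rw [ENNReal.tsum_mul_left, tsum_fintype]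
          _ ≤ c + ∑' p, μ p * (c * q + Fintype.card Θ * Φ p.1) := by
              gcongr with p
              exact ih p.1 ((x, p.2) :: h)
          _ = c + (c * q + Fintype.card Θ * ∑' p, μ p * Φ p.1) := by
              simp only [mul_add]
              rw [ENNReal.tsum_add, ENNReal.tsum_mul_right, μ.tsum_coe, one_mul]
              congr 2
              rw [← ENNReal.tsum_mul_left]
              refine tsum_congr fun p => ?_
              ring
          _ ≤ c + (c * q + Fintype.card Θ * Φ s) := by gcongr
          _ = _ := by push_cast; ring
      · refine le_trans (le_of_eq ?_) zero_le
        refine Finset.sum_eq_zero fun θ _ => ?_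
        obtain ⟨ν, n1, n2, n3⟩ := h3 θ
        have : a θ x = b θ x := by
          simp only [ha, hb]
          -- Both reactions are marginals of the joint law ν, which is supported on matching states.
          rw [n2, n3, PMF.bind_map, PMF.bind_map]
          congr 1
          refine bind_congr_support _ fun p hp => ?_
          exact outcome_eq_of_match Match hK.matched Z q _ _ _ (n1 p hp)
        rw [this, tsub_self]
    calc _ = ∑ θ, (∑' x, Z.next h x * a θ x - ∑' x, Z.next h x * b θ x) := by
          simp only [e₁, e₂]
      _ ≤ ∑ θ, ∑' x, Z.next h x * (a θ x - b θ x) :=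
          Finset.sum_le_sum fun θ _ => weighted_sub_le _ _ _
      _ = ∑' x, Z.next h x * ∑ θ, (a θ x - b θ x) := by
          rw [← tsum_fintype (L := .unconditional Θ), ENNReal.tsum_comm]
          refine tsum_congr fun p => ?_
          rw [ENNReal.tsum_mul_left, tsum_fintype]
      _ ≤ ∑' x, Z.next h x * (c * (q + 1 : ℕ) + Fintype.card Θ * Φ s) := by
          gcongr with x; exact bound x
      _ = _ := by rw [ENNReal.tsum_mul_right, PMF.tsum_coe, one_mul]

theorem acceptProb_eq_outcome (Z : Env Q R) (W : World Q R) (q : ℕ) :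
    acceptProb Z W q = ((W.init.bind fun t => outcome Z W q t []) true).toReal := rfl

theorem outcome_init_le {Θ S : Type} [Fintype Θ] [Nonempty Θ] {W₁ W₂ : World Q R}
    {K₁ : Θ → S → PMF W₁.State} {K₂ : Θ → S → PMF W₂.State} {σ : PMF S}
    (h₁ : W₁.init = (PMF.uniformOfFintype Θ).bind fun θ => σ.bind (K₁ θ))
    (h₂ : W₂.init = (PMF.uniformOfFintype Θ).bind fun θ => σ.bind (K₂ θ))
    {Match : W₁.State → W₂.State → Prop} {Φ : S → ℝ≥0∞} {c : ℕ} (hK : Coupling K₁ K₂ Match Φ c)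
    {ε : ℝ≥0∞} (hε : ∑' s, σ s * Φ s ≤ ε) (Z : Env Q R) (q : ℕ) :
    (W₁.init.bind fun t => outcome Z W₁ q t []) true ≤
      (W₂.init.bind fun t => outcome Z W₂ q t []) true + (c * q / Fintype.card Θ + ε) := by
  have e : ∀ (W : World Q R) (K : Θ → S → PMF W.State),
      (((PMF.uniformOfFintype Θ).bind fun θ => σ.bind (K θ)).bind fun t =>
        outcome Z W q t []) true = ∑' s, σ s * ∑' θ, (Fintype.card Θ : ℝ≥0∞)⁻¹ *
          ((K θ s).bind fun t => outcome Z W q t []) true := by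
    intro W K
    rw [PMF.bind_comm, PMF.bind_bind, PMF.bind_apply]
    simp only [PMF.bind_bind]
    refine tsum_congr fun s => ?_
    rw [PMF.bind_apply]
    simp only [PMF.uniformOfFintype_apply]
  rw [h₁, h₂, e, e, ← tsub_le_iff_left]
  refine (weighted_sub_le _ _ _).trans ?_
  calc _ ≤ ∑' s, σ s * (c * q / Fintype.card Θ + Φ s) := by
        gcongr with s
        refine (weighted_sub_le _ _ _).trans ?_
        rw [ENNReal.tsum_mul_left, tsum_fintype]
        calc _ ≤ (Fintype.card Θ : ℝ≥0∞)⁻¹ * (c * q + Fintype.card Θ * Φ s) := by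
              gcongr; exact sum_outcome_sub_le hK Z q s []
          _ = _ := by
              rw [mul_add, ← mul_assoc _ (Fintype.card Θ : ℝ≥0∞),
                ENNReal.inv_mul_cancel (by simp) (by simp), one_mul,
                mul_comm _ (c * q : ℝ≥0∞), div_eq_mul_inv]
    _ = c * q / Fintype.card Θ + ∑' s, σ s * Φ s := by
        simp only [mul_add]
        rw [ENNReal.tsum_add, ENNReal.tsum_mul_right, PMF.tsum_coe, one_mul]
    _ ≤ _ := by gcongr

theorem abs_acceptProb_sub_le {Θ S : Type} [Fintype Θ] [Nonempty Θ] {W₁ W₂ : World Q R}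
    {K₁ : Θ → S → PMF W₁.State} {K₂ : Θ → S → PMF W₂.State} {σ : PMF S}
    (h₁ : W₁.init = (PMF.uniformOfFintype Θ).bind fun θ => σ.bind (K₁ θ))
    (h₂ : W₂.init = (PMF.uniformOfFintype Θ).bind fun θ => σ.bind (K₂ θ))
    {Match : W₁.State → W₂.State → Prop} {Φ : S → ℝ≥0∞} {c : ℕ} (hK : Coupling K₁ K₂ Match Φ c)
    {ε : ℝ≥0∞} (hε : ∑' s, σ s * Φ s ≤ ε) (hε' : ε ≠ ∞) (Z : Env Q R) (q : ℕ) :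
    |acceptProb Z W₁ q - acceptProb Z W₂ q| ≤ c * q / Fintype.card Θ + ε.toReal := by
  have h12 := outcome_init_le h₁ h₂ hK hε Z q
  have h21 := outcome_init_le h₂ h₁ hK.symm hε Z q
  have hfin : (c * q / Fintype.card Θ : ℝ≥0∞) ≠ ∞ :=
    ENNReal.div_ne_top (ENNReal.mul_ne_top (by simp) (by simp)) (by simp)
  have e : (c * q / Fintype.card Θ + ε : ℝ≥0∞).toReal = c * q / Fintype.card Θ + ε.toReal := by
    rw [ENNReal.toReal_add hfin hε', ENNReal.toReal_div, ENNReal.toReal_mul]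
    simp
  have hb : ∀ (W : World Q R), (W.init.bind fun t => outcome Z W q t []) true ≠ ∞ :=
    fun W => PMF.apply_ne_top _ _
  have r12 := ENNReal.toReal_mono (ENNReal.add_ne_top.2 ⟨hb _, ENNReal.add_ne_top.2 ⟨hfin, hε'⟩⟩) h12
  have r21 := ENNReal.toReal_mono (ENNReal.add_ne_top.2 ⟨hb _, ENNReal.add_ne_top.2 ⟨hfin, hε'⟩⟩) h21
  rw [ENNReal.toReal_add (hb _) (by simp [hfin, hε']), e] at r12 r21
  rw [acceptProb_eq_outcome, acceptProb_eq_outcome, abs_sub_le_iff]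
  constructor <;> linarith

end Compare

/-! ## Types whose encodings are all bit strings -/

/-- The memory of a simulator and its coins are arbitrary bit strings. If every string encodes a
value, decoding is a bijection: it needs no gates, and uniform coins decode to a uniform value. -/
class FullWired (α : Type) [Wired α] : Prop where
  enc_surjective : Function.Surjective (Wired.enc : α → Wired.Wire α → Bool)

section Full

variable {α β : Type} [Wired α] [Wired β]

noncomputable def dec [FullWired α] (m : Wired.Wire α → Bool) : α :=
  Function.surjInv FullWired.enc_surjective m

@[simp]
theorem enc_dec [FullWired α] (m : Wired.Wire α → Bool) : Wired.enc (dec m : α) = m :=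
  Function.surjInv_eq FullWired.enc_surjective m

@[simp]
theorem dec_enc [FullWired α] (a : α) : dec (Wired.enc a) = a :=
  Wired.enc_injective (enc_dec _)

theorem dec_bijective [FullWired α] : Function.Bijective (dec : _ → α) :=
  ⟨fun m m' h => by rw [← enc_dec (α := α) m, h, enc_dec], fun a => ⟨_, dec_enc a⟩⟩

instance : FullWired Bool := ⟨fun m => ⟨m (), rfl⟩⟩

instance : FullWired Bit := ⟨fun m => by
  by_cases h : m () = true
  · exact ⟨1, funext fun w => h.symm⟩
  · exact ⟨0, funext fun w => ((Bool.eq_false_iff.2 h)).symm⟩⟩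

instance [FullWired α] [FullWired β] : FullWired (α × β) := ⟨fun m => by
  obtain ⟨a, ha⟩ := FullWired.enc_surjective (α := α) fun w => m (Sum.inl w)
  obtain ⟨b, hb⟩ := FullWired.enc_surjective (α := β) fun w => m (Sum.inr w)
  refine ⟨(a, b), funext ?_⟩
  rintro (w | w)
  · exact congrFun ha w
  · exact congrFun hb w⟩

instance {ι : Type} [Fintype ι] [FullWired α] : FullWired (ι → α) := ⟨fun m => by
  choose f hf using fun i => FullWired.enc_surjective (α := α) fun w => m (i, w)
  exact ⟨f, funext fun w => congrFun (hf w.1) w.2⟩⟩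

instance (κ : ℕ) : FullWired (SenderView κ) := ⟨fun m => by
  obtain ⟨⟨x₀, x₁, m₀, m₁, kc, kz⟩, h⟩ :=
    FullWired.enc_surjective (α := Bit × Bit × Key κ × Key κ × Key κ × Key κ) m
  exact ⟨⟨x₀, x₁, m₀, m₁, kc, kz⟩, h⟩⟩

instance (κ : ℕ) : FullWired (ReceiverView κ) := ⟨fun m => by
  obtain ⟨⟨k₀, k₁, c, mc, z, mz⟩, h⟩ :=
    FullWired.enc_surjective (α := Key κ × Key κ × Bit × Key κ × Bit × Key κ) m
  exact ⟨⟨k₀, k₁, c, mc, z, mz⟩, h⟩⟩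

theorem isWiring_dec [FullWired α] {A : Type} [Wired A] {m : A → Wired.Wire α → Bool}
    (hm : ∀ w, IsWiring fun a => m a w) : IsWiring (fun a => (dec (m a) : α)) := by
  intro w
  have h := hm w ()
  have e : (fun a => Wired.enc (dec (m a) : α) w) = fun a => Wired.enc (m a w) () := by
    funext a; rw [enc_dec]; rfl
  rwa [e]

end Full

/-! ## Numbers of wires -/

/-- Elements of `α` are encoded on at most `(s + 2) ^ j` wires. -/
def FewWires (s j : ℕ) (α : Type) [Wired α] : Prop :=
  @Fintype.card (Wired.Wire α) Wired.fin ≤ (s + 2) ^ j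

namespace FewWires

variable {s i j : ℕ} {α β : Type} [Wired α] [Wired β]

theorem mono (h : FewWires s i α) (hij : i ≤ j) : FewWires s j α :=
  le_trans h (base_pow_mono s hij)

theorem prod (ha : FewWires s i α) (hb : FewWires s j β) :
    FewWires s (max i j + 1) (α × β) := by
  have h1 := ha.mono (le_max_left i j)
  have h2 := hb.mono (le_max_right i j)
  unfold FewWires at *
  have h3 := pow_bound s (max i j) 2 1 (by norm_num)
  have : @Fintype.card (Wired.Wire (α × β)) Wired.fin =
      @Fintype.card (Wired.Wire α) Wired.fin + @Fintype.card (Wired.Wire β) Wired.fin :=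
    @Fintype.card_sum _ _ Wired.fin Wired.fin
  omega

theorem sum (ha : FewWires s i α) (hb : FewWires s j β) :
    FewWires s (max i j + 2) (α ⊕ β) := by
  have h1 := ha.mono (le_max_left i j)
  have h2 := hb.mono (le_max_right i j)
  unfold FewWires at *
  have h3 := pow_bound s (max i j) 3 2 (by norm_num)
  have h4 := one_le_base_pow s (max i j)
  have : @Fintype.card (Wired.Wire (α ⊕ β)) Wired.fin = 1 +
      (@Fintype.card (Wired.Wire α) Wired.fin + @Fintype.card (Wired.Wire β) Wired.fin) := by
    refine (@Fintype.card_sum Unit _ _ (@instFintypeSum _ _ Wired.fin Wired.fin)).trans ?_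
    exact congrArg _ (@Fintype.card_sum _ _ Wired.fin Wired.fin)
  omega

theorem pi {ι : Type} [Fintype ι] (hι : Fintype.card ι ≤ (s + 2) ^ i) (ha : FewWires s j α) :
    FewWires s (i + j) (ι → α) := by
  unfold FewWires at *
  have : @Fintype.card (Wired.Wire (ι → α)) Wired.fin =
      Fintype.card ι * @Fintype.card (Wired.Wire α) Wired.fin :=
    @Fintype.card_prod _ _ _ Wired.fin
  rw [this, pow_add]
  exact Nat.mul_le_mul hι ha

theorem unit : FewWires s 0 Unit := by
  unfold FewWires
  have : @Fintype.card (Wired.Wire Unit) Wired.fin = 0 := rfl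
  omega

theorem bool : FewWires s 0 Bool := by
  unfold FewWires
  have : @Fintype.card (Wired.Wire Bool) Wired.fin = 1 := rfl
  simp [this]

theorem bit : FewWires s 0 Bit := by
  unfold FewWires
  have : @Fintype.card (Wired.Wire Bit) Wired.fin = 1 := rfl
  simp [this]

theorem party : FewWires s 0 Party := by
  unfold FewWires
  have : @Fintype.card (Wired.Wire Party) Wired.fin = 1 := rfl
  simp [this]

theorem fin {m : ℕ} (hm : m ≤ (s + 2) ^ j) : FewWires s j (Fin m) :=
  le_trans (Fintype.card_fin m).le hm

theorem perm {m : ℕ} (hm : m ≤ (s + 2) ^ j) : FewWires s (j + j) (Equiv.Perm (Fin m)) :=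
  pi (α := Fin m) (by simpa using hm) (fin hm)

variable {κ ℓ B : ℕ}

/-- The parameters are bounded by `s`. -/
structure Params (s κ ℓ B : ℕ) : Prop where
  key : κ ≤ s + 2
  buckets : ℓ ≤ s + 2
  size : B ≤ s + 2

theorem Params.mul (h : Params s κ ℓ B) : ℓ * B ≤ (s + 2) ^ 2 := by
  rw [pow_two]
  exact Nat.mul_le_mul h.buckets h.size

theorem Params.pred (h : Params s κ ℓ B) : B - 1 ≤ (s + 2) ^ 1 := by
  have := h.size
  rw [pow_one]
  omega

theorem key (h : κ ≤ s + 2) : FewWires s 1 (Key κ) :=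
  pi (i := 1) (j := 0) (by simpa using h) bit

theorem senderView (h : κ ≤ s + 2) : FewWires s 6 (SenderView κ) :=
  (bit.prod (bit.prod ((key h).prod ((key h).prod ((key h).prod (key h)))))).mono (by decide)

theorem receiverView (h : κ ≤ s + 2) : FewWires s 6 (ReceiverView κ) :=
  ((key h).prod ((key h).prod (bit.prod ((key h).prod (bit.prod (key h)))))).mono (by decide)

theorem senderOut {n : ℕ} (h : κ ≤ s + 2) (hn : n ≤ (s + 2) ^ 2) :
    FewWires s 9 (SenderOut κ n) :=
  ((key h).prod (pi (by simpa using hn) (senderView h))).mono (by decide)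

theorem receiverOut {n : ℕ} (h : κ ≤ s + 2) (hn : n ≤ (s + 2) ^ 2) :
    FewWires s 9 (ReceiverOut κ n) :=
  ((key h).prod (pi (by simpa using hn) (receiverView h))).mono (by decide)

theorem bits (h : Params s κ ℓ B) : FewWires s 2 (Fin ℓ → Fin (B - 1) → Bit) :=
  pi (i := 1) (by simpa using h.buckets) (pi (i := 1) (by simpa using h.pred) bit)

theorem reveals (h : Params s κ ℓ B) : FewWires s 4 (Reveals κ ℓ B) :=
  pi (i := 1) (by simpa using h.buckets) (pi (i := 1) (by simpa using h.pred)
    (bit.prod (key h.key)))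

theorem boxCmd (h : Params s κ ℓ B) : FewWires s 20 (BoxCmd κ ℓ) :=
  have hℓ : ℓ ≤ (s + 2) ^ 2 := h.buckets.trans (Nat.le_self_pow (by decide) _)
  ((senderOut h.key hℓ).sum ((receiverOut h.key hℓ).sum ((party.prod (key h.key)).sum
    (party.sum unit)))).mono (by decide)

theorem reply (h : Params s κ ℓ B) : FewWires s 20 (Reply κ ℓ B) :=
  (unit.sum (bool.sum ((perm h.mul).sum (reveals h)))).mono (by decide)

theorem simAction (h : Params s κ ℓ B) : FewWires s 22 (SimAction κ ℓ B) :=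
  ((boxCmd h).sum (reply h)).mono (by decide)

theorem wires {ι : Type} {hι : Fintype ι} (h : Fintype.card ι ≤ (s + 2) ^ j) :
    FewWires s j (ι → Bool) :=
  (pi h bool).mono (by simp)

end FewWires

open FewWires (Params)

/-! ## Circuits for cases and constructors -/

namespace Cx

variable {s k : ℕ} {κ ℓ B : ℕ} {A δ : Type} [Wired A] [Wired δ]

theorem advCmd {F : A × AdvCmd κ ℓ B → δ}
    (chooseA : Cx s k fun p : A × SenderOut κ (ℓ * B) => F (p.1, .chooseA p.2))
    (chooseB : Cx s k fun p : A × ReceiverOut κ (ℓ * B) => F (p.1, .chooseB p.2))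
    (guess : Cx s k fun p : A × (Fin (ℓ * B) × Bit) => F (p.1, .guess p.2.1 p.2.2))
    (keyQuery : Cx s k fun p : A × (Party × Key κ) => F (p.1, .keyQuery p.2.1 p.2.2))
    (deliverBox : Cx s k fun p : A × Party => F (p.1, .deliverBox p.2))
    (deliverPerm : Cx s k fun p : A × Unit => F (p.1, .deliverPerm))
    (deliverReveals : Cx s k fun p : A × Unit => F (p.1, .deliverReveals))
    (sendPerm : Cx s k fun p : A × Equiv.Perm (Fin (ℓ * B)) => F (p.1, .sendPerm p.2))
    (sendReveals : Cx s k fun p : A × Reveals κ ℓ B => F (p.1, .sendReveals p.2)) :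
    Cx s (k + 32) F := by
  let G : A × (SenderOut κ (ℓ * B) ⊕ ReceiverOut κ (ℓ * B) ⊕ (Fin (ℓ * B) × Bit) ⊕
      (Party × Key κ) ⊕ Party ⊕ Unit ⊕ Unit ⊕ Equiv.Perm (Fin (ℓ * B)) ⊕ Reveals κ ℓ B) → δ :=
    fun p => F (p.1, match p.2 with
      | .inl v => .chooseA v
      | .inr (.inl v) => .chooseB v
      | .inr (.inr (.inl x)) => .guess x.1 x.2
      | .inr (.inr (.inr (.inl x))) => .keyQuery x.1 x.2
      | .inr (.inr (.inr (.inr (.inl x)))) => .deliverBox x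
      | .inr (.inr (.inr (.inr (.inr (.inl _))))) => .deliverPerm
      | .inr (.inr (.inr (.inr (.inr (.inr (.inl _)))))) => .deliverReveals
      | .inr (.inr (.inr (.inr (.inr (.inr (.inr (.inl x))))))) => .sendPerm x
      | .inr (.inr (.inr (.inr (.inr (.inr (.inr (.inr x))))))) => .sendReveals x)
  have hG : Cx s (k + 32) G := by
    -- Eight nested eliminations, each raising the exponent by 4.
    refine Cx.mono (sum_elim chooseA (sum_elim chooseB (sum_elim guess (sum_elim keyQuery
      (sum_elim deliverBox (sum_elim deliverPerm (sum_elim deliverReveals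
        (sum_elim sendPerm sendReveals)))))))) ?_
    omega
  -- A command is encoded through its image in the sum type, so both have the same wires.
  have hw : IsWiring fun p : A × AdvCmd κ ℓ B => (p.1, p.2.toSum) := by
    rintro (w | w)
    · exact ⟨Sum.inl w, rfl⟩
    · exact ⟨Sum.inr w, rfl⟩
  have h := hG.comp_wiring hw
  have e : (fun p : A × AdvCmd κ ℓ B => G (p.1, p.2.toSum)) = F := by
    funext ⟨a, c⟩
    cases c <;> rfl
  rwa [e] at h

theorem simInput {F : A × SimInput κ ℓ B → δ}
    (started : Cx s k fun p : A × Party => F (p.1, .started p.2))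
    (attack : Cx s k fun p : A × AdvCmd κ ℓ B => F (p.1, .attack p.2))
    (answer : Cx s k fun p : A × Bool => F (p.1, .answer p.2)) :
    Cx s (k + 8) F := by
  let G : A × (Party ⊕ AdvCmd κ ℓ B ⊕ Bool) → δ :=
    fun p => F (p.1, match p.2 with
      | .inl v => .started v
      | .inr (.inl v) => .attack v
      | .inr (.inr x) => .answer x)
  have hG : Cx s (k + 8) G := by
    refine Cx.mono (sum_elim started (sum_elim attack answer)) ?_
    omega
  have hw : IsWiring fun p : A × SimInput κ ℓ B => (p.1, p.2.toSum) := by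
    rintro (w | w)
    · exact ⟨Sum.inl w, rfl⟩
    · exact ⟨Sum.inr w, rfl⟩
  have h := hG.comp_wiring hw
  have e : (fun p : A × SimInput κ ℓ B => G (p.1, p.2.toSum)) = F := by
    funext ⟨a, c⟩
    cases c <;> rfl
  rwa [e] at h

theorem call {f : A → BoxCmd κ ℓ} (h : Cx s k f) :
    Cx s k fun a => (SimAction.call (f a) : SimAction κ ℓ B) :=
  inl (γ := Reply κ ℓ B) h

theorem reply {f : A → Reply κ ℓ B} (h : Cx s k f) :
    Cx s k fun a => (SimAction.reply (f a) : SimAction κ ℓ B) :=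
  inr (β := BoxCmd κ ℓ) h

theorem answer {f : A → Bool} (h : Cx s k f) :
    Cx s k fun a => (Reply.answer (f a) : Reply κ ℓ B) :=
  inr (β := Unit) (inl (γ := Equiv.Perm (Fin (ℓ * B)) ⊕ Reveals κ ℓ B) h)

theorem replyPerm {f : A → Equiv.Perm (Fin (ℓ * B))} (h : Cx s k f) :
    Cx s k fun a => (Reply.perm (f a) : Reply κ ℓ B) :=
  inr (β := Unit) (inr (β := Bool) (inl (γ := Reveals κ ℓ B) h))

theorem replyReveals {f : A → Reveals κ ℓ B} (h : Cx s k f) :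
    Cx s k fun a => (Reply.reveals (f a) : Reply κ ℓ B) :=
  inr (β := Unit) (inr (β := Bool) (inr (β := Equiv.Perm (Fin (ℓ * B))) h))

theorem boxChooseA {f : A → SenderOut κ ℓ} (h : Cx s k f) :
    Cx s k fun a => BoxCmd.chooseA (f a) :=
  inl (γ := ReceiverOut κ ℓ ⊕ (Party × Key κ) ⊕ Party ⊕ Unit) h

theorem boxChooseB {f : A → ReceiverOut κ ℓ} (h : Cx s k f) :
    Cx s k fun a => BoxCmd.chooseB (f a) :=
  inr (β := SenderOut κ ℓ) (inl (γ := (Party × Key κ) ⊕ Party ⊕ Unit) h)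

theorem boxKeyQuery {f : A → Party} {g : A → Key κ} (hf : Cx s k f) (hg : Cx s k g) :
    Cx s k fun a => (BoxCmd.keyQuery (f a) (g a) : BoxCmd κ ℓ) :=
  (inr (β := SenderOut κ ℓ) (inr (β := ReceiverOut κ ℓ) (inl (γ := Party ⊕ Unit)
    (prodMk hf hg)))).mono (by simp)

end Cx

/-! ## Simulators with structured memory -/

/-- A simulator with memory `T` and coins `C`. The first of the two extra bits says that the
simulator is finishing an activation and the second that only a reply is missing: after
`(true, false)` it lets the box deliver to the party `honest` and then replies `finish`, after
`(true, true)` it replies `finish`, after `(false, true)` it passes on the answer of the box. -/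
structure Strategy (κ ℓ B : ℕ) (T C : Type) where
  init : T
  start : T → Party → T
  react : T → AdvCmd κ ℓ B → C → Equiv.Perm (Fin (ℓ * B)) → (T × Bool × Bool) × SimAction κ ℓ B
  finish : T → C → Reply κ ℓ B
  honest : Party

namespace Strategy

variable {κ ℓ B : ℕ} {T C : Type} (σ : Strategy κ ℓ B T C)

def next : (T × Bool × Bool) → SimInput κ ℓ B → C → Equiv.Perm (Fin (ℓ * B)) →
    (T × Bool × Bool) × SimAction κ ℓ B
  | (t, _, _), .started P, _, _ => ((σ.start t P, false, false), .reply .silent)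
  | (t, _, _), .attack x, c, π => σ.react t x c π
  | (t, false, _), .answer b, _, _ => ((t, false, false), .reply (.answer b))
  | (t, true, false), .answer _, _, _ => ((t, true, true), .call (.deliver σ.honest))
  | (t, true, true), .answer _, c, _ => ((t, false, false), .reply (σ.finish t c))

variable [Wired T] [Wired C] [FullWired T] [FullWired C]

noncomputable def toSimulator : Simulator κ ℓ B where
  Mem := Wired.Wire (T × Bool × Bool)
  fin := Wired.fin
  coins := @Fintype.card (Wired.Wire C) Wired.fin
  -- The longest activation consists of the attack, the answer to a first command, and the answer to
  -- the delivery that follows it.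
  steps := 3
  init := Wired.enc (σ.init, false, false)
  next := fun p =>
    let _ : Fintype (Wired.Wire C) := Wired.fin
    let o := σ.next (dec p.1) p.2.1 (dec (p.2.2.1 ∘ Fintype.equivFin _)) p.2.2.2
    (Wired.enc o.1, o.2)

theorem costAtMost {s j k c : ℕ} (h : Params s κ ℓ B) (hT : FewWires s j (T × Bool × Bool))
    (hC : FewWires s c C)
    (hstart : Cx s k fun p : T × Party => σ.start p.1 p.2)
    (hreact : Cx s k fun p : (T × C × Equiv.Perm (Fin (ℓ * B))) × AdvCmd κ ℓ B =>
      σ.react p.1.1 p.2 p.1.2.1 p.1.2.2)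
    (hfin : Cx s k fun p : T × C => σ.finish p.1 p.2) {N : ℕ}
    (hN : (s + 2) ^ (j + c + k + 50) ≤ N) : σ.toSimulator.CostAtMost N := by
  have hmain : Cx s (k + 16) fun p : ((T × Bool × Bool) × C × Equiv.Perm (Fin (ℓ * B))) ×
      SimInput κ ℓ B => σ.next p.1.1 p.2 p.1.2.1 p.1.2.2 := by
    refine (Cx.simInput (k := k + 8) ?_ ?_ ?_).mono (by omega)
    · refine Cx.mono (k := k) ?_ (by omega)
      have h1 := hstart.comp_wiring (f := fun p : ((T × Bool × Bool) × C ×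
        Equiv.Perm (Fin (ℓ * B))) × Party => (p.1.1.1, p.2))
        (IsWiring.prodMk isWiring_fst.fst.fst isWiring_snd)
      exact ((h1.prodMk ((Cx.const false).prodMk (Cx.const false))).prodMk
        (Cx.const (SimAction.reply Reply.silent))).mono (by simp)
    · refine Cx.mono (k := k) ?_ (by omega)
      exact hreact.comp_wiring (f := fun p : ((T × Bool × Bool) × C ×
        Equiv.Perm (Fin (ℓ * B))) × AdvCmd κ ℓ B => ((p.1.1.1, p.1.2.1, p.1.2.2), p.2))
        (IsWiring.prodMk (isWiring_fst.fst.fst.prodMk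
          (isWiring_fst.snd.fst.prodMk isWiring_fst.snd.snd)) isWiring_snd)
    · have hf := hfin.comp_wiring (f := fun p : ((T × Bool × Bool) × C ×
        Equiv.Perm (Fin (ℓ * B))) × Bool => (p.1.1.1, p.1.2.1))
        (isWiring_fst.fst.fst.prodMk isWiring_fst.snd.fst)
      have ht : Cx s 0 fun p : ((T × Bool × Bool) × C × Equiv.Perm (Fin (ℓ * B))) × Bool =>
        p.1.1.1 := .of_isWiring isWiring_fst.fst.fst
      have ha : Cx s 0 fun p : ((T × Bool × Bool) × C × Equiv.Perm (Fin (ℓ * B))) × Bool =>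
        p.1.1.2.1 := .of_isWiring isWiring_fst.fst.snd.fst
      have hb : Cx s 0 fun p : ((T × Bool × Bool) × C × Equiv.Perm (Fin (ℓ * B))) × Bool =>
        p.1.1.2.2 := .of_isWiring isWiring_fst.fst.snd.snd
      have hx : Cx s 0 fun p : ((T × Bool × Bool) × C × Equiv.Perm (Fin (ℓ * B))) × Bool =>
        p.2 := .of_isWiring isWiring_snd
      have hr : Cx s 0 fun p : ((T × Bool × Bool) × C × Equiv.Perm (Fin (ℓ * B))) × Bool =>
        (SimAction.reply (.answer p.2) : SimAction κ ℓ B) := hx.answer.reply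
      have h1 := (ht.prodMk ((Cx.const false).prodMk (Cx.const false))).prodMk hr
      have h2 := (ht.prodMk ((Cx.const true).prodMk (Cx.const true))).prodMk
        (Cx.const (SimAction.call (BoxCmd.deliver σ.honest) : SimAction κ ℓ B))
      have h3 := (ht.prodMk ((Cx.const false).prodMk (Cx.const false))).prodMk hf.reply
      have h4 := (ha.ite (hb.ite h3 h2) h1).mono (k' := k + 8) (by omega)
      convert h4 using 2 with p
      obtain ⟨⟨⟨t, _ | _, _ | _⟩, c, π⟩, x⟩ := p <;> rfl
  let _ := σ.toSimulator.fin
  let _ : Fintype (Wired.Wire (T × Bool × Bool)) := Wired.fin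
  have hnext : Cx s (k + 16) σ.toSimulator.next := by
    let _ : Fintype (Wired.Wire C) := Wired.fin
    have hw : IsWiring fun p : (Wired.Wire (T × Bool × Bool) → Bool) × SimInput κ ℓ B ×
        (Fin σ.toSimulator.coins → Bool) × Equiv.Perm (Fin (ℓ * B)) =>
        (((dec p.1 : T × Bool × Bool), (dec (p.2.2.1 ∘ Fintype.equivFin _) : C), p.2.2.2),
          p.2.1) := by
      refine IsWiring.prodMk (IsWiring.prodMk (isWiring_dec fun w => isWiring_fst.apply w)
        (IsWiring.prodMk (isWiring_dec fun w => isWiring_snd.snd.fst.apply _)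
          isWiring_snd.snd.snd)) isWiring_snd.fst
    have h1 := hmain.comp_wiring hw
    rintro (⟨w, _⟩ | w)
    · exact h1 (Sum.inl w)
    · exact h1 (Sum.inr w)
  refine ⟨?_, ?_, ?_, ?_⟩
  · exact le_trans hT (le_trans (base_pow_mono s (by omega)) hN)
  · exact le_trans hC (le_trans (base_pow_mono s (by omega)) hN)
  · refine le_trans ?_ hN
    have h1 := pow_bound s 0 3 2 (by norm_num)
    have h2 := base_pow_mono s (show 0 + 2 ≤ j + c + k + 50 by omega)
    have h3 : σ.toSimulator.steps = 3 := rfl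
    rw [pow_zero] at h1
    omega
  -- The output is the memory, with exponent `j`, next to an action, with exponent 22; the pair
  -- costs one more. Multiplying by the size `k + 16` per wire stays below the exponent `j + c + k +
  -- 50`.
  · obtain ⟨gs, g1, g2, g3⟩ := hnext.hasCircuit (j := j + 23)
      (FewWires.mono (FewWires.prod (i := j) (FewWires.wires hT) (FewWires.simAction h))
        (by omega))
    exact ⟨gs, g1, g2.trans ((base_pow_mono s (by omega)).trans hN), g3⟩

section Activation

variable [Fintype C] [Nonempty C]

/-- The end of an activation, after the first step of the simulator. -/
noncomputable def resolve (cor : Corruption) (b : Box κ ℓ) :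
    (T × Bool × Bool) × SimAction κ ℓ B →
      PMF (((Wired.Wire (T × Bool × Bool) → Bool) × Box κ ℓ) × Response κ ℓ B)
  | (t, .reply r) => PMF.pure ((Wired.enc t, b), ⟨r, []⟩)
  | ((t, false, _), .call x) => PMF.pure ((Wired.enc (t, false, false), (b.command cor x).1),
      ⟨.answer (b.command cor x).2.1, (b.command cor x).2.2⟩)
  | ((t, true, true), .call x) => (PMF.uniformOfFintype C).bind fun c =>
      PMF.pure ((Wired.enc (t, false, false), (b.command cor x).1),
        ⟨σ.finish t c, (b.command cor x).2.2⟩)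
  | ((t, true, false), .call x) => (PMF.uniformOfFintype C).bind fun c =>
      PMF.pure ((Wired.enc (t, false, false),
          ((b.command cor x).1.command cor (.deliver σ.honest)).1),
        ⟨σ.finish t c, (b.command cor x).2.2 ++
          ((b.command cor x).1.command cor (.deliver σ.honest)).2.2⟩)

theorem bind_coins {D : Type} (g : C → PMF D) :
    ((PMF.uniformOfFintype (Fin σ.toSimulator.coins → Bool)).bind fun ρ =>
      let _ : Fintype (Wired.Wire C) := Wired.fin
      g (dec (ρ ∘ Fintype.equivFin _))) = (PMF.uniformOfFintype C).bind g := by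
  let _ : Fintype (Wired.Wire C) := Wired.fin
  refine Regular.bind_comp (f := fun ρ : Fin σ.toSimulator.coins → Bool =>
    (dec (ρ ∘ Fintype.equivFin (Wired.Wire C)) : C)) (Regular.of_bijective ?_) g
  exact dec_bijective.comp ((Fintype.equivFin (Wired.Wire C)).arrowCongr
    (Equiv.refl Bool)).symm.bijective

/-- One activation, in terms of structured memory. -/
noncomputable def run (cor : Corruption) (D : PMF (Equiv.Perm (Fin (ℓ * B)))) :
    ℕ → T × Bool × Bool → Box κ ℓ → SimInput κ ℓ B →
      PMF (((Wired.Wire (T × Bool × Bool) → Bool) × Box κ ℓ) × Response κ ℓ B)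
  | 0, t, b, _ => PMF.pure ((Wired.enc t, b), ⟨.silent, []⟩)
  | k + 1, t, b, i => (PMF.uniformOfFintype C).bind fun c => D.bind fun π =>
      match σ.next t i c π with
      | (t', .reply r) => PMF.pure ((Wired.enc t', b), ⟨r, []⟩)
      | (t', .call x) => (run cor D k t' (b.command cor x).1 (.answer (b.command cor x).2.1)).map
          fun sr => (sr.1, ⟨sr.2.reply, (b.command cor x).2.2 ++ sr.2.outputs⟩)

theorem activate_eq_run (D : PMF (Equiv.Perm (Fin (ℓ * B)))) (cor : Corruption) (k : ℕ) :
    ∀ (t : T × Bool × Bool) (b : Box κ ℓ) (i : SimInput κ ℓ B),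
      σ.toSimulator.activate D cor k (Wired.enc t, b) i = σ.run cor D k t b i := by
  induction k with
  | zero => intro t b i; rfl
  | succ k ih =>
    intro t b i
    rw [run, ← σ.bind_coins]
    simp only [Simulator.activate]
    congr 1
    funext ρ
    congr 1
    funext π
    simp only [toSimulator, dec_enc]
    generalize σ.next t i _ π = o
    obtain ⟨t', x | r⟩ := o
    · exact congrArg (PMF.map fun sr : ((Wired.Wire (T × Bool × Bool) → Bool) × Box κ ℓ) ×
        Response κ ℓ B => (sr.1, (⟨sr.2.reply, (b.command cor x).2.2 ++ sr.2.outputs⟩ :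
          Response κ ℓ B))) (ih _ _ _)
    · rfl

/-- For each setting of the two control bits the activation ends within three steps, so the step
bound never cuts it off. -/
theorem run_attack (D : PMF (Equiv.Perm (Fin (ℓ * B)))) (cor : Corruption) (t : T)
    (b : Box κ ℓ) (x : AdvCmd κ ℓ B) :
    σ.run cor D 3 (t, false, false) b (.attack x) =
      (PMF.uniformOfFintype C).bind fun c => D.bind fun π =>
        σ.resolve cor b (σ.react t x c π) := by
  rw [run]
  congr 1
  funext c
  congr 1
  funext π
  simp only [next]
  generalize σ.react t x c π = o
  obtain ⟨⟨t', _ | _, _ | _⟩, y | r⟩ := o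
  all_goals simp [resolve, run, next, PMF.pure_map, PMF.map_bind, PMF.bind_const]

theorem step_attack (D : PMF (Equiv.Perm (Fin (ℓ * B)))) (cor : Corruption) (t : T)
    (b : Box κ ℓ) (x : AdvCmd κ ℓ B) :
    (idealWorld σ.toSimulator D cor).step (Wired.enc (t, false, false), b) (.attack x) =
      (PMF.uniformOfFintype C).bind fun c => D.bind fun π =>
        σ.resolve cor b (σ.react t x c π) :=
  (σ.activate_eq_run D cor 3 _ b _).trans (σ.run_attack D cor t b x)

theorem step_attack_of_react {D : PMF (Equiv.Perm (Fin (ℓ * B)))} {cor : Corruption} {t : T}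
    {b : Box κ ℓ} {x : AdvCmd κ ℓ B} {o : (T × Bool × Bool) × SimAction κ ℓ B}
    (h : ∀ c π, σ.react t x c π = o) :
    (idealWorld σ.toSimulator D cor).step (Wired.enc (t, false, false), b) (.attack x) =
      σ.resolve cor b o := by
  rw [step_attack]
  simp only [h, PMF.bind_const]
  rfl

theorem step_attack_of_perm {D : PMF (Equiv.Perm (Fin (ℓ * B)))} {cor : Corruption} {t : T}
    {b : Box κ ℓ} {x : AdvCmd κ ℓ B}
    {o : Equiv.Perm (Fin (ℓ * B)) → (T × Bool × Bool) × SimAction κ ℓ B}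
    (h : ∀ c π, σ.react t x c π = o π) :
    (idealWorld σ.toSimulator D cor).step (Wired.enc (t, false, false), b) (.attack x) =
      D.bind fun π => σ.resolve cor b (o π) := by
  rw [step_attack]
  simp only [h, PMF.bind_const]
  rfl

theorem step_start (D : PMF (Equiv.Perm (Fin (ℓ * B)))) (cor : Corruption) (t : T)
    (b : Box κ ℓ) (P : Party) :
    (idealWorld σ.toSimulator D cor).step (Wired.enc (t, false, false), b) (.start P) =
      if cor = some P then PMF.pure ((Wired.enc (t, false, false), b), ⟨.silent, []⟩)
      else PMF.pure ((Wired.enc (σ.start t P, false, false), b.start cor P), ⟨.silent, []⟩) := by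
  change (if cor = some P then _ else σ.toSimulator.activate D cor 3 _ _) = _
  rw [activate_eq_run, run]
  simp only [next, PMF.bind_const]
  by_cases h : cor = some P
  · exact (if_pos h).trans (if_pos h).symm
  · exact (if_neg h).trans (if_neg h).symm

end Activation

end Strategy

/-! ## Combining authenticated OTs -/

section Combine

variable {κ : ℕ}

theorem bit_add_self (x : Bit) : x + x = 0 := CharTwo.add_self_eq_zero x

theorem key_add_self (x : Key κ) : x + x = 0 := funext fun _ => bit_add_self _

@[ext]
theorem SenderView.ext' {a b : SenderView κ} (h₁ : a.x₀ = b.x₀) (h₂ : a.x₁ = b.x₁)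
    (h₃ : a.m₀ = b.m₀) (h₄ : a.m₁ = b.m₁) (h₅ : a.kc = b.kc) (h₆ : a.kz = b.kz) : a = b := by
  cases a; cases b; simp_all

@[ext]
theorem ReceiverView.ext' {a b : ReceiverView κ} (h₁ : a.k₀ = b.k₀) (h₂ : a.k₁ = b.k₁)
    (h₃ : a.c = b.c) (h₄ : a.mc = b.mc) (h₅ : a.z = b.z) (h₆ : a.mz = b.mz) : a = b := by
  cases a; cases b; simp_all

/-- Correctness of the combiner. With s = x₀ + x₁, the combined OT has difference s², while z¹ + z²
contributes c¹s¹ + c²s²; adding d c¹ with d = s¹ + s² replaces c¹s¹ by c¹s². The MACs follow by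
linearity. -/
theorem combineB_receiverOf (ΔA ΔB : Key κ) (a a' : SenderView κ) (c c' : Bit) :
    combineB (receiverOf ΔA ΔB a c) (receiverOf ΔA ΔB a' c') (revealed a a').1 =
      receiverOf ΔA ΔB (combineA a a' (revealed a a').1) (c + c') := by
  ext1
  · funext i
    simp only [combineB, receiverOf, combineA, Pi.add_apply, Pi.smul_apply, smul_eq_mul]
    ring
  · funext i
    simp only [combineB, receiverOf, combineA, Pi.add_apply, Pi.smul_apply, smul_eq_mul]
    ring
  · rfl
  · funext i
    simp only [combineB, receiverOf, combineA, Pi.add_apply, Pi.smul_apply, smul_eq_mul]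
    ring
  · simp only [combineB, receiverOf, combineA, revealed]
    grind
  · funext i
    simp only [combineB, receiverOf, combineA, revealed, Pi.add_apply, Pi.smul_apply, smul_eq_mul]
    grind

theorem foldB_receiverOf (ΔA ΔB : Key κ) (v : ℕ → SenderView κ) (c d : ℕ → Bit) (k : ℕ)
    (hd : ∀ i < k, d i = (revealed (foldA v i) (v (i + 1))).1) :
    foldB (fun i => receiverOf ΔA ΔB (v i) (c i)) d k =
      receiverOf ΔA ΔB (foldA v k) (∑ i ∈ Finset.range (k + 1), c i) := by
  induction k with
  | zero => simp [foldB, foldA]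
  | succ k ih =>
    rw [foldB, foldA, ih fun i hi => hd i (by omega), hd k (by omega), combineB_receiverOf,
      ← Finset.sum_range_succ]

/-- This and the similar closed forms below are what the circuits compute: unrolling the recursion
gate by gate would raise the exponent with every combination, whereas a sum costs a constant in the
exponent. -/
theorem foldA_x₀ (v : ℕ → SenderView κ) (k : ℕ) :
    (foldA v k).x₀ = ∑ i ∈ Finset.range (k + 1), (v i).x₀ := by
  induction k with
  | zero => simp [foldA]
  | succ k ih => rw [Finset.sum_range_succ, ← ih]; rfl

theorem foldA_m₀ (v : ℕ → SenderView κ) (k : ℕ) :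
    (foldA v k).m₀ = ∑ i ∈ Finset.range (k + 1), (v i).m₀ := by
  induction k with
  | zero => simp [foldA]
  | succ k ih => rw [Finset.sum_range_succ, ← ih]; rfl

theorem foldA_kc (v : ℕ → SenderView κ) (k : ℕ) :
    (foldA v k).kc = ∑ i ∈ Finset.range (k + 1), (v i).kc := by
  induction k with
  | zero => simp [foldA]
  | succ k ih => rw [Finset.sum_range_succ, ← ih]; rfl

theorem foldA_x₁ (v : ℕ → SenderView κ) (k : ℕ) :
    (foldA v k).x₁ = ∑ i ∈ Finset.range k, (v i).x₀ + (v k).x₁ := by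
  cases k with
  | zero => simp [foldA]
  | succ k => rw [← foldA_x₀]; rfl

theorem foldA_m₁ (v : ℕ → SenderView κ) (k : ℕ) :
    (foldA v k).m₁ = ∑ i ∈ Finset.range k, (v i).m₀ + (v k).m₁ := by
  cases k with
  | zero => simp [foldA]
  | succ k => rw [← foldA_m₀]; rfl

/-- The combiner keeps the difference of its second argument, so the running result has the
difference of the last OT added. Consequently each revealed bit depends on two neighbouring OTs of
the bucket only, as `revealed_foldA` records. -/
theorem foldA_x_add (v : ℕ → SenderView κ) (k : ℕ) :
    (foldA v k).x₀ + (foldA v k).x₁ = (v k).x₀ + (v k).x₁ := by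
  rw [foldA_x₀, foldA_x₁, Finset.sum_range_succ]
  grind

theorem foldA_m_add (v : ℕ → SenderView κ) (k : ℕ) :
    (foldA v k).m₀ + (foldA v k).m₁ = (v k).m₀ + (v k).m₁ := by
  rw [foldA_m₀, foldA_m₁, Finset.sum_range_succ]
  have := key_add_self (∑ i ∈ Finset.range k, (v i).m₀)
  rw [add_add_add_comm, this, zero_add]

theorem revealed_foldA (v : ℕ → SenderView κ) (k : ℕ) (a : SenderView κ) :
    revealed (foldA v k) a = revealed (v k) a := by
  simp only [revealed, foldA_x_add, foldA_m_add]

theorem foldA_kz (v : ℕ → SenderView κ) (k : ℕ) :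
    (foldA v k).kz = ∑ i ∈ Finset.range (k + 1), (v i).kz +
      ∑ i ∈ Finset.range k, (revealed (v i) (v (i + 1))).1 •
        ∑ t ∈ Finset.range (i + 1), (v t).kc := by
  induction k with
  | zero => simp [foldA]
  | succ k ih =>
    rw [Finset.sum_range_succ _ (k + 1), Finset.sum_range_succ (fun i =>
      (revealed (v i) (v (i + 1))).1 •
      ∑ t ∈ Finset.range (i + 1), (v t).kc) k, foldA]
    simp only [combineA, ih, revealed_foldA, foldA_kc]
    abel

theorem foldB_k₀ (v : ℕ → ReceiverView κ) (d : ℕ → Bit) (k : ℕ) :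
    (foldB v d k).k₀ = ∑ i ∈ Finset.range (k + 1), (v i).k₀ := by
  induction k with
  | zero => simp [foldB]
  | succ k ih => rw [Finset.sum_range_succ, ← ih]; rfl

theorem foldB_k₁ (v : ℕ → ReceiverView κ) (d : ℕ → Bit) (k : ℕ) :
    (foldB v d k).k₁ = ∑ i ∈ Finset.range k, (v i).k₀ + (v k).k₁ := by
  cases k with
  | zero => simp [foldB]
  | succ k => rw [← foldB_k₀ v d]; rfl

theorem foldB_c (v : ℕ → ReceiverView κ) (d : ℕ → Bit) (k : ℕ) :
    (foldB v d k).c = ∑ i ∈ Finset.range (k + 1), (v i).c := by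
  induction k with
  | zero => simp [foldB]
  | succ k ih => rw [Finset.sum_range_succ, ← ih]; rfl

theorem foldB_mc (v : ℕ → ReceiverView κ) (d : ℕ → Bit) (k : ℕ) :
    (foldB v d k).mc = ∑ i ∈ Finset.range (k + 1), (v i).mc := by
  induction k with
  | zero => simp [foldB]
  | succ k ih => rw [Finset.sum_range_succ, ← ih]; rfl

theorem foldB_z (v : ℕ → ReceiverView κ) (d : ℕ → Bit) (k : ℕ) :
    (foldB v d k).z = ∑ i ∈ Finset.range (k + 1), (v i).z +
      ∑ i ∈ Finset.range k, d i * ∑ t ∈ Finset.range (i + 1), (v t).c := by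
  induction k with
  | zero => simp [foldB]
  | succ k ih =>
    rw [Finset.sum_range_succ _ (k + 1), Finset.sum_range_succ (fun i =>
      d i * ∑ t ∈ Finset.range (i + 1), (v t).c) k, foldB]
    simp only [combineB, ih, foldB_c]
    abel

theorem foldB_mz (v : ℕ → ReceiverView κ) (d : ℕ → Bit) (k : ℕ) :
    (foldB v d k).mz = ∑ i ∈ Finset.range (k + 1), (v i).mz +
      ∑ i ∈ Finset.range k, d i • ∑ t ∈ Finset.range (i + 1), (v t).mc := by
  induction k with
  | zero => simp [foldB]
  | succ k ih =>
    rw [Finset.sum_range_succ _ (k + 1), Finset.sum_range_succ (fun i =>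
      d i • ∑ t ∈ Finset.range (i + 1), (v t).mc) k, foldB]
    simp only [combineB, ih, foldB_mc]
    abel

theorem revealedKey_foldB (v : ℕ → ReceiverView κ) (d : ℕ → Bit) (k : ℕ) (b : ReceiverView κ) :
    revealedKey (foldB v d k) b = revealedKey (v k) b := by
  simp only [revealedKey]
  rw [foldB_k₀, foldB_k₁, Finset.sum_range_succ]
  have := key_add_self (∑ i ∈ Finset.range k, (v i).k₀)
  rw [add_add_add_comm, this, zero_add]

theorem revealedKey_receiverOf (ΔA ΔB : Key κ) (a a' : SenderView κ) (c c' : Bit) :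
    revealedKey (receiverOf ΔA ΔB a c) (receiverOf ΔA ΔB a' c') =
      (revealed a a').2 + (revealed a a').1 • ΔA := by
  funext i
  simp only [revealedKey, revealed, receiverOf, Pi.add_apply, Pi.smul_apply, smul_eq_mul]
  ring

/-- A quadruple can be parametrised from Alice's side or from Bob's. Translating between the two
lets the case of a corrupted Bob reuse computations made from Alice's side. -/
theorem receiverOf_senderOf (ΔA ΔB : Key κ) (b : ReceiverView κ) (y : Bit) :
    receiverOf ΔA ΔB (senderOf ΔA ΔB b y) b.c = b := by
  have hc : b.c = 0 ∨ b.c = 1 := by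
    generalize b.c = x; revert x; decide
  have h1 : (1 : Bit) ≠ 0 := by decide
  have key : ∀ (x : Bit) (u v : Key κ), u + x • v + x • v = u := fun x u v => by
    rw [add_assoc, key_add_self, add_zero]
  have e : y + (b.z + y) = b.z := by grind
  rcases hc with hc | hc <;> ext1 <;>
    simp [receiverOf, senderOf, hc, key, h1, add_assoc, key_add_self, e]

/-- The bit that Bob did not select is z + (x₀ + x₁), because z is the selected one of the two. -/
theorem senderOf_receiverOf (ΔA ΔB : Key κ) (a : SenderView κ) (c : Bit) :
    senderOf ΔA ΔB (receiverOf ΔA ΔB a c) ((receiverOf ΔA ΔB a c).z + (a.x₀ + a.x₁)) = a := by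
  have hc : c = 0 ∨ c = 1 := by revert c; decide
  have h1 : (1 : Bit) ≠ 0 := by decide
  have e0 : a.x₀ + (a.x₀ + a.x₁) = a.x₁ := by grind
  have e1 : a.x₀ + a.x₁ + a.x₀ = a.x₁ := by grind
  have e2 : a.x₁ + (a.x₀ + a.x₁) = a.x₀ := by grind
  rcases hc with rfl | rfl <;> ext1 <;>
    simp [receiverOf, senderOf, h1, add_assoc, key_add_self, e0, e1, e2]

theorem senderOf_x_add (ΔA ΔB : Key κ) (b : ReceiverView κ) (y : Bit) :
    (senderOf ΔA ΔB b y).x₀ + (senderOf ΔA ΔB b y).x₁ = b.z + y := by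
  simp only [senderOf]
  split
  · rfl
  · rw [add_comm]

end Combine

/-! ## Buckets -/

section Bucket

variable {κ ℓ B : ℕ} (π : Equiv.Perm (Fin (ℓ * B)))

theorem bucket_receiverOf (ΔA ΔB : Key κ) (v : Fin (ℓ * B) → SenderView κ)
    (c : Fin (ℓ * B) → Bit) (j : Fin ℓ) :
    bucket π (fun i => receiverOf ΔA ΔB (v i) (c i)) j =
      fun i => receiverOf ΔA ΔB (bucket π v j i) (bucket π c j i) := by
  funext i
  unfold bucket
  split
  · rfl
  -- Positions beyond the bucket are padded by zeros, and the all-zero quadruple with choice bit 0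
  -- is valid for all global keys.
  · change (⟨0, 0, 0, 0, 0, 0⟩ : ReceiverView κ) =
      receiverOf ΔA ΔB ⟨0, 0, 0, 0, 0, 0⟩ (0 : Bit)
    simp [receiverOf]

/-- The choice bits of the combined OTs. -/
def bucketSum (c : Fin (ℓ * B) → Bit) (j : Fin ℓ) : Bit :=
  ∑ i ∈ Finset.range B, bucket π c j i

/-- Only the bits of `r` matter and not the MACs, so this applies also to simulated messages whose
MACs are set to 0. -/
theorem bobResult_receiverOf (hB : 1 ≤ B) (ΔA ΔB : Key κ) (v : Fin (ℓ * B) → SenderView κ)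
    (c : Fin (ℓ * B) → Bit) (r : Reveals κ ℓ B)
    (hr : ∀ j k, (r j k).1 = (aliceReveals π v j k).1) :
    bobResult π (fun i => receiverOf ΔA ΔB (v i) (c i)) r =
      fun j => receiverOf ΔA ΔB (aliceResult π v j) (bucketSum π c j) := by
  funext j
  rw [bobResult, bucket_receiverOf, foldB_receiverOf, aliceResult, bucketSum,
    Nat.sub_add_cancel hB]
  intro i hi
  rw [revealedBits, dif_pos hi, hr]
  rfl

theorem bobAccepts_receiverOf (ΔA ΔB : Key κ) (v : Fin (ℓ * B) → SenderView κ)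
    (c : Fin (ℓ * B) → Bit) (r : Reveals κ ℓ B) :
    BobAccepts ΔA π (fun i => receiverOf ΔA ΔB (v i) (c i)) r ↔
      ∀ j k, (r j k).2 = (aliceReveals π v j k).2 +
        ((aliceReveals π v j k).1 + (r j k).1) • ΔA := by
  unfold BobAccepts
  refine forall_congr' fun j => forall_congr' fun k => ?_
  rw [bucket_receiverOf, revealedKey_foldB, revealedKey_receiverOf, aliceReveals, revealed_foldA,
    add_smul, add_assoc]

theorem bobAccepts_aliceReveals (ΔA ΔB : Key κ) (v : Fin (ℓ * B) → SenderView κ)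
    (c : Fin (ℓ * B) → Bit) :
    BobAccepts ΔA π (fun i => receiverOf ΔA ΔB (v i) (c i)) (aliceReveals π v) := by
  rw [bobAccepts_receiverOf]
  intro j k
  rw [bit_add_self, zero_smul, add_zero]

/-- A forgery determines the global key. -/
theorem eq_of_bobAccepts {ΔA ΔB : Key κ} {v : Fin (ℓ * B) → SenderView κ}
    {c : Fin (ℓ * B) → Bit} {r : Reveals κ ℓ B}
    (h : BobAccepts ΔA π (fun i => receiverOf ΔA ΔB (v i) (c i)) r) :
    r = aliceReveals π v ∨ ∃ j k, (r j k).1 ≠ (aliceReveals π v j k).1 ∧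
      ΔA = (r j k).2 + (aliceReveals π v j k).2 := by
  rw [bobAccepts_receiverOf] at h
  by_cases hr : ∀ j k, (r j k).1 = (aliceReveals π v j k).1
  · left
    funext j k
    refine Prod.ext (hr j k) ?_
    rw [h j k, hr j k, bit_add_self, zero_smul, add_zero]
  · right
    push Not at hr
    obtain ⟨j, k, hjk⟩ := hr
    refine ⟨j, k, hjk, ?_⟩
    have e : (aliceReveals π v j k).1 + (r j k).1 = 1 := by
      revert hjk
      generalize (r j k).1 = x
      generalize (aliceReveals π v j k).1 = y
      revert x y
      decide
    rw [h j k, e, one_smul, add_right_comm, key_add_self, zero_add]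

end Bucket

/-! ## Uniformity of the combined OTs -/

section Uniform

variable {κ : ℕ}

/-- The involution exchanges the two fibres. -/
theorem Regular.of_shift {A : Type} [Fintype A] [Nonempty A] {f : A → Bit} (σ : A → A)
    (hσ : Function.Involutive σ) (h : ∀ a, f (σ a) = f a + 1) : Regular f := by
  rw [regular_iff_card]
  have hc : (Finset.univ.filter fun a => f a = 0).card =
      (Finset.univ.filter fun a => f a = 1).card := by
    refine Finset.card_bij' (fun a _ => σ a) (fun a _ => σ a) ?_ ?_ ?_ ?_
    · intro a ha
      simp only [Finset.mem_filter, Finset.mem_univ, true_and] at ha ⊢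
      rw [h, ha]; rfl
    · intro a ha
      simp only [Finset.mem_filter, Finset.mem_univ, true_and] at ha ⊢
      rw [h, ha]; rfl
    · exact fun a _ => hσ a
    · exact fun a _ => hσ a
  have hs : (Finset.univ.filter fun a => f a = 0).card +
      (Finset.univ.filter fun a => f a = 1).card = Fintype.card A := by
    rw [← Finset.card_univ, ← Finset.card_filter_add_card_filter_not (s := Finset.univ)
      (fun a => f a = 0)]
    congr 2
    ext a
    simp only [Finset.mem_filter, Finset.mem_univ, true_and]
    generalize f a = x
    revert x
    decide
  have h2 : Fintype.card Bit = 2 := ZMod.card 2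
  intro b
  have hb : b = 0 ∨ b = 1 := by revert b; decide
  rw [h2]
  rcases hb with rfl | rfl <;> omega

/-- A sum of bits, some of them fixed, is uniform if at least one of them is. -/
theorem regular_sum {n : ℕ} (l : Fin n → Option Bit) (i₀ : Fin n) (h : l i₀ = none) :
    Regular (fun u : Fin n → Bit => ∑ i, (l i).getD (u i)) := by
  refine .of_shift (fun u => Function.update u i₀ (u i₀ + 1)) (fun u => ?_) fun u => ?_
  · funext i
    by_cases hi : i = i₀
    · subst hi
      simp only [Function.update_self]
      rw [add_assoc, bit_add_self, add_zero]
    · simp [Function.update_of_ne hi]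
  · rw [← Finset.add_sum_erase _ _ (Finset.mem_univ i₀),
      ← Finset.add_sum_erase Finset.univ (fun i => (l i).getD (u i)) (Finset.mem_univ i₀)]
    have : ∑ i ∈ Finset.univ.erase i₀, (l i).getD (Function.update u i₀ (u i₀ + 1) i) =
        ∑ i ∈ Finset.univ.erase i₀, (l i).getD (u i) :=
      Finset.sum_congr rfl fun i hi => by rw [Function.update_of_ne (Finset.ne_of_mem_erase hi)]
    rw [this]
    simp only [h, Function.update_self, Option.getD_none]
    ring

def pairStep (p : SenderView κ × SenderView κ) : SenderView κ × (Bit × Key κ) :=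
  (combineA p.1 p.2 (revealed p.1 p.2).1, revealed p.1 p.2)

instance : Nonempty (SenderView κ) := ⟨default⟩

/-- Revealing d with its MAC says nothing about the combined OT. The map becomes a bijection when
x₀, m₀ and the two keys of the first quadruple are appended: its x₁ and m₁ are then read off from
the revealed pair, and the second quadruple from the result. -/
theorem regular_pairStep : Regular (pairStep (κ := κ)) := by
  have hb : Function.Bijective (fun p : SenderView κ × SenderView κ =>
      (pairStep p, (p.1.x₀, p.1.m₀, p.1.kc, p.1.kz))) := by
    rw [Function.bijective_iff_has_inverse]
    refine ⟨fun q => (⟨q.2.1, q.1.2.1 + q.2.1 + q.1.1.x₀ + q.1.1.x₁, q.2.2.1,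
      q.1.2.2 + q.2.2.1 + q.1.1.m₀ + q.1.1.m₁, q.2.2.2.1, q.2.2.2.2⟩,
      ⟨q.1.1.x₀ + q.2.1, q.1.1.x₁ + q.2.1, q.1.1.m₀ + q.2.2.1, q.1.1.m₁ + q.2.2.1,
        q.1.1.kc + q.2.2.2.1, q.1.1.kz + q.2.2.2.2 + q.1.2.1 • q.2.2.2.1⟩), ?_, ?_⟩
    · rintro ⟨a, a'⟩
      refine Prod.ext ?_ ?_ <;> ext1 <;> (try funext i) <;>
        (try simp only [pairStep, combineA, revealed, Pi.add_apply, Pi.smul_apply,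
          smul_eq_mul]) <;>
        grind
    · rintro ⟨⟨⟨x₀, x₁, m₀, m₁, kc, kz⟩, d, M⟩, y, w, u, v⟩
      simp only [pairStep, combineA, revealed, Prod.mk.injEq, SenderView.mk.injEq, and_true]
      have hd : y + (d + y + x₀ + x₁) + (x₀ + y) + (x₁ + y) = d := by grind
      rw [hd]
      refine ⟨⟨?_, ?_, ?_, ?_, ?_, ?_⟩, rfl, ?_⟩ <;> (try funext i) <;>
        (try simp only [Pi.add_apply, Pi.smul_apply, smul_eq_mul]) <;> grind
  exact regular_fst.comp (.of_bijective hb)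

/-- The sequence that continues a tuple by default values. -/
def extend {α : Type} [Inhabited α] {n : ℕ} (u : Fin n → α) (i : ℕ) : α :=
  if h : i < n then u ⟨i, h⟩ else default

theorem foldA_congr {v w : ℕ → SenderView κ} {k : ℕ} (h : ∀ i ≤ k, v i = w i) :
    foldA v k = foldA w k := by
  induction k with
  | zero => exact h 0 le_rfl
  | succ k ih => rw [foldA, foldA, ih fun i hi => h i (by omega), h (k + 1) le_rfl]

def foldTuple (m : ℕ) (u : Fin (m + 1) → SenderView κ) :
    SenderView κ × (Fin m → Bit × Key κ) :=
  (foldA (extend u) m, fun k => revealed (foldA (extend u) k) (extend u (k + 1)))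

theorem extend_init {α : Type} [Inhabited α] {m : ℕ} (u : Fin (m + 2) → α) {i : ℕ}
    (hi : i ≤ m) : extend (fun x : Fin (m + 1) => u x.castSucc) i = extend u i := by
  unfold extend
  rw [dif_pos (by omega), dif_pos (by omega)]
  rfl

/-- Induction on the bucket size: the running result is uniform and independent of what has been
revealed, and combining it with a fresh quadruple is one application of `regular_pairStep`. The
remaining maps only regroup tuples. -/
theorem regular_foldTuple (m : ℕ) : Regular (foldTuple (κ := κ) m) := by
  induction m with
  | zero =>
    refine .of_bijective ⟨fun u v h => ?_, fun p => ⟨fun _ => p.1, ?_⟩⟩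
    · funext i
      obtain rfl : i = 0 := by ext; omega
      simpa [foldTuple, foldA, extend] using congrArg Prod.fst h
    · refine Prod.ext ?_ (funext fun k => k.elim0)
      simp [foldTuple, foldA, extend]
  | succ m ih =>
    have h1 : Regular fun u : Fin (m + 2) → SenderView κ =>
        ((fun x : Fin (m + 1) => u x.castSucc), u (Fin.last (m + 1))) := by
      refine .of_bijective ⟨fun u v h => ?_, fun p => ⟨Fin.snoc p.1 p.2, by simp⟩⟩
      funext i
      induction i using Fin.lastCases with
      | last => exact congrArg Prod.snd h
      | cast i => exact congrFun (congrArg Prod.fst h) i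
    have h2 := (regular_prodMap ih (Regular.of_bijective
      (Function.bijective_id : Function.Bijective (id : SenderView κ → SenderView κ)))).comp h1
    have h3 : Regular fun p : (SenderView κ × (Fin m → Bit × Key κ)) × SenderView κ =>
        (((p.1.1, p.2), p.1.2) : (SenderView κ × SenderView κ) × (Fin m → Bit × Key κ)) :=
      .of_bijective ⟨fun p q h => by
        obtain ⟨⟨a, b⟩, c⟩ := p; obtain ⟨⟨a', b'⟩, c'⟩ := q; simp_all, fun p =>
        ⟨((p.1.1, p.2), p.1.2), rfl⟩⟩
    have h4 := (regular_prodMap (regular_pairStep (κ := κ)) (Regular.of_bijective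
      (Function.bijective_id : Function.Bijective
        (id : (Fin m → Bit × Key κ) → (Fin m → Bit × Key κ))))).comp (h3.comp h2)
    have h5 : Regular fun p : (SenderView κ × (Bit × Key κ)) × (Fin m → Bit × Key κ) =>
        ((p.1.1, (Fin.snoc p.2 p.1.2 : Fin (m + 1) → Bit × Key κ)) :
          SenderView κ × (Fin (m + 1) → Bit × Key κ)) := by
      refine .of_bijective ⟨fun p q h => ?_, fun p =>
        ⟨((p.1, p.2 (Fin.last m)), fun k => p.2 k.castSucc), ?_⟩⟩
      · obtain ⟨⟨a, b⟩, c⟩ := p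
        obtain ⟨⟨a', b'⟩, c'⟩ := q
        simp only [Prod.mk.injEq] at h ⊢
        obtain ⟨ha, hs⟩ := h
        refine ⟨⟨ha, ?_⟩, ?_⟩
        · simpa using congrFun hs (Fin.last m)
        · funext k
          simpa using congrFun hs k.castSucc
      · refine Prod.ext rfl ?_
        funext k
        induction k using Fin.lastCases <;> simp
    have h6 := h5.comp h4
    convert h6 using 2 with u
    have e1 : ∀ k ≤ m, foldA (extend fun x : Fin (m + 1) => u x.castSucc) k =
        foldA (extend u) k := fun k hk => foldA_congr fun i hi => extend_init u (by omega)
    have e2 : extend u (m + 1) = u (Fin.last (m + 1)) := by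
      unfold extend; rw [dif_pos (by omega)]; rfl
    refine Prod.ext ?_ (funext fun k => ?_)
    · simp [foldTuple, pairStep, foldA, e1, e2]
    · induction k using Fin.lastCases with
      | last => simp [foldTuple, pairStep, e1, e2]
      | cast k =>
        have := k.2
        simp [foldTuple, e1 k (by omega), extend_init u (show (k : ℕ) + 1 ≤ m by omega)]

/-- The unselected bits of a bucket correspond to the revealed bits and the unselected bit of
the result. -/
theorem bijective_revealed (m : ℕ) (z : ℕ → Bit) (F : (Fin m → Bit) → Bit) :
    Function.Bijective fun y : Fin (m + 1) → Bit =>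
      (((fun k => (z k + extend y k) + (z (k + 1) + extend y (k + 1))),
        F (fun k => (z k + extend y k) + (z (k + 1) + extend y (k + 1))) + (z m + extend y m)) :
        (Fin m → Bit) × Bit) := by
  rw [Fintype.bijective_iff_injective_and_card]
  constructor
  · intro y y' h
    simp only [Prod.mk.injEq] at h
    obtain ⟨h1, h2⟩ := h
    rw [h1] at h2
    have hm : extend y m = extend y' m := add_left_cancel (add_left_cancel h2)
    -- The component containing `F` gives the last bit, since `F` depends only on revealed bits.
    -- From there the revealed sums of neighbours determine the earlier bits, going downwards.
    have key : ∀ t ≤ m, extend y (m - t) = extend y' (m - t) := by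
      intro t
      induction t with
      | zero => intro _; exact hm
      | succ t ih =>
        intro ht
        have h3 := congrFun h1 ⟨m - (t + 1), by omega⟩
        simp only at h3
        rw [show m - (t + 1) + 1 = m - t by omega, ih (by omega)] at h3
        exact add_left_cancel (add_right_cancel h3)
    funext i
    have hi := i.2
    have h3 := key (m - i) (by omega)
    rw [show m - (m - (i : ℕ)) = i by omega] at h3
    unfold extend at h3
    rwa [dif_pos hi, dif_pos hi] at h3
  · simp [pow_succ]

end Uniform

/-! ### Uniformity in all buckets simultaneously. -/

section Buckets

variable {κ ℓ B : ℕ} (π : Equiv.Perm (Fin (ℓ * B)))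

/-- The positions of bucket `j`. -/
def position (p : Fin ℓ × Fin B) : Fin (ℓ * B) := π (finProdFinEquiv p)

theorem position_bijective : Function.Bijective (position π) :=
  π.bijective.comp finProdFinEquiv.bijective

theorem bijective_byBucket {α : Type} : Function.Bijective
    fun (v : Fin (ℓ * B) → α) (j : Fin ℓ) (i : Fin B) => v (position π (j, i)) := by
  refine ⟨fun v w h => ?_, fun f => ?_⟩
  · funext x
    obtain ⟨⟨j, i⟩, rfl⟩ := (position_bijective π).2 x
    exact congrFun (congrFun h j) i
  · obtain ⟨g, hg, _⟩ := Function.bijective_iff_has_inverse.1 (position_bijective π)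
    refine ⟨fun x => f (g x).1 (g x).2, ?_⟩
    funext j i
    simp only [hg (j, i)]

theorem regular_byBucket {α β : Type} [Fintype α] [Nonempty α] [Fintype β] [Nonempty β]
    {f : Fin ℓ → (Fin B → α) → β} (hf : ∀ j, Regular (f j)) :
    Regular fun (v : Fin (ℓ * B) → α) (j : Fin ℓ) => f j fun i => v (position π (j, i)) :=
  (regular_pi hf).comp (.of_bijective (bijective_byBucket π))

theorem bucketSum_eq (c : Fin (ℓ * B) → Bit) (j : Fin ℓ) :
    bucketSum π c j = ∑ i, c (position π (j, i)) := by
  rw [bucketSum, Finset.sum_range]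
  refine Finset.sum_congr rfl fun i _ => ?_
  rw [bucket, dif_pos i.2]
  rfl

/-- One unleaked choice bit in every bucket suffices. This is the only use of the absence of fully
leaked buckets. -/
theorem regular_bucketSum (l : Fin (ℓ * B) → Option Bit)
    (h : ∀ j, ∃ i : Fin B, l (position π (j, i)) = none) :
    Regular fun (c : Fin (ℓ * B) → Bit) => bucketSum π fun i => (l i).getD (c i) := by
  choose i₀ hi₀ using h
  have := regular_byBucket π (f := fun j u => ∑ i, (l (position π (j, i))).getD (u i))
    fun j => regular_sum _ (i₀ j) (hi₀ j)
  convert this using 2 with c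
  funext j
  exact bucketSum_eq π _ j

theorem regular_alice (hB : 1 ≤ B) : Regular fun v : Fin (ℓ * B) → SenderView κ =>
    (aliceResult π v, aliceReveals π v) := by
  obtain ⟨m, rfl⟩ : ∃ m, B = m + 1 := ⟨B - 1, by omega⟩
  have h1 := regular_byBucket π (f := fun _ => foldTuple (κ := κ) m) fun _ => regular_foldTuple m
  have h2 : Regular fun f : Fin ℓ → SenderView κ × (Fin m → Bit × Key κ) =>
      ((fun j => (f j).1), fun j => (f j).2) :=
    .of_bijective ⟨fun f g h => funext fun j => Prod.ext (congrFun (congrArg Prod.fst h) j)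
      (congrFun (congrArg Prod.snd h) j), fun p => ⟨fun j => (p.1 j, p.2 j), rfl⟩⟩
  exact h2.comp h1

/-- Corrupted Bob: the revealed bits and the unselected result bits are uniform. -/
theorem regular_other (hB : 1 ≤ B) (ΔA ΔB : Key κ) (b : Fin (ℓ * B) → ReceiverView κ)
    (F : Fin ℓ → (Fin (B - 1) → Bit) → Bit) :
    Regular fun y : Fin (ℓ * B) → Bit =>
      let v := fun i => senderOf ΔA ΔB (b i) (y i)
      ((fun j => F j (fun k => (aliceReveals π v j k).1) +
          ((aliceResult π v j).x₀ + (aliceResult π v j).x₁), fun j k => (aliceReveals π v j k).1) :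
        (Fin ℓ → Bit) × (Fin ℓ → Fin (B - 1) → Bit)) := by
  obtain ⟨m, rfl⟩ : ∃ m, B = m + 1 := ⟨B - 1, by omega⟩
  have h1 := regular_byBucket π (f := fun j => _) fun j =>
    Regular.of_bijective (bijective_revealed m (fun k => (bucket π b j k).z) (F j))
  have h2 : Regular fun f : Fin ℓ → (Fin m → Bit) × Bit =>
      ((fun j => (f j).2), fun j => (f j).1) :=
    .of_bijective ⟨fun f g h => funext fun j => Prod.ext (congrFun (congrArg Prod.snd h) j)
      (congrFun (congrArg Prod.fst h) j), fun p => ⟨fun j => (p.2 j, p.1 j), rfl⟩⟩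
  have h3 := h2.comp h1
  refine Eq.subst (motive := fun f => Regular f) (Eq.symm ?_) h3
  funext y
  have e : ∀ j k, k ≤ m → (bucket π (fun i => senderOf ΔA ΔB (b i) (y i)) j k).x₀ +
      (bucket π (fun i => senderOf ΔA ΔB (b i) (y i)) j k).x₁ =
      (bucket π b j k).z + extend (fun i => y (position π (j, i))) k := by
    intro j k hk
    simp only [bucket, extend]
    rw [dif_pos (by omega), dif_pos (by omega), dif_pos (by omega), senderOf_x_add]
    rfl
  have e1 : ∀ j (k : Fin m), (aliceReveals π (fun i => senderOf ΔA ΔB (b i) (y i)) j k).1 =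
      ((bucket π b j k).z + extend (fun i => y (position π (j, i))) k) +
      ((bucket π b j (k + 1)).z + extend (fun i => y (position π (j, i))) (k + 1)) := by
    intro j k
    rw [aliceReveals, revealed_foldA, revealed, ← e j k (by omega), ← e j (k + 1) (by omega)]
    simp only [add_assoc]
  have e2 : ∀ j, (aliceResult π (fun i => senderOf ΔA ΔB (b i) (y i)) j).x₀ +
      (aliceResult π (fun i => senderOf ΔA ΔB (b i) (y i)) j).x₁ =
      (bucket π b j m).z + extend (fun i => y (position π (j, i))) m := by
    intro j
    rw [aliceResult, foldA_x_add]
    exact e j m le_rfl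
  refine Prod.ext (funext fun j => ?_) (funext fun j => funext fun k => e1 j k)
  simp only [e2]
  congr 2
  funext k
  exact e1 j k

end Buckets

/-! ## Tools for simulation proofs -/

section Tools

variable {Q R : Type}

/-- Hidden data are split into a part `i`, which the reply discloses and which enters the new
knowledge, and a part `u`, which stays hidden. Given both, the step is deterministic. -/
theorem Reacts.of_bind {W : World Q R} {S U I : Type} {K : S → PMF W.State} {s : S} {x : Q}
    (ν : PMF I) (m : I → PMF U) (f : U → W.State) (g : I → U → W.State) (s' : I → S)
    (r : I → R) (hK : K s = ν.bind fun i => (m i).map f) (hK' : ∀ i, K (s' i) = (m i).map (g i))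
    (h : ∀ i, ∀ u ∈ (m i).support, W.step (f u) x = PMF.pure (g i u, r i)) :
    Reacts W K s x (ν.map fun i => (s' i, r i)) := by
  unfold Reacts
  rw [hK, PMF.bind_map, PMF.bind_bind]
  congr 1
  funext i
  simp only [Function.comp_apply]
  rw [hK', PMF.bind_map, PMF.map_comp]
  exact bind_congr_support _ fun u hu => h i u hu

theorem reacts_pure_iff {W : World Q R} {S : Type} {e : S → W.State} {s : S} {x : Q}
    {μ : PMF (S × R)} :
    Reacts W (fun s => PMF.pure (e s)) s x μ ↔ W.step (e s) x = μ.map fun p => (e p.1, p.2) := by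
  simp only [Reacts, PMF.pure_bind, PMF.pure_map]
  rfl

open Classical in
/-- Perfect simulation, with an invariant of the knowledge of the environment. -/
theorem acceptProb_eq_of_reacts_inv {S : Type} {W₁ W₂ : World Q R}
    {K₁ : S → PMF W₁.State} {K₂ : S → PMF W₂.State} {σ : PMF S} (Inv : S → Prop)
    (h₁ : W₁.init = σ.bind K₁) (h₂ : W₂.init = σ.bind K₂) (hσ : ∀ s ∈ σ.support, Inv s)
    (h : ∀ s x, Inv s → ∃ μ : PMF (S × R), (∀ p ∈ μ.support, Inv p.1) ∧
      Reacts W₁ K₁ s x μ ∧ Reacts W₂ K₂ s x μ) (Z : Env Q R) (q : ℕ) :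
    acceptProb Z W₁ q = acceptProb Z W₂ q := by
  have hzero : ∀ {A : Type} (μ : PMF A) (f : A → S), (∀ p ∈ μ.support, Inv (f p)) →
      ∑' p, μ p * (if Inv (f p) then 0 else 1 : ℝ≥0∞) = 0 := by
    intro A μ f hμ
    refine ENNReal.tsum_eq_zero.2 fun p => ?_
    by_cases hp : p ∈ μ.support
    · rw [if_pos (hμ p hp), mul_zero]
    · rw [(PMF.apply_eq_zero_iff _ _).2 hp, zero_mul]
  -- No secret is needed and no states are ever matched; the potential is the indicator of a
  -- violated invariant, so it vanishes along every run.
  have hK : Coupling (Θ := Unit) (fun _ => K₁) (fun _ => K₂) (fun _ _ => False)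
      (fun s => if Inv s then 0 else 1) 0 :=
    ⟨fun _ _ _ => False.elim, fun s x => by
      by_cases hs : Inv s
      · obtain ⟨μ, h0, h1, h2⟩ := h s x hs
        exact Or.inr (Or.inl ⟨∅, μ, by simp, by rw [hzero μ Prod.fst h0]; exact zero_le,
          fun _ _ => ⟨h1, h2⟩⟩)
      · exact Or.inl (by simp [hs])⟩
  have := abs_acceptProb_sub_le (σ := σ) (by rw [PMF.bind_const, h₁]) (by rw [PMF.bind_const, h₂])
    hK (ε := 0) (hzero σ (fun s => s) hσ).le (by simp) Z q
  simpa [sub_eq_zero] using this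

/-- `W₁`, with hidden part `m s` of its state, and `W₂` react to `x` in the same way when the
environment knows `s`. -/
def Simulated {S U : Type} (W₁ W₂ : World Q R) (m : S → PMF U) (f : S → U → W₁.State)
    (e : S → W₂.State) (Inv : S → Prop) (s : S) (x : Q) : Prop :=
  ∃ μ : PMF (S × R), (∀ p ∈ μ.support, Inv p.1) ∧
    Reacts W₁ (fun s => (m s).map (f s)) s x μ ∧ Reacts W₂ (fun s => PMF.pure (e s)) s x μ

section Simulated

variable {S U I : Type} {W₁ W₂ : World Q R} {m : S → PMF U} {f : S → U → W₁.State}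
  {e : S → W₂.State} {Inv : S → Prop} {s : S} {x : Q}

theorem Simulated.of_bind (ν : PMF I) (s' : I → S) (r : I → R) (hs' : ∀ i, Inv (s' i))
    (hm : m s = ν.bind fun i => m (s' i))
    (h₁ : ∀ i, ∀ u ∈ (m (s' i)).support, W₁.step (f s u) x = PMF.pure (f (s' i) u, r i))
    (h₂ : W₂.step (e s) x = ν.map fun i => (e (s' i), r i)) :
    Simulated W₁ W₂ m f e Inv s x := by
  refine ⟨ν.map fun i => (s' i, r i), ?_, ?_, ?_⟩
  · intro p hp
    rw [PMF.support_map] at hp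
    obtain ⟨i, -, rfl⟩ := hp
    exact hs' i
  · refine Reacts.of_bind ν (fun i => m (s' i)) (f s) (fun i => f (s' i)) _ _ ?_ (fun _ => rfl) h₁
    rw [hm, PMF.map_bind]
  · refine reacts_pure_iff.2 ?_
    rw [h₂, PMF.map_comp]
    rfl

theorem Simulated.of_pure (s' : S) (r : R) (hs' : Inv s') (hm : m s' = m s)
    (h₁ : ∀ u ∈ (m s).support, W₁.step (f s u) x = PMF.pure (f s' u, r))
    (h₂ : W₂.step (e s) x = PMF.pure (e s', r)) : Simulated W₁ W₂ m f e Inv s x :=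
  .of_bind (PMF.pure ()) (fun _ => s') (fun _ => r) (fun _ => hs')
    (by rw [PMF.pure_bind, hm]) (fun _ => by rwa [hm]) (by rw [h₂, PMF.pure_map])

theorem acceptProb_eq_of_simulated {σ : PMF S} (h₁ : W₁.init = σ.bind fun s => (m s).map (f s))
    (h₂ : W₂.init = σ.map e) (hσ : ∀ s ∈ σ.support, Inv s)
    (h : ∀ s x, Inv s → Simulated W₁ W₂ m f e Inv s x) (Z : Env Q R) (q : ℕ) :
    acceptProb Z W₁ q = acceptProb Z W₂ q :=
  acceptProb_eq_of_reacts_inv Inv h₁ h₂ hσ h Z q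

end Simulated

end Tools

/-! ### Flags indexed by parties, and circuits for simulator actions. -/

instance : Fintype Party := ⟨{.alice, .bob}, by rintro ⟨⟩ <;> simp⟩

/-- A form of updating by `true` that is visibly a small circuit even when the party is itself an
input. -/
def setFlag (f : Party → Bool) (P : Party) (Q : Party) : Bool := f Q || decide (P = Q)

theorem setFlag_eq_update (f : Party → Bool) (P : Party) :
    setFlag f P = Function.update f P true := by
  funext Q
  by_cases h : Q = P
  · subst h; simp [setFlag]
  · simp [setFlag, Function.update_of_ne h, Ne.symm h]

theorem Cx.setFlag {s k k' : ℕ} {A : Type} [Wired A] {f : A → Party → Bool} {P : A → Party}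
    (hf : Cx s k f) (hP : Cx s k' P) : Cx s (max k (k' + 9) + 4) fun a => setFlag (f a) (P a) := by
  refine pi fun Q => ?_
  have h1 := hf.apply Q
  have h2 : Cx s (k' + 9) fun a => decide (P a = Q) :=
    (Cx.eq (j := 0) FewWires.party hP (Cx.const (s := s) Q)).mono (by omega)
  have h3 := ((h1.not.and h2.not).not).mono (k' := max k (k' + 9) + 4) (by omega)
  convert h3 using 2 with a
  simp [AOT.setFlag]

theorem FewWires.flags (s : ℕ) : FewWires s 1 (Party → Bool) := by
  have h : Fintype.card Party ≤ (s + 2) ^ 1 := by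
    rw [pow_one]
    exact (show Fintype.card Party = 2 from rfl).le.trans (by omega)
  exact FewWires.pi h FewWires.bool

section React

variable {s k k' κ ℓ B : ℕ} {A T : Type} [Wired A] [Wired T]

theorem Cx.react {t : A → T} {x : A → SimAction κ ℓ B} (ht : Cx s k t) (hx : Cx s k x)
    (a b : Bool) : Cx s k fun p => ((t p, a, b), x p) :=
  ((ht.prodMk ((Cx.const a).prodMk (Cx.const b))).prodMk hx).mono (by simp)

theorem Cx.silent {t : A → T} (ht : Cx s k t) :
    Cx s k fun p => ((t p, false, false), (SimAction.reply .silent : SimAction κ ℓ B)) :=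
  ht.react ((Cx.const _).mono (Nat.zero_le k)) _ _

end React

/-! ## Nobody is corrupted -/

namespace Honest

variable {κ ℓ B : ℕ}

/-- Which parties have started, which got their `LaOT` outputs, whether Alice is done and whether
Bob is done. -/
abbrev Memory := (Party → Bool) × (Party → Bool) × Bool × Bool

/-- Neither the permutation nor the revealed pairs need to be remembered: each is drawn when it is
sent, and no later reply depends on it. -/
def strategy (κ ℓ B : ℕ) : Strategy κ ℓ B Memory (Reveals κ ℓ B) where
  init := (fun _ => false, fun _ => false, false, false)
  start t P := (setFlag t.1 P, t.2)
  react t x _ π := match x with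
    | .keyQuery P Δ => ((t, false, true), .call (.keyQuery P Δ))
    | .deliverBox P =>
      if t.1 .alice && t.1 .bob && !t.2.1 P then
        (((t.1, setFlag t.2.1 P, t.2.2), false, false),
          .reply (if decide (P = .bob) then .perm π else .silent))
      else ((t, false, false), .reply .silent)
    | .deliverPerm =>
      if t.2.1 .alice && t.2.1 .bob && !t.2.2.1 then
        (((t.1, t.2.1, true, t.2.2.2), true, true), .call (.deliver .alice))
      else ((t, false, false), .reply .silent)
    | .deliverReveals =>
      if t.2.2.1 && t.2.1 .bob && !t.2.2.2 then
        (((t.1, t.2.1, t.2.2.1, true), true, true), .call (.deliver .bob))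
      else ((t, false, false), .reply .silent)
    | _ => ((t, false, false), .reply .silent)
  -- Bob cannot be done before Alice, so his flag tells which of the two deliveries is being
  -- finished.
  finish t r := if t.2.2.2 then .silent else .reveals r
  -- Arbitrary, since every delivery is commanded directly here.
  honest := .alice

/-- What the environment knows: the memory of the simulator, the tape of `aOT`, and the
permutation and the revealed bits once they are sent. -/
structure Knowledge (κ ℓ B : ℕ) where
  tape : Tape κ ℓ
  started : Party → Bool
  gotA : Bool
  perm : Option (Equiv.Perm (Fin (ℓ * B)))
  reveals : Option (Reveals κ ℓ B)
  doneB : Bool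

namespace Knowledge

variable (s : Knowledge κ ℓ B)

def got : Party → Bool
  | .alice => s.gotA
  | .bob => s.perm.isSome

def done : Party → Bool
  | .alice => s.reveals.isSome
  | .bob => s.doneB

def memory : Memory := (s.started, s.got, s.reveals.isSome, s.doneB)

def Inv : Prop :=
  (s.gotA = true ∨ s.perm.isSome = true → s.started .alice = true ∧ s.started .bob = true) ∧
  (s.reveals.isSome = true → s.gotA = true ∧ s.perm.isSome = true) ∧
  (s.doneB = true → s.reveals.isSome = true)

end Knowledge

/-- The part of a tape of `LaOT` that matters, given the permutation. -/
def combineTape (π : Equiv.Perm (Fin (ℓ * B))) (a : Tape κ (ℓ * B)) :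
    Tape κ ℓ × Reveals κ ℓ B :=
  (⟨a.ΔA, a.ΔB, aliceResult π a.sender, bucketSum π a.choice, bucketSum π a.other⟩,
    aliceReveals π a.sender)

/-- Alice's parts are covered by `regular_alice` and the choice bits by `regular_bucketSum` with
nothing leaked. The field `other` is summed in the same way only to obtain a complete tape. -/
theorem regular_combineTape (hB : 1 ≤ B) (π : Equiv.Perm (Fin (ℓ * B))) :
    Regular (combineTape (κ := κ) π) := by
  have hs : Regular (bucketSum π) := by
    simpa using regular_bucketSum π (fun _ => none) fun _ => ⟨⟨0, hB⟩, rfl⟩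
  have h1 : Regular fun a : Tape κ (ℓ * B) => ((a.ΔA, a.ΔB), a.sender, a.choice, a.other) :=
    .of_bijective ⟨by
      rintro ⟨⟩ ⟨⟩ h
      simp_all, fun p => ⟨⟨p.1.1, p.1.2, p.2.1, p.2.2.1, p.2.2.2⟩, rfl⟩⟩
  have h2 := (regular_prodMap (Regular.of_bijective (Function.bijective_id :
    Function.Bijective (id : Key κ × Key κ → Key κ × Key κ)))
    (regular_prodMap (regular_alice (κ := κ) π hB) (regular_prodMap hs hs))).comp h1
  have h3 : Regular fun p : (Key κ × Key κ) × ((Fin ℓ → SenderView κ) × Reveals κ ℓ B) ×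
      (Fin ℓ → Bit) × (Fin ℓ → Bit) =>
      ((⟨p.1.1, p.1.2, p.2.1.1, p.2.2.1, p.2.2.2⟩, p.2.1.2) : Tape κ ℓ × Reveals κ ℓ B) :=
    .of_bijective ⟨by
      rintro ⟨⟨_, _⟩, ⟨_, _⟩, _, _⟩ ⟨⟨_, _⟩, ⟨_, _⟩, _, _⟩ h
      simp_all, by
      rintro ⟨⟨a, b, c, d, e⟩, r⟩
      exact ⟨((a, b), (c, r), d, e), rfl⟩⟩
  exact h3.comp h2

/-- The state of the real world, given the permutation and the tape of `LaOT`. -/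
def realState (s : Knowledge κ ℓ B) (p : Equiv.Perm (Fin (ℓ * B)) × Tape κ (ℓ * B)) :
    RealState κ ℓ B where
  box := ⟨p.2, s.started, none, none, s.got, false⟩
  perm := p.1
  gotA := if s.gotA then some (p.2.ΔB, p.2.sender) else none
  gotB := if s.perm.isSome then some (p.2.ΔA, fun i =>
    receiverOf p.2.ΔA p.2.ΔB (p.2.sender i) (p.2.choice i)) else none
  sent := s.reveals
  doneA := s.reveals.isSome
  doneB := s.doneB

def idealBox (s : Knowledge κ ℓ B) : Box κ ℓ := ⟨s.tape, s.started, none, none, s.done, false⟩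

end Honest

/-! ### Perfect simulation when nobody is corrupted. -/

namespace Honest

variable {κ ℓ B : ℕ}

section Simulation

variable (D : PMF (Equiv.Perm (Fin (ℓ * B))))
  (kern : Equiv.Perm (Fin (ℓ * B)) → Tape κ ℓ × Reveals κ ℓ B → PMF (Tape κ (ℓ * B)))

/-- The permutation and the tape of `LaOT`, given what the environment knows. -/
noncomputable def sample (s : Knowledge κ ℓ B) :
    PMF (Equiv.Perm (Fin (ℓ * B)) × Tape κ (ℓ * B)) :=
  (s.perm.elim D PMF.pure).bind fun π =>
    (s.reveals.elim (PMF.uniformOfFintype (Reveals κ ℓ B)) PMF.pure).bind fun r =>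
      (kern π (s.tape, r)).map fun a => (π, a)

variable {kern} (hkern : ∀ π b, ∀ a ∈ (kern π b).support, combineTape π a = b)

include hkern in
theorem sample_support {s : Knowledge κ ℓ B} {u : Equiv.Perm (Fin (ℓ * B)) × Tape κ (ℓ * B)}
    (hu : u ∈ (sample D kern s).support) :
    (combineTape u.1 u.2).1 = s.tape ∧ (∀ π, s.perm = some π → u.1 = π) ∧
      ∀ r, s.reveals = some r → aliceReveals u.1 u.2.sender = r := by
  simp only [sample, PMF.mem_support_bind_iff, PMF.support_map, Set.mem_image] at hu
  obtain ⟨π, h1, r, h2, a, h3, rfl⟩ := hu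
  have h := hkern π _ a h3
  refine ⟨by rw [h], fun π' hπ => ?_, fun r' hr => ?_⟩
  · simpa [hπ] using h1
  · rw [hr] at h2
    have h2 : r = r' := by simpa using h2
    rw [← h2]
    exact congrArg Prod.snd h

noncomputable def idealState (s : Knowledge κ ℓ B) :
    (Wired.Wire (Memory × Bool × Bool) → Bool) × Box κ ℓ :=
  (Wired.enc (s.memory, false, false), idealBox s)

/-- Both worlds react to `x` in the same way when the environment knows `s`. -/
abbrev Good (D : PMF (Equiv.Perm (Fin (ℓ * B))))
    (kern : Equiv.Perm (Fin (ℓ * B)) → Tape κ ℓ × Reveals κ ℓ B → PMF (Tape κ (ℓ * B)))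
    (s : Knowledge κ ℓ B) (x : EnvQuery κ ℓ B) : Prop :=
  Simulated (realWorld κ ℓ B D none) (idealWorld (strategy κ ℓ B).toSimulator D none)
    (sample D kern) realState idealState Knowledge.Inv s x

theorem Good.of_silent {s : Knowledge κ ℓ B} {x : AdvCmd κ ℓ B} (hs : s.Inv)
    (h₁ : ∀ u ∈ (sample D kern s).support,
      (realState s u).attack none x = (realState s u, ⟨.silent, []⟩))
    (h₂ : ∀ c π, (strategy κ ℓ B).react s.memory x c π =
      ((s.memory, false, false), .reply .silent)) :
    Good D kern s (.attack x) :=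
  .of_pure s ⟨.silent, []⟩ hs rfl (fun u hu => congrArg PMF.pure (h₁ u hu))
    (Strategy.step_attack_of_react _ h₂)

theorem simulated_start (s : Knowledge κ ℓ B) (P : Party) (hs : s.Inv) :
    Good D kern s (.start P) := by
  refine .of_pure { s with started := setFlag s.started P } ⟨.silent, []⟩
    ⟨fun h => ?_, hs.2.1, hs.2.2⟩ rfl (fun u _ => congrArg PMF.pure ?_) ?_
  · have := hs.1 h
    simp [setFlag, this]
  · simp [RealState.step, Box.start, realState, setFlag_eq_update]
    rfl
  · refine (Strategy.step_start _ _ _ _ _ _).trans ?_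
    simp [idealState, idealBox, Knowledge.memory, setFlag_eq_update, strategy, Box.start]
    rfl

include hkern in
theorem simulated_keyQuery (s : Knowledge κ ℓ B) (P : Party) (Δ : Key κ) (hs : s.Inv) :
    Good D kern s (.attack (.keyQuery P Δ)) := by
  refine .of_pure s ⟨.answer ((idealBox s).keyQuery none P Δ), []⟩ hs rfl (fun u hu => congrArg PMF.pure ?_) ?_
  · have h := (sample_support D hkern hu).1
    have hA : u.2.ΔA = s.tape.ΔA := congrArg Tape.ΔA h
    have hB : u.2.ΔB = s.tape.ΔB := congrArg Tape.ΔB h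
    cases P <;> simp [RealState.step, RealState.attack, Box.keyQuery, Box.globalKey, realState,
      idealBox, hA, hB] <;> rfl
  · exact Strategy.step_attack_of_react _ (o := ((s.memory, false, true), .call (.keyQuery P Δ)))
      fun c π => rfl

include hkern in
theorem simulated_deliverBox (s : Knowledge κ ℓ B) (P : Party) (hs : s.Inv) :
    Good D kern s (.attack (.deliverBox P)) := by
  by_cases h : s.started .alice = true ∧ s.started .bob = true ∧ s.got P = false
  · obtain ⟨ha, hb, hg⟩ := h
    cases P with
    | alice =>
      refine .of_pure { s with gotA := true } ⟨.silent, []⟩ ⟨fun _ => ⟨ha, hb⟩, fun h =>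
        ⟨rfl, (hs.2.1 h).2⟩, hs.2.2⟩ rfl (fun u _ => congrArg PMF.pure ?_) ?_
      · have hu : Function.update s.got .alice true =
            Knowledge.got { s with gotA := true } := by
          funext P
          cases P <;> rfl
        simp [RealState.step, RealState.attack, Box.deliver, Box.values, realState, ha, hb, hg,
          ← hu]
        rfl
      · refine (Strategy.step_attack_of_react _ (o := ((_, false, false), .reply .silent))
          fun c π => ?_).trans rfl
        simp [strategy, Knowledge.memory, ha, hb, hg, setFlag_eq_update]
        funext P
        cases P <;> rfl
    | bob =>
      have hn : s.perm = none := by simpa [Knowledge.got] using hg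
      have hr : s.reveals = none := by
        by_contra h
        have := (hs.2.1 (Option.isSome_iff_ne_none.2 h)).2
        simp [hn] at this
      have hu : ∀ π, Function.update s.got .bob true =
          Knowledge.got { s with perm := some π } := fun π => by
        funext P
        cases P <;> rfl
      -- The real permutation exists from the beginning but is hidden until now, so disclosing it
      -- has the same effect as the simulator's fresh sample.
      refine .of_bind D (fun π => { s with perm := some π }) (fun π => ⟨.perm π, []⟩)
        (fun π => ⟨fun _ => ⟨ha, hb⟩, fun h => ⟨(hs.2.1 h).1, rfl⟩, hs.2.2⟩)
        (by simp [sample, hn, PMF.pure_bind]) (fun π u hu' => ?_) ?_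
      · have hπ := (sample_support D hkern hu').2.1 π rfl
        refine congrArg PMF.pure ?_
        simp [RealState.step, RealState.attack, Box.deliver, Box.values, realState, ha, hb, hg,
          ← hu π, hπ]
        rfl
      · refine (Strategy.step_attack_of_perm _
          (o := fun π => ((Knowledge.memory { s with perm := some π }, false, false),
            .reply (.perm π))) fun c π => ?_).trans rfl
        simp [strategy, Knowledge.memory, ha, hb, hg, setFlag_eq_update, hu π]
  · refine .of_silent D hs (fun u hu => ?_) fun c π => ?_
    · have : ¬(s.started P = true ∧ s.started .alice = true ∧ s.started .bob = true ∧
          s.got P = false) := fun h' => h h'.2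
      by_cases h1 : s.started P = true ∧ s.got P = false
      · have h2 : (s.started .alice && s.started .bob) = false := by
          rw [Bool.eq_false_iff]
          intro h3
          rw [Bool.and_eq_true] at h3
          exact h ⟨h3.1, h3.2, h1.2⟩
        simp [RealState.attack, Box.deliver, Box.values, realState, h1, h2]
      · have : ¬(s.started P = true ∧ s.got P = false) := h1
        simp [RealState.attack, Box.deliver, realState, this]
    · have : (s.started .alice && s.started .bob && !s.got P) = false := by
        rw [Bool.eq_false_iff]
        intro h3
        simp only [Bool.and_eq_true, Bool.not_eq_true'] at h3
        exact h ⟨h3.1.1, h3.1.2, h3.2⟩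
      simp only [strategy, Knowledge.memory, this]
      rfl

include hkern in
theorem simulated_deliverPerm (s : Knowledge κ ℓ B) (hs : s.Inv) :
    Good D kern s (.attack .deliverPerm) := by
  by_cases h : s.gotA = true ∧ s.perm.isSome = true ∧ s.reveals = none
  · obtain ⟨hA, hp, hr⟩ := h
    obtain ⟨π, hπ⟩ := Option.isSome_iff_exists.1 hp
    have hd : s.doneB = false := by
      by_contra h
      have := hs.2.2 (by simpa using h)
      simp [hr] at this
    have hst := hs.1 (Or.inr hp)
    -- Given the permutation and the outputs, the revealed pairs are still uniform, exactly like the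
    -- simulator's coins.
    refine .of_bind (PMF.uniformOfFintype (Reveals κ ℓ B))
      (fun r => { s with reveals := some r })
      (fun r => ⟨.reveals r, [.sender (s.tape.ΔB, s.tape.sender)]⟩)
      (fun r => ⟨hs.1, fun _ => ⟨hA, hp⟩, fun _ => rfl⟩)
      (by simp [sample, hπ, hr, PMF.pure_bind]) (fun r u hu => ?_) ?_
    · obtain ⟨h1, h2, h3⟩ := sample_support D hkern hu
      have h3 := h3 r rfl
      have hT : ∀ f : Tape κ ℓ → Key κ × (Fin ℓ → SenderView κ),
        f (combineTape u.1 u.2).1 = f s.tape := fun f => congrArg f h1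
      have hT := hT fun t => (t.ΔB, t.sender)
      simp only [combineTape, Prod.mk.injEq] at hT
      refine congrArg PMF.pure ?_
      have hg : Knowledge.got { s with gotA := true, reveals := some r } = s.got := by
        rw [← hA]
        rfl
      simp [RealState.step, RealState.attack, RealState.receivePerm, realState, hg, hA, hr, hp, h3,
        hT.1, hT.2]
      rfl
    · refine (Strategy.step_attack_of_react _ (o := (((s.started, s.got, true, s.doneB), true, true),
        .call (.deliver .alice))) fun c π => ?_).trans ?_
      · simp [strategy, Knowledge.memory, hA, hp, hr, Knowledge.got]
      · have hu : ∀ r, Knowledge.done { s with reveals := some r, doneB := false } =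
            Function.update s.done .alice true := by
          intro r
          funext P
          cases P
          · rfl
          · exact hd.symm
        simp only [Strategy.resolve, strategy, Box.command, Box.deliver,
          Box.values, idealBox, hst, Knowledge.done, hd, hr]
        simp only [PMF.map, idealState, idealBox, Knowledge.memory, hu]
        rfl
  · refine .of_silent D hs (fun u hu => ?_) fun c π => ?_
    · by_cases hA : s.gotA = true
      · by_cases hp : s.perm.isSome = true
        · obtain ⟨r, hr⟩ := Option.ne_none_iff_exists'.1 fun hr => h ⟨hA, hp, hr⟩
          simp [RealState.attack, realState, hr, hp, hA, RealState.receivePerm]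
        · simp [RealState.attack, realState, hp]
      · simp [RealState.attack, realState, RealState.receivePerm, hA]
    · have : (s.gotA && s.perm.isSome && !s.reveals.isSome) = false := by
        rw [Bool.eq_false_iff]
        intro h3
        simp only [Bool.and_eq_true, Bool.not_eq_true', Option.isSome_eq_false_iff,
          Option.isNone_iff_eq_none] at h3
        exact h ⟨h3.1.1, h3.1.2, h3.2⟩
      simp only [strategy, Knowledge.memory, Knowledge.got, this]
      rfl

include hkern in
theorem simulated_deliverReveals (hB : 1 ≤ B) (s : Knowledge κ ℓ B) (hs : s.Inv) :
    Good D kern s (.attack .deliverReveals) := by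
  by_cases h : s.reveals.isSome = true ∧ s.doneB = false
  · obtain ⟨hr, hd⟩ := h
    obtain ⟨r, hr'⟩ := Option.isSome_iff_exists.1 hr
    have hp := (hs.2.1 hr).2
    refine .of_pure { s with doneB := true } ⟨.silent, [.receiver (s.tape.ΔA, fun j =>
      receiverOf s.tape.ΔA s.tape.ΔB (s.tape.sender j) (s.tape.choice j))]⟩
      ⟨hs.1, hs.2.1, fun _ => hr⟩ rfl (fun u hu => congrArg PMF.pure ?_) ?_
    · obtain ⟨h1, -, h3⟩ := sample_support D hkern hu
      have h3 := h3 r hr'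
      have hT : ∀ f : Tape κ ℓ → (Key κ × Key κ) × (Fin ℓ → SenderView κ) × (Fin ℓ → Bit),
        f (combineTape u.1 u.2).1 = f s.tape := fun f => congrArg f h1
      have hT := hT fun t => ((t.ΔA, t.ΔB), t.sender, t.choice)
      simp only [combineTape, Prod.mk.injEq] at hT
      simp only [RealState.step, RealState.attack, realState, hr', hp, RealState.receiveReveals,
        hd, if_true]
      rw [← h3, if_pos (bobAccepts_aliceReveals _ u.2.ΔA u.2.ΔB u.2.sender u.2.choice), bobResult_receiverOf _ hB _ _ _ _ _
        fun _ _ => rfl, hT.1.1, hT.1.2, hT.2.1, hT.2.2]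
      rfl
    · refine (Strategy.step_attack_of_react _ (o := ((Knowledge.memory { s with doneB := true },
        true, true), .call (.deliver .bob))) fun c π => ?_).trans ?_
      · simp [strategy, Knowledge.memory, hr, hp, hd, Knowledge.got]
        rfl
      · have hst := hs.1 (Or.inr hp)
        simp only [Strategy.resolve, strategy, Knowledge.memory, if_true, Box.command, Box.deliver,
          Box.values, idealBox, hst, Knowledge.done, hd]
        have hu : Function.update s.done .bob true =
            Knowledge.done { s with doneB := true } := by
          funext P
          cases P <;> rfl
        simp [PMF.bind_const, idealState, idealBox, Knowledge.memory, ← hu]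
        rfl
  · refine .of_silent D hs (fun u hu => ?_) fun c π => ?_
    · rcases hr : s.reveals with _ | r
      · simp [RealState.attack, realState, hr]
      · have hp := (hs.2.1 (by simp [hr])).2
        have hd : s.doneB = true := by simpa [hr] using h
        simp [RealState.attack, realState, hr, hp, RealState.receiveReveals, hd]
    · have : (s.reveals.isSome && s.perm.isSome && !s.doneB) = false := by
        rw [not_and] at h
        rcases hr : s.reveals.isSome <;> simp [hr] at h ⊢
        simp [h]
      simp only [strategy, Knowledge.memory, Knowledge.got, this]
      rfl

include hkern in
theorem simulated (hB : 1 ≤ B) (s : Knowledge κ ℓ B) (x : EnvQuery κ ℓ B) (hs : s.Inv) :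
    Good D kern s x := by
  rcases x with P | x
  · exact simulated_start D s P hs
  · cases x with
    | keyQuery P Δ => exact simulated_keyQuery D hkern s P Δ hs
    | deliverBox P => exact simulated_deliverBox D hkern s P hs
    | deliverPerm => exact simulated_deliverPerm D hkern s hs
    | deliverReveals => exact simulated_deliverReveals D hkern hB s hs
    | _ => exact .of_silent D hs (fun _ _ => rfl) fun _ _ => rfl

end Simulation

theorem acceptProb_eq (hB : 1 ≤ B) (D : PMF (Equiv.Perm (Fin (ℓ * B))))
    (Z : Env (EnvQuery κ ℓ B) (Response κ ℓ B)) (q : ℕ) :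
    acceptProb Z (realWorld κ ℓ B D none) q =
      acceptProb Z (idealWorld (strategy κ ℓ B).toSimulator D none) q := by
  choose kern h1 h2 using fun π => (regular_combineTape (κ := κ) hB π).exists_kernel
  let s₀ : Tape κ ℓ → Knowledge κ ℓ B := fun t => ⟨t, fun _ => false, false, none, none, false⟩
  have hf : ∀ t, (s₀ t).got = fun _ => false := fun t => by
    funext P
    cases P <;> rfl
  have hd : ∀ t, (s₀ t).done = fun _ => false := fun t => by
    funext P
    cases P <;> rfl
  refine acceptProb_eq_of_simulated (σ := (PMF.uniformOfFintype (Tape κ ℓ)).map s₀)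
    (m := sample D kern) (f := realState) (e := idealState) (Inv := Knowledge.Inv) ?_ ?_ ?_
    (simulated D h2 hB) Z q
  · simp only [realWorld, PMF.bind_map, Function.comp_def, sample, s₀, Option.elim,
      PMF.map_bind, PMF.map_comp]
    -- For a fixed permutation, drawing the tape of `aOT` and the revealed pairs first and then the
    -- tape of `LaOT` from the kernel over them gives a uniform tape of `LaOT`.
    have e1 : ∀ π, ((PMF.uniformOfFintype (Tape κ ℓ)).bind fun t =>
        (PMF.uniformOfFintype (Reveals κ ℓ B)).bind fun r => (kern π (t, r)).map fun a =>
          realState (s₀ t) (π, a)) = (PMF.uniformOfFintype (Tape κ (ℓ * B))).map fun t =>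
            (⟨Box.create t, π, none, none, none, false, false⟩ : RealState κ ℓ B) := by
      intro π
      rw [h1 π, uniform_prod]
      simp only [PMF.map_bind, PMF.bind_bind, PMF.bind_map, Function.comp_def, realState, hf]
      rfl
    exact (PMF.bind_comm _ D _).trans ((congrArg (PMF.bind D) (funext fun π => (e1 π).symm)).trans
      (PMF.bind_comm D _ _))
  · refine Eq.trans ?_ (PMF.map_comp _ _ _).symm
    refine congrArg (fun f => PMF.map f _) (funext fun t => ?_)
    change _ = (Wired.enc ((_, (s₀ t).got, _, _), _, _), (⟨_, _, _, _, (s₀ t).done, _⟩ : Box κ ℓ))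
    rw [hf, hd]
    rfl
  · intro s hs
    rw [PMF.support_map] at hs
    obtain ⟨t, -, rfl⟩ := hs
    simp [Knowledge.Inv, s₀]

end Honest

/-! ### Cost of the simulator when nobody is corrupted. -/

namespace Honest

variable {s κ ℓ B : ℕ}

section

variable {A : Type} [Wired A]

theorem cx_deliverBox {t : A → Memory} {P : A → Party} {π : A → Equiv.Perm (Fin (ℓ * B))}
    (ht : Cx s 0 t) (hP : Cx s 0 P) (hπ : Cx s 0 π) :
    Cx s 40 fun a => if (t a).1 .alice && (t a).1 .bob && !(t a).2.1 (P a) then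
        ((((t a).1, setFlag (t a).2.1 (P a), (t a).2.2), false, false),
          (SimAction.reply (if decide (P a = .bob) then .perm (π a) else .silent) :
            SimAction κ ℓ B))
      else ((t a, false, false), .reply .silent) := by
  have hb : Cx s 9 fun a => decide (P a = .bob) :=
    (Cx.eq (j := 0) FewWires.party hP (Cx.const (s := s) Party.bob)).mono (by omega)
  have hg : Cx s 13 fun a => (t a).2.1 (P a) := by
    have e : (fun a => (t a).2.1 (P a)) =
        fun a => if decide (P a = .bob) = true then (t a).2.1 .bob else (t a).2.1 .alice := by
      funext a
      cases P a <;> rfl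
    rw [e]
    exact (hb.ite (ht.snd.fst.apply .bob) (ht.snd.fst.apply .alice)).mono (by omega)
  have hc := ((ht.fst.apply .alice).and (ht.fst.apply .bob)).and hg.not
  have hr : Cx s 13 fun a => (SimAction.reply (if decide (P a = .bob) then .perm (π a)
      else .silent) : SimAction κ ℓ B) :=
    ((hb.ite (Cx.replyPerm hπ) (Cx.const (s := s) Reply.silent)).mono (by omega)).reply
  have hT : Cx s 13 fun a => ((t a).1, setFlag (t a).2.1 (P a), (t a).2.2) :=
    (ht.fst.prodMk ((Cx.setFlag ht.snd.fst hP).prodMk ht.snd.snd)).mono (by omega)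
  exact (hc.ite (hT.react hr false false) ht.silent).mono (by omega)

theorem cx_deliverPerm {t : A → Memory} (ht : Cx s 0 t) :
    Cx s 40 fun a => if (t a).2.1 .alice && (t a).2.1 .bob && !(t a).2.2.1 then
        ((((t a).1, (t a).2.1, true, (t a).2.2.2), true, true),
          (SimAction.call (.deliver .alice) : SimAction κ ℓ B))
      else ((t a, false, false), .reply .silent) := by
  have hc := ((ht.snd.fst.apply .alice).and (ht.snd.fst.apply .bob)).and ht.snd.snd.fst.not
  have hT : Cx s 0 fun a => ((t a).1, (t a).2.1, true, (t a).2.2.2) :=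
    ht.fst.prodMk (ht.snd.fst.prodMk ((Cx.const true).prodMk ht.snd.snd.snd))
  exact (hc.ite (hT.react (Cx.const _) true true) ht.silent).mono (by omega)

theorem cx_deliverReveals {t : A → Memory} (ht : Cx s 0 t) :
    Cx s 40 fun a => if (t a).2.2.1 && (t a).2.1 .bob && !(t a).2.2.2 then
        ((((t a).1, (t a).2.1, (t a).2.2.1, true), true, true),
          (SimAction.call (.deliver .bob) : SimAction κ ℓ B))
      else ((t a, false, false), .reply .silent) := by
  have hc := ((ht.snd.snd.fst).and (ht.snd.fst.apply .bob)).and ht.snd.snd.snd.not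
  have hT : Cx s 0 fun a => ((t a).1, (t a).2.1, (t a).2.2.1, true) :=
    ht.fst.prodMk (ht.snd.fst.prodMk (ht.snd.snd.fst.prodMk (Cx.const true)))
  exact (hc.ite (hT.react (Cx.const _) true true) ht.silent).mono (by omega)

end

theorem costAtMost (h : Params s κ ℓ B) {N : ℕ} (hN : (s + 2) ^ 150 ≤ N) :
    (strategy κ ℓ B).toSimulator.CostAtMost N := by
  have hT : FewWires s 10 (Memory × Bool × Bool) :=
    ((((FewWires.flags s).prod ((FewWires.flags s).prod (FewWires.bool.prod FewWires.bool))).prod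
      (FewWires.bool.prod FewWires.bool))).mono (by omega)
  have ht : ∀ {X : Type} [Wired X], Cx s 0 fun p : (Memory × Reveals κ ℓ B ×
      Equiv.Perm (Fin (ℓ * B))) × X => p.1.1 := fun {X} _ => .of_isWiring isWiring_fst.fst
  have hx : ∀ {X : Type} [Wired X], Cx s 0 fun p : (Memory × Reveals κ ℓ B ×
      Equiv.Perm (Fin (ℓ * B))) × X => p.2 := fun {X} _ => .of_isWiring isWiring_snd
  have triv : ∀ {X : Type} [Wired X], Cx s 40 fun p : (Memory × Reveals κ ℓ B ×
      Equiv.Perm (Fin (ℓ * B))) × X => ((p.1.1, false, false), (SimAction.reply .silent :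
        SimAction κ ℓ B)) := fun {X} _ => ht.silent.mono (by omega)
  refine (strategy κ ℓ B).costAtMost (j := 10) (c := 4) (k := 80) h hT (FewWires.reveals h)
    ?_ ?_ ?_ ((base_pow_mono s (by omega)).trans hN)
  · have hm : Cx s 0 fun p : Memory × Party => p.1 := .of_isWiring isWiring_fst
    have hP : Cx s 0 fun p : Memory × Party => p.2 := .of_isWiring isWiring_snd
    exact ((Cx.setFlag hm.fst hP).prodMk hm.snd).mono (k' := 80) (by omega)
  · refine Cx.mono (k := 40 + 32) (Cx.advCmd triv triv triv ?_ ?_ ?_ ?_ triv triv) (by omega)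
    · exact (ht.react (Cx.boxKeyQuery hx.fst hx.snd).call false true).mono (by omega)
    · exact cx_deliverBox ht hx (.of_isWiring isWiring_fst.snd.snd)
    · exact cx_deliverPerm ht
    · exact cx_deliverReveals ht
  · have hm : Cx s 0 fun p : Memory × Reveals κ ℓ B => p.1 := .of_isWiring isWiring_fst
    have hr : Cx s 0 fun p : Memory × Reveals κ ℓ B => p.2 := .of_isWiring isWiring_snd
    exact (hm.snd.snd.snd.ite (Cx.const (s := s) Reply.silent) hr.replyReveals).mono
      (k' := 80) (by omega)

end Honest

/-! ### Reactions of two worlds that share a secret key. -/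

section Tools

variable {Q R Θ S U V : Type} {W₁ W₂ : World Q R}

theorem tsum_map_mul {A A' : Type} (p : PMF A) (F : A → A') (φ : A' → ℝ≥0∞) :
    ∑' b, p.map F b * φ b = ∑' a, p a * φ (F a) := by
  classical
  simp only [PMF.map_apply, ← ENNReal.tsum_mul_right]
  rw [ENNReal.tsum_comm]
  refine tsum_congr fun a => ?_
  rw [tsum_eq_single (F a)]
  · simp
  · intro b hb
    simp [hb]

/-- The hidden part of the second world has a fixed law `m'`: the tape of `aOT` is not touched
before outputs appear. Only in the first world does the conditional law depend on the knowledge. -/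
theorem react_of_bind {I : Type} {m : S → PMF U} {f₁ : Θ → S → U → W₁.State} {m' : PMF V}
    {f₂ : Θ → S → V → W₂.State} {Φ : S → ℝ≥0∞} {c : ℕ} {s : S} {x : Q} (ν : PMF I) (s' : I → S)
    (r : I → R) (X : Finset Θ) (hX : X.card ≤ c) (hΦ : ∑' i, ν i * Φ (s' i) ≤ Φ s)
    (hm : m s = ν.bind fun i => m (s' i))
    (h₁ : ∀ θ ∉ X, ∀ i, ∀ u ∈ (m (s' i)).support,
      W₁.step (f₁ θ s u) x = PMF.pure (f₁ θ (s' i) u, r i))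
    (h₂ : ∀ θ ∉ X, ∀ u, W₂.step (f₂ θ s u) x = ν.map fun i => (f₂ θ (s' i) u, r i)) :
    ∃ (X : Finset Θ) (μ : PMF (S × R)), X.card ≤ c ∧ ∑' p, μ p * Φ p.1 ≤ Φ s ∧
      ∀ θ ∉ X, Reacts W₁ (fun s => (m s).map (f₁ θ s)) s x μ ∧
        Reacts W₂ (fun s => m'.map (f₂ θ s)) s x μ := by
  refine ⟨X, ν.map fun i => (s' i, r i), hX, ?_, fun θ hθ => ⟨?_, ?_⟩⟩
  · rwa [tsum_map_mul ν (fun i => (s' i, r i)) fun p => Φ p.1]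
  · refine Reacts.of_bind ν (fun i => m (s' i)) (f₁ θ s) (fun i => f₁ θ (s' i)) _ _ ?_
      (fun _ => rfl) (h₁ θ hθ)
    rw [hm, PMF.map_bind]
  · simp only [Reacts, PMF.bind_map, PMF.map_comp, Function.comp_def, h₂ θ hθ]
    exact PMF.bind_comm m' ν _

theorem react_of_pure {m : S → PMF U} {f₁ : Θ → S → U → W₁.State} {m' : PMF V}
    {f₂ : Θ → S → V → W₂.State} {Φ : S → ℝ≥0∞} {c : ℕ} {s : S} {x : Q} (s' : S) (r : R)
    (X : Finset Θ) (hX : X.card ≤ c) (hΦ : Φ s' ≤ Φ s) (hm : m s' = m s)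
    (h₁ : ∀ θ ∉ X, ∀ u ∈ (m s).support, W₁.step (f₁ θ s u) x = PMF.pure (f₁ θ s' u, r))
    (h₂ : ∀ θ ∉ X, ∀ u, W₂.step (f₂ θ s u) x = PMF.pure (f₂ θ s' u, r)) :
    ∃ (X : Finset Θ) (μ : PMF (S × R)), X.card ≤ c ∧ ∑' p, μ p * Φ p.1 ≤ Φ s ∧
      ∀ θ ∉ X, Reacts W₁ (fun s => (m s).map (f₁ θ s)) s x μ ∧
        Reacts W₂ (fun s => m'.map (f₂ θ s)) s x μ :=
  react_of_bind (PMF.pure ()) (fun _ => s') (fun _ => r) X hX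
    (by
      rw [tsum_eq_single () fun i hi => (hi rfl).elim]
      simpa using hΦ)
    (by rw [PMF.pure_bind, hm]) (fun θ hθ _ => by rw [hm]; exact h₁ θ hθ)
    (fun θ hθ u => by rw [PMF.pure_map]; exact h₂ θ hθ u)

end Tools

variable {κ n : ℕ}

/-- Resampling one key of a uniform tape changes nothing. It isolates the honest party's key as the
common secret θ of both worlds. -/
theorem uniform_tape_ΔB : ((PMF.uniformOfFintype (Key κ)).bind fun θ =>
    (PMF.uniformOfFintype (Tape κ n)).map fun u => { u with ΔB := θ }) =
      PMF.uniformOfFintype (Tape κ n) := by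
  have h : Regular fun p : Key κ × Tape κ n => ({ p.2 with ΔB := p.1 } : Tape κ n) := by
    have h1 : Regular fun p : Key κ × Tape κ n =>
        (({ p.2 with ΔB := p.1 } : Tape κ n), p.2.ΔB) := .of_bijective ⟨by
      rintro ⟨_, ⟨⟩⟩ ⟨_, ⟨⟩⟩ h
      simp_all, fun ⟨t, θ⟩ => ⟨(t.ΔB, { t with ΔB := θ }), rfl⟩⟩
    exact regular_fst.comp h1
  have h2 : PMF.map _ _ = PMF.uniformOfFintype (Tape κ n) := h
  rw [uniform_prod, PMF.map_bind] at h2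
  simp only [PMF.map_comp] at h2
  exact h2

theorem uniform_tape_ΔA : ((PMF.uniformOfFintype (Key κ)).bind fun θ =>
    (PMF.uniformOfFintype (Tape κ n)).map fun u => { u with ΔA := θ }) =
      PMF.uniformOfFintype (Tape κ n) := by
  have h : Regular fun p : Key κ × Tape κ n => ({ p.2 with ΔA := p.1 } : Tape κ n) := by
    have h1 : Regular fun p : Key κ × Tape κ n =>
        (({ p.2 with ΔA := p.1 } : Tape κ n), p.2.ΔA) := .of_bijective ⟨by
      rintro ⟨_, ⟨⟩⟩ ⟨_, ⟨⟩⟩ h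
      simp_all, fun ⟨t, θ⟩ => ⟨(t.ΔA, { t with ΔA := θ }), rfl⟩⟩
    exact regular_fst.comp h1
  have h2 : PMF.map _ _ = PMF.uniformOfFintype (Tape κ n) := h
  rw [uniform_prod, PMF.map_bind] at h2
  simp only [PMF.map_comp] at h2
  exact h2

/-! ## Bob is corrupted -/

namespace CorruptBob

variable {ℓ B : ℕ}

/-- Messages that look like those of Alice, given the revealed bits. -/
def forge (ΔA : Key κ) (v : Fin (ℓ * B) → ReceiverView κ) (d : Fin ℓ → Fin (B - 1) → Bit) :
    Reveals κ ℓ B :=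
  fun j k => (d j k, revealedKey (bucket 1 v j k) (bucket 1 v j (k + 1)) + d j k • ΔA)

/-- Whether Alice has started, whether Bob has chosen, his choice, whether Alice got her output
from `LaOT`, whether she is done, and what she has revealed. -/
abbrev Memory (κ ℓ B : ℕ) :=
  Bool × Bool × ReceiverOut κ (ℓ * B) × Bool × Bool × Reveals κ ℓ B

/-- The coins are the revealed bits. Bob's values are permuted before anything else, so that buckets
then lie at fixed positions (permutation `1`), which keeps the circuits simple. Queries for Bob's
own key are answered from memory, since `aOT` learns this key only at the end. -/
def strategy (κ ℓ B : ℕ) : Strategy κ ℓ B (Memory κ ℓ B) (Fin ℓ → Fin (B - 1) → Bit) where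
  init := (false, false, default, false, false, default)
  start t _ := (true, t.2)
  react t x d _ := match x with
    | .chooseB v => (((t.1, true, if t.2.1 then t.2.2.1 else v, t.2.2.2), false, false),
        .reply .silent)
    | .keyQuery P Δ =>
      if decide (P = .bob) then
        ((t, false, false), .reply (.answer (t.2.1 && decide (t.2.2.1.1 = Δ))))
      else ((t, false, true), .call (.keyQuery P Δ))
    | .deliverBox P =>
      (((t.1, t.2.1, t.2.2.1, t.2.2.2.1 || (decide (P = .alice) && t.1 && t.2.1), t.2.2.2.2),
        false, false), .reply .silent)
    | .sendPerm π =>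
      if t.2.2.2.1 && !t.2.2.2.2.1 then
        (((t.1, t.2.1, t.2.2.1, t.2.2.2.1, true,
            forge t.2.2.1.1 (fun i => t.2.2.1.2 (π i)) d), true, false),
          .call (.chooseB (t.2.2.1.1, bobResult 1 (fun i => t.2.2.1.2 (π i))
            fun j k => (d j k, 0))))
      else ((t, false, false), .reply .silent)
    | _ => ((t, false, false), .reply .silent)
  finish t _ := .reveals t.2.2.2.2.2
  honest := .alice

/-- What the environment knows before Alice is done. -/
structure Knowledge (κ ℓ B : ℕ) where
  started : Bool
  chosen : Option (ReceiverOut κ (ℓ * B))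
  got : Bool

namespace Knowledge

variable (s : Knowledge κ ℓ B)

def memory : Memory κ ℓ B :=
  (s.started, s.chosen.isSome, s.chosen.getD default, s.got, false, default)

def Inv : Prop := s.got = true → s.started = true ∧ s.chosen.isSome = true

end Knowledge

/-- Indicator of Alice. -/
def aliceFlag (b : Bool) : Party → Bool := Function.update (fun _ => false) .alice b

def realState (θ : Key κ) (s : Knowledge κ ℓ B)
    (u : Equiv.Perm (Fin (ℓ * B)) × Tape κ (ℓ * B)) : RealState κ ℓ B where
  box := ⟨{ u.2 with ΔB := θ }, aliceFlag s.started, none, s.chosen, aliceFlag s.got, false⟩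
  perm := u.1
  gotA := if s.got then s.chosen.map fun v =>
    (θ, fun i => senderOf v.1 θ (v.2 i) (u.2.other i)) else none
  gotB := none
  sent := none
  doneA := false
  doneB := false

noncomputable def idealState (θ : Key κ) (s : Knowledge κ ℓ B) (u : Tape κ ℓ) :
    (Wired.Wire (Memory κ ℓ B × Bool × Bool) → Bool) × Box κ ℓ :=
  (Wired.enc (s.memory, false, false),
    ⟨{ u with ΔB := θ }, aliceFlag s.started, none, none, fun _ => false, false⟩)

/-- States after Alice is done. -/
def Match (t₁ : RealState κ ℓ B)
    (t₂ : (Wired.Wire (Memory κ ℓ B × Bool × Bool) → Bool) × Box κ ℓ) : Prop :=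
  ∃ (v : ReceiverOut κ (ℓ * B)) (r : Reveals κ ℓ B) (started : Bool),
    t₁.box.choiceB = some v ∧ t₁.box.delivered .alice = true ∧ t₁.doneA = true ∧
    t₂.1 = Wired.enc (((started, true, v, true, true, r), false, false) :
      Memory κ ℓ B × Bool × Bool) ∧
    t₁.box.tape.ΔB = t₂.2.tape.ΔB

/-- Alice's true MACs pass Bob's check, and the check determines a MAC from the bit, Bob's keys and
Δ_A. -/
theorem forge_aliceReveals (π : Equiv.Perm (Fin (ℓ * B))) (ΔA ΔB : Key κ)
    (b : Fin (ℓ * B) → ReceiverView κ) (y : Fin (ℓ * B) → Bit) :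
    forge ΔA (fun i => b (π i)) (fun j k =>
      (aliceReveals π (fun i => senderOf ΔA ΔB (b i) (y i)) j k).1) =
        aliceReveals π fun i => senderOf ΔA ΔB (b i) (y i) := by
  have h := bobAccepts_aliceReveals π ΔA ΔB (fun i => senderOf ΔA ΔB (b i) (y i)) fun i => (b i).c
  simp only [receiverOf_senderOf] at h
  funext j k
  refine Prod.ext rfl ?_
  rw [h j k, revealedKey_foldB]
  rfl

/-- What `aOT` gives Alice, computed from Bob's combined values and an unselected bit, agrees with
her result in the protocol, provided this bit is z plus the difference of her result. -/
theorem senderOf_bobResult (hB : 1 ≤ B) (π : Equiv.Perm (Fin (ℓ * B))) (ΔA ΔB : Key κ)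
    (b : Fin (ℓ * B) → ReceiverView κ) (y : Fin (ℓ * B) → Bit) (r : Reveals κ ℓ B)
    (hr : ∀ j k, (r j k).1 = (aliceReveals π (fun i => senderOf ΔA ΔB (b i) (y i)) j k).1)
    (j : Fin ℓ) :
    senderOf ΔA ΔB (bobResult π b r j) ((bobResult π b r j).z +
      ((aliceResult π (fun i => senderOf ΔA ΔB (b i) (y i)) j).x₀ +
        (aliceResult π (fun i => senderOf ΔA ΔB (b i) (y i)) j).x₁)) =
      aliceResult π (fun i => senderOf ΔA ΔB (b i) (y i)) j := by
  have h := bobResult_receiverOf π hB ΔA ΔB (fun i => senderOf ΔA ΔB (b i) (y i))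
    (fun i => (b i).c) r hr
  simp only [receiverOf_senderOf] at h
  rw [h]
  exact senderOf_receiverOf _ _ _ _

/-- The tape of `aOT` and the revealed bits, given the tape of `LaOT`. -/
def combineTape (θ : Key κ) (b : ReceiverOut κ (ℓ * B)) (π : Equiv.Perm (Fin (ℓ * B)))
    (u : Tape κ (ℓ * B)) : Tape κ ℓ × (Fin ℓ → Fin (B - 1) → Bit) :=
  let v := fun i => senderOf b.1 θ (b.2 i) (u.other i)
  (⟨u.ΔA, u.ΔB, aliceResult π u.sender, bucketSum π u.choice, fun j =>
    (bobResult π b.2 (fun j k => ((aliceReveals π v j k).1, 0)) j).z +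
      ((aliceResult π v j).x₀ + (aliceResult π v j).x₁)⟩, fun j k => (aliceReveals π v j k).1)

/-- The main component is `regular_other`, with `F` being Bob's combined bit z as a function of the
revealed bits. -/
theorem regular_combineTape (hB : 1 ≤ B) (θ : Key κ) (b : ReceiverOut κ (ℓ * B))
    (π : Equiv.Perm (Fin (ℓ * B))) : Regular (combineTape θ b π) := by
  have hs : Regular (bucketSum π) := by
    simpa using regular_bucketSum π (fun _ => none) fun _ => ⟨⟨0, hB⟩, rfl⟩
  have h1 : Regular fun a : Tape κ (ℓ * B) => ((a.ΔA, a.ΔB), a.sender, a.choice, a.other) :=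
    .of_bijective ⟨by
      rintro ⟨⟩ ⟨⟩ h
      simp_all, fun p => ⟨⟨p.1.1, p.1.2, p.2.1, p.2.2.1, p.2.2.2⟩, rfl⟩⟩
  have h2 := (regular_prodMap (Regular.of_bijective (Function.bijective_id :
    Function.Bijective (id : Key κ × Key κ → Key κ × Key κ)))
    (regular_prodMap (regular_fst.comp (regular_alice (κ := κ) π hB))
      (regular_prodMap hs (regular_other π hB b.1 θ b.2 fun j d =>
        (bobResult π b.2 (fun _ k => (d k, 0)) j).z)))).comp h1
  have h3 : Regular fun p : (Key κ × Key κ) × (Fin ℓ → SenderView κ) × (Fin ℓ → Bit) ×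
      ((Fin ℓ → Bit) × (Fin ℓ → Fin (B - 1) → Bit)) =>
      ((⟨p.1.1, p.1.2, p.2.1, p.2.2.1, p.2.2.2.1⟩, p.2.2.2.2) :
        Tape κ ℓ × (Fin ℓ → Fin (B - 1) → Bit)) :=
    .of_bijective ⟨by
      rintro ⟨⟨_, _⟩, _, _, _, _⟩ ⟨⟨_, _⟩, _, _, _, _⟩ h
      simp_all, by
      rintro ⟨⟨a, b, c, d, e⟩, r⟩
      exact ⟨((a, b), c, d, e, r), rfl⟩⟩
  exact h3.comp h2

section Simulation

variable (D : PMF (Equiv.Perm (Fin (ℓ * B))))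

theorem matched (t₁ : (realWorld κ ℓ B D (some .bob)).State)
    (t₂ : (idealWorld (strategy κ ℓ B).toSimulator D (some .bob)).State) (x : EnvQuery κ ℓ B)
    (h : Match t₁ t₂) : ∃ t₁' t₂' r, (realWorld κ ℓ B D (some .bob)).step t₁ x =
      PMF.pure (t₁', r) ∧ (idealWorld (strategy κ ℓ B).toSimulator D (some .bob)).step t₂ x =
        PMF.pure (t₂', r) ∧ Match t₁' t₂' := by
  obtain ⟨v, r, st, h1, h2, h3, h4, h5⟩ := h
  obtain ⟨t₂, b⟩ := t₂
  obtain rfl := h4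
  rcases x with P | x
  · by_cases hP : P = .bob
    · subst hP
      refine ⟨t₁, _, ⟨.silent, []⟩, ?_, (Strategy.step_start _ _ _ _ _ _).trans (if_pos rfl),
        ⟨v, r, st, h1, h2, h3, rfl, h5⟩⟩
      simp [realWorld, RealState.step, Box.start]
      rfl
    · refine ⟨_, _, ⟨.silent, []⟩, rfl, (Strategy.step_start _ _ _ _ _ _).trans (if_neg ?_),
        ⟨v, r, true, ?_, ?_, h3, rfl, ?_⟩⟩
      all_goals simp [Box.start, Ne.symm hP, h1, h2, h5]
  · have ideal : ∀ {o : (Memory κ ℓ B × Bool × Bool) × SimAction κ ℓ B},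
        (∀ c π, (strategy κ ℓ B).react (st, true, v, true, true, r) x c π = o) → _ :=
      fun h => (strategy κ ℓ B).step_attack_of_react (D := D) (cor := some .bob) (b := b) h
    cases x with
    | chooseB w =>
      refine ⟨t₁, _, ⟨.silent, []⟩, ?_, ideal (fun _ _ => rfl), ⟨v, r, st, h1, h2, h3, rfl, h5⟩⟩
      simp [realWorld, RealState.step, RealState.attack, Box.chooseB, h1]
      rfl
    | guess i g =>
      refine ⟨t₁, _, ⟨.silent, []⟩, ?_, ideal (fun _ _ => rfl), ⟨v, r, st, h1, h2, h3, rfl, h5⟩⟩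
      simp [realWorld, RealState.step, RealState.attack, Box.guess]
      rfl
    | chooseA w =>
      refine ⟨t₁, _, ⟨.silent, []⟩, ?_, ideal (fun _ _ => rfl), ⟨v, r, st, h1, h2, h3, rfl, h5⟩⟩
      simp [realWorld, RealState.step, RealState.attack, Box.chooseA]
      rfl
    | keyQuery P Δ =>
      cases P with
      | bob =>
        refine ⟨t₁, _, _, rfl, (ideal (fun _ _ => rfl)).trans ?_,
          ⟨v, r, st, h1, h2, h3, rfl, h5⟩⟩
        simp [Strategy.resolve, Box.keyQuery, Box.globalKey, h1]
        rfl
      | alice =>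
        refine ⟨t₁, _, _, rfl, (ideal (fun _ _ => rfl)).trans ?_,
          ⟨v, r, st, h1, h2, h3, rfl, h5⟩⟩
        simp [Strategy.resolve, Box.command, Box.keyQuery, Box.globalKey, h5]
        rfl
    | deliverBox P =>
      refine ⟨t₁, _, ⟨.silent, []⟩, ?_, ideal (fun _ _ => rfl), ⟨v, r, st, h1, h2, h3, rfl, h5⟩⟩
      cases P <;> simp [realWorld, RealState.step, RealState.attack, Box.deliver, h2] <;> rfl
    | deliverPerm =>
      refine ⟨t₁, _, ⟨.silent, []⟩, ?_, ideal (fun _ _ => rfl), ⟨v, r, st, h1, h2, h3, rfl, h5⟩⟩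
      simp [realWorld, RealState.step, RealState.attack]
    | deliverReveals =>
      refine ⟨t₁, _, ⟨.silent, []⟩, ?_, ideal (fun _ _ => rfl), ⟨v, r, st, h1, h2, h3, rfl, h5⟩⟩
      simp [realWorld, RealState.step, RealState.attack]
    | sendPerm π =>
      refine ⟨t₁, _, ⟨.silent, []⟩, ?_, ideal (fun _ _ => rfl), ⟨v, r, st, h1, h2, h3, rfl, h5⟩⟩
      simp [realWorld, RealState.step, RealState.attack, RealState.receivePerm, h3]
    | sendReveals r' =>
      refine ⟨t₁, _, ⟨.silent, []⟩, ?_, ideal (fun _ _ => rfl), ⟨v, r, st, h1, h2, h3, rfl, h5⟩⟩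
      simp [realWorld, RealState.step, RealState.attack]

open Classical in
/-- The invariant, as a bound for the probability of failure. -/
noncomputable def potential (s : Knowledge κ ℓ B) : ℝ≥0∞ := if s.Inv then 0 else 1

/-- The hidden parts of the states are independent of what the environment knows. -/
noncomputable def sample : PMF (Equiv.Perm (Fin (ℓ * B)) × Tape κ (ℓ * B)) :=
  (PMF.uniformOfFintype (Tape κ (ℓ * B))).bind fun t => D.map fun π => (π, t)

abbrev Coupled (s : Knowledge κ ℓ B) (x : EnvQuery κ ℓ B) : Prop :=
  ∃ (X : Finset (Key κ)) (μ : PMF (Knowledge κ ℓ B × Response κ ℓ B)), X.card ≤ 1 ∧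
    ∑' p, μ p * potential p.1 ≤ potential s ∧ ∀ θ ∉ X,
    Reacts (realWorld κ ℓ B D (some .bob)) (fun s => (sample D).map (realState θ s)) s x μ ∧
    Reacts (idealWorld (strategy κ ℓ B).toSimulator D (some .bob))
      (fun s => (PMF.uniformOfFintype (Tape κ ℓ)).map (idealState θ s)) s x μ

variable {D}

theorem Coupled.of_pure {s : Knowledge κ ℓ B} {x : EnvQuery κ ℓ B} (s' : Knowledge κ ℓ B)
    (r : Response κ ℓ B) (hs' : s'.Inv) (X : Finset (Key κ)) (hX : X.card ≤ 1)
    (h₁ : ∀ θ ∉ X, ∀ u, (realState θ s u).step (some .bob) x = (realState θ s' u, r))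
    (h₂ : ∀ θ ∉ X, ∀ u, (idealWorld (strategy κ ℓ B).toSimulator D (some .bob)).step
      (idealState θ s u) x = PMF.pure (idealState θ s' u, r)) : Coupled D s x :=
  react_of_pure (m := fun _ => sample D) s' r X hX (by rw [potential, if_pos hs']; exact zero_le) rfl
    (fun θ hθ u _ => congrArg PMF.pure (h₁ θ hθ u)) h₂

theorem Coupled.of_silent {s : Knowledge κ ℓ B} {x : AdvCmd κ ℓ B} (hs : s.Inv)
    (h₁ : ∀ θ u, (realState θ s u).attack (some .bob) x = (realState θ s u, ⟨.silent, []⟩))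
    (h₂ : ∀ c π, (strategy κ ℓ B).react s.memory x c π =
      ((s.memory, false, false), .reply .silent)) : Coupled D s (.attack x) :=
  .of_pure s ⟨.silent, []⟩ hs ∅ (by simp) (fun θ _ u => h₁ θ u)
    fun θ _ u => Strategy.step_attack_of_react _ h₂

theorem coupled_start (s : Knowledge κ ℓ B) (P : Party) (hs : s.Inv) :
    Coupled D s (.start P) := by
  cases P with
  | bob => exact .of_pure s ⟨.silent, []⟩ hs ∅ (by simp) (fun θ _ u => rfl) fun θ _ u =>
      (Strategy.step_start _ _ _ _ _ _).trans (if_pos rfl)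
  | alice =>
    refine .of_pure { s with started := true } ⟨.silent, []⟩ (fun h => ⟨rfl, (hs h).2⟩) ∅ (by simp)
      (fun θ _ u => ?_) fun θ _ u => (Strategy.step_start _ _ _ _ _ _).trans (if_neg (by simp)
        |>.trans ?_)
    · simp [RealState.step, Box.start, realState, aliceFlag]
    · simp [Box.start, aliceFlag, idealState, Knowledge.memory, strategy]
      rfl

theorem coupled_chooseB (s : Knowledge κ ℓ B) (v : ReceiverOut κ (ℓ * B)) (hs : s.Inv) :
    Coupled D s (.attack (.chooseB v)) := by
  obtain ⟨st, ch, got⟩ := s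
  cases ch with
  | some w =>
    refine .of_silent hs (fun θ u => ?_) fun c π => rfl
    simp [RealState.attack, Box.chooseB, realState]
  | none =>
    have hg : got = false := by
      by_contra h
      have := hs (by simpa using h)
      simp at this
    subst hg
    refine .of_pure ⟨st, some v, false⟩ ⟨.silent, []⟩ (fun h => by simp at h) ∅ (by simp)
      (fun θ _ u => ?_) fun θ _ u => (Strategy.step_attack_of_react _ (fun c π => rfl)).trans rfl
    simp [RealState.step, RealState.attack, Box.chooseB, realState]

theorem coupled_keyQuery (s : Knowledge κ ℓ B) (P : Party) (Δ : Key κ) (hs : s.Inv) :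
    Coupled D s (.attack (.keyQuery P Δ)) := by
  cases P with
  | bob =>
    refine .of_pure s ⟨.answer (s.chosen.isSome && decide ((s.chosen.getD default).1 = Δ)), []⟩ hs
      ∅ (by simp) (fun θ _ u => ?_) fun θ _ u =>
        (Strategy.step_attack_of_react _ (fun c π => rfl)).trans rfl
    obtain ⟨st, _ | w, got⟩ := s <;>
      simp [RealState.step, RealState.attack, Box.keyQuery, Box.globalKey, realState]
  | alice =>
    -- The queried string is the single exceptional value of θ; for all others both worlds answer
    -- `false`.
    refine .of_pure s ⟨.answer false, []⟩ hs {Δ} (by simp) (fun θ hθ u => ?_) fun θ hθ u =>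
        (Strategy.step_attack_of_react _ (fun c π => rfl)).trans ?_
    · have : θ ≠ Δ := by simpa using hθ
      simp [RealState.step, RealState.attack, Box.keyQuery, Box.globalKey, realState, this]
    · have : θ ≠ Δ := by simpa using hθ
      simp [Strategy.resolve, Box.command, Box.keyQuery, Box.globalKey, this]
      rfl

theorem coupled_deliverBox (s : Knowledge κ ℓ B) (P : Party) (hs : s.Inv) :
    Coupled D s (.attack (.deliverBox P)) := by
  obtain ⟨st, ch, got⟩ := s
  cases P with
  | bob =>
    refine .of_silent hs (fun θ u => ?_) fun c π => ?_
    · simp [RealState.attack, Box.deliver, realState]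
    · simp [strategy, Knowledge.memory]
  | alice =>
    by_cases h : st = true ∧ ch.isSome = true ∧ got = false
    · obtain ⟨rfl, hc, rfl⟩ := h
      obtain ⟨v, rfl⟩ := Option.isSome_iff_exists.1 hc
      refine .of_pure ⟨true, some v, true⟩ ⟨.silent, []⟩ (fun _ => ⟨rfl, rfl⟩) ∅ (by simp)
        (fun θ _ u => ?_) fun θ _ u => (Strategy.step_attack_of_react _ (fun c π => rfl)).trans rfl
      simp [RealState.step, RealState.attack, Box.deliver, Box.values, realState, aliceFlag]
    · refine .of_silent hs (fun θ u => ?_) fun c π => ?_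
      · cases st <;> cases ch <;> cases got <;>
          simp [RealState.attack, Box.deliver, Box.values, realState, aliceFlag] at h ⊢
      · cases st <;> cases ch <;> cases got <;> simp [strategy, Knowledge.memory] at h ⊢

/-- Alice's output now contains θ, so no common law independent of θ can exist and the worlds pass
to matched states instead. The joint law is driven by the tape of `LaOT`; its ideal marginal is
correct because `combineTape` is regular. -/
theorem coupling_sendPerm (hB : 1 ≤ B) (v : ReceiverOut κ (ℓ * B)) (π : Equiv.Perm (Fin (ℓ * B)))
    (θ : Key κ) : ∃ ν : PMF (((realWorld κ ℓ B D (some .bob)).State ×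
        (idealWorld (strategy κ ℓ B).toSimulator D (some .bob)).State) × Response κ ℓ B),
      (∀ p ∈ ν.support, Match p.1.1 p.1.2) ∧
      (((sample D).map (realState θ ⟨true, some v, true⟩)).bind fun t =>
        (realWorld κ ℓ B D (some .bob)).step t (.attack (.sendPerm π))) =
          ν.map (fun p => (p.1.1, p.2)) ∧
      (((PMF.uniformOfFintype (Tape κ ℓ)).map (idealState θ ⟨true, some v, true⟩)).bind fun t =>
        (idealWorld (strategy κ ℓ B).toSimulator D (some .bob)).step t (.attack (.sendPerm π))) =
          ν.map (fun p => (p.1.2, p.2)) := by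
  let w : Tape κ (ℓ * B) → Fin (ℓ * B) → SenderView κ := fun u i =>
    senderOf v.1 θ (v.2 i) (u.other i)
  let real : Equiv.Perm (Fin (ℓ * B)) × Tape κ (ℓ * B) → RealState κ ℓ B := fun p =>
    { realState θ ⟨true, some v, true⟩ p with
      sent := some (aliceReveals π (w p.2))
      doneA := true }
  let ideal : Tape κ ℓ × (Fin ℓ → Fin (B - 1) → Bit) →
      (Wired.Wire (Memory κ ℓ B × Bool × Bool) → Bool) × Box κ ℓ := fun p =>
    (Wired.enc ((true, true, v, true, true, forge v.1 (fun i => v.2 (π i)) p.2), false, false),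
      ⟨{ p.1 with ΔB := θ }, aliceFlag true, none,
        some (v.1, bobResult π v.2 fun j k => (p.2 j k, 0)), aliceFlag true, false⟩)
  let resp : Tape κ ℓ × (Fin ℓ → Fin (B - 1) → Bit) → Response κ ℓ B := fun p =>
    ⟨.reveals (forge v.1 (fun i => v.2 (π i)) p.2), [.sender (θ, fun j =>
      senderOf v.1 θ (bobResult π v.2 (fun j k => (p.2 j k, 0)) j) (p.1.other j))]⟩
  refine ⟨(sample D).map fun p => ((real p, ideal (combineTape θ v π p.2)),
    resp (combineTape θ v π p.2)), ?_, ?_, ?_⟩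
  · intro p hp
    rw [PMF.support_map] at hp
    obtain ⟨q, -, rfl⟩ := hp
    exact ⟨v, _, true, rfl, by simp [real, realState, aliceFlag], rfl, rfl, rfl⟩
  · rw [PMF.bind_map, PMF.map_comp]
    refine congrArg (PMF.bind (sample D)) (funext fun p => congrArg PMF.pure ?_)
    have e1 := forge_aliceReveals π v.1 θ v.2 p.2.other
    have e2 : ∀ j, _ = _ := senderOf_bobResult hB π v.1 θ v.2 p.2.other
      (fun j k => ((aliceReveals π (w p.2) j k).1, 0)) fun _ _ => rfl
    simp only [RealState.step, RealState.attack, RealState.receivePerm, realState, if_true,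
      Option.map_some]
    refine Prod.ext rfl ?_
    simp only [Function.comp_apply, resp, combineTape, e1]
    exact congrArg (fun y => (⟨_, [.sender (θ, y)]⟩ : Response κ ℓ B))
      (funext fun j => (e2 j).symm)
  · have hideal : ∀ T d π', (strategy κ ℓ B).resolve (some .bob) (idealState θ ⟨true, some v, true⟩ T).2
        ((strategy κ ℓ B).react (Knowledge.memory ⟨true, some v, true⟩) (.sendPerm π) d π') =
          PMF.pure (ideal (T, d), resp (T, d)) := by
      intro T d π'
      simp [strategy, Knowledge.memory, Strategy.resolve, idealState, Box.command, Box.chooseB,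
        Box.deliver, Box.values, aliceFlag, PMF.bind_const]
      rfl
    have h1 : ∀ T, (idealWorld (strategy κ ℓ B).toSimulator D (some .bob)).step
        (idealState θ ⟨true, some v, true⟩ T) (.attack (.sendPerm π)) =
          (PMF.uniformOfFintype (Fin ℓ → Fin (B - 1) → Bit)).map fun d =>
            (ideal (T, d), resp (T, d)) := by
      intro T
      refine (Strategy.step_attack _ _ _ _ _ _).trans ?_
      refine congrArg (PMF.bind _) (funext fun d => ?_)
      refine (congrArg (PMF.bind D) (funext fun π' => hideal T d π')).trans (PMF.bind_const _ _)
    have h2 := (regular_combineTape hB θ v π).map_comp fun p => (ideal p, resp p)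
    rw [PMF.bind_map, PMF.map_comp, sample, PMF.map_bind]
    simp only [PMF.map_comp]
    refine Eq.trans ?_ (Eq.trans h2.symm ?_)
    · rw [uniform_prod, PMF.map_bind]
      refine congrArg (PMF.bind _) (funext fun T => ?_)
      rw [PMF.map_comp]
      exact h1 T
    · refine congrArg (PMF.bind _) (funext fun u => ?_)
      exact (PMF.map_const _ _).symm

theorem coupling (hB : 1 ≤ B) : Coupling (W₁ := realWorld κ ℓ B D (some .bob))
    (W₂ := idealWorld (strategy κ ℓ B).toSimulator D (some .bob))
    (fun θ s => (sample D).map (realState θ s))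
    (fun θ s => (PMF.uniformOfFintype (Tape κ ℓ)).map (idealState θ s)) Match potential 1 := by
  refine ⟨matched D, fun s x => ?_⟩
  by_cases hs : s.Inv
  swap
  · exact Or.inl (by rw [potential, if_neg hs])
  right
  rcases x with P | x
  · exact Or.inl (coupled_start s P hs)
  cases x with
  | chooseB v => exact Or.inl (coupled_chooseB s v hs)
  | keyQuery P Δ => exact Or.inl (coupled_keyQuery s P Δ hs)
  | deliverBox P => exact Or.inl (coupled_deliverBox s P hs)
  | sendPerm π =>
    obtain ⟨st, ch, _ | _⟩ := s
    · exact Or.inl (Coupled.of_silent hs (fun _ _ => rfl) fun _ _ => rfl)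
    · obtain ⟨rfl, hc⟩ := hs rfl
      obtain ⟨v, rfl⟩ := Option.isSome_iff_exists.1 hc
      exact Or.inr (coupling_sendPerm hB v π)
  | _ => exact Or.inl (Coupled.of_silent hs (fun _ _ => rfl) fun _ _ => rfl)

theorem abs_acceptProb_sub_le (hB : 1 ≤ B) (D : PMF (Equiv.Perm (Fin (ℓ * B))))
    (Z : Env (EnvQuery κ ℓ B) (Response κ ℓ B)) (q : ℕ) :
    |acceptProb Z (realWorld κ ℓ B D (some .bob)) q -
      acceptProb Z (idealWorld (strategy κ ℓ B).toSimulator D (some .bob)) q| ≤ q / 2 ^ κ := by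
  let s₀ : Knowledge κ ℓ B := ⟨false, none, false⟩
  have hflag : aliceFlag false = fun _ => false := Function.update_eq_self _ _
  have h := AOT.abs_acceptProb_sub_le (σ := PMF.pure s₀) ?_ ?_ (coupling (κ := κ) (D := D) hB)
    (ε := 0) ?_ (by simp) Z q
  · simpa using h
  · simp only [PMF.pure_bind, sample]
    refine Eq.trans (congrArg (fun p : PMF (Tape κ (ℓ * B)) => p.bind fun t => D.map fun π =>
      (⟨Box.create t, π, none, none, none, false, false⟩ : RealState κ ℓ B))
        uniform_tape_ΔB.symm) ?_
    rw [PMF.bind_bind]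
    refine congrArg (PMF.bind _) (funext fun θ => ?_)
    rw [PMF.bind_map]
    refine Eq.trans ?_ (PMF.map_bind _ _ _).symm
    refine congrArg (PMF.bind _) (funext fun u => ?_)
    refine Eq.trans ?_ (PMF.map_comp _ _ _).symm
    refine congrArg (fun f => PMF.map f _) (funext fun π => ?_)
    change _ = (⟨⟨_, aliceFlag false, _, _, aliceFlag false, _⟩, _, _, _, _, _, _⟩ :
      RealState κ ℓ B)
    rw [hflag]
    rfl
  · simp only [PMF.pure_bind]
    refine Eq.trans (congrArg (PMF.map _) uniform_tape_ΔB.symm) ?_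
    rw [PMF.map_bind]
    refine congrArg (PMF.bind _) (funext fun θ => ?_)
    rw [PMF.map_comp]
    refine congrArg (fun f => PMF.map f _) (funext fun u => ?_)
    change _ = (_, (⟨_, aliceFlag false, _, _, _, _⟩ : Box κ ℓ))
    rw [hflag]
    rfl
  · rw [tsum_eq_single s₀]
    · simp [potential, Knowledge.Inv, s₀]
    · intro p hp
      simp [PMF.pure_apply, hp]

end Simulation

end CorruptBob

/-! ## The probability of a fully leaked bucket -/

/-- C(k,B)/2^k is maximal at k = 2B. From k to k + 1 it changes by the factor (k+1)/(2(k+1-B)),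
which is at least 1 for B ≤ k < 2B and at most 1 for k ≥ 2B; hence two inductions starting from 2B.
-/
theorem choose_mul_four_pow_le (k B : ℕ) : k.choose B * 4 ^ B ≤ 2 ^ k * (2 * B).choose B := by
  have up : ∀ i, (2 * B + i).choose B * 4 ^ B ≤ 2 ^ (2 * B + i) * (2 * B).choose B := by
    intro i
    induction i with
    | zero => rw [Nat.add_zero, pow_mul, mul_comm]; norm_num
    | succ i ih =>
      have h1 := Nat.choose_mul_succ_eq (2 * B + i) B
      have h2 : (2 * B + i + 1).choose B ≤ 2 * (2 * B + i).choose B := by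
        have h3 : 0 < 2 * B + i + 1 - B := by omega
        refine Nat.le_of_mul_le_mul_right ?_ h3
        have h4 : 2 * B + i + 1 ≤ 2 * (2 * B + i + 1 - B) := by omega
        rw [← h1]
        nlinarith [Nat.mul_le_mul_left ((2 * B + i).choose B) h4]
      rw [← add_assoc, pow_succ]
      nlinarith [Nat.mul_le_mul_right (4 ^ B) h2]
  have down : ∀ i ≤ 2 * B, (2 * B - i).choose B * 4 ^ B ≤ 2 ^ (2 * B - i) * (2 * B).choose B := by
    intro i
    induction i with
    | zero => intro _; exact up 0
    | succ i ih =>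
      intro hi
      have ih := ih (by omega)
      obtain ⟨m, hm⟩ : ∃ m, 2 * B - i = m + 1 := ⟨2 * B - i - 1, by omega⟩
      have e : 2 * B - (i + 1) = m := by omega
      rw [e]
      rw [hm] at ih
      have h1 := Nat.choose_mul_succ_eq m B
      have h2 : 2 * m.choose B ≤ (m + 1).choose B := by
        refine Nat.le_of_mul_le_mul_right ?_ (Nat.succ_pos m)
        rw [Nat.succ_eq_add_one, mul_assoc, h1, mul_left_comm]
        exact Nat.mul_le_mul_left _ (by omega)
      have h3 := Nat.mul_le_mul_right (4 ^ B) h2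
      rw [pow_succ] at ih
      nlinarith
  rcases le_total k (2 * B) with h | h
  · have := down (2 * B - k) (by omega)
    rwa [Nat.sub_sub_self h] at this
  · obtain ⟨i, rfl⟩ := Nat.exists_eq_add_of_le h
    exact up i

/-- After multiplication by B! both sides are products over i < B, and ℓ(2B - i) ≤ 2(ℓB - i) because
ℓ ≥ 2. -/
theorem pow_mul_choose_le {ℓ : ℕ} (hℓ : 2 ≤ ℓ) (B : ℕ) :
    ℓ ^ B * (2 * B).choose B ≤ 2 ^ B * (ℓ * B).choose B := by
  refine Nat.le_of_mul_le_mul_left ?_ (Nat.factorial_pos B)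
  rw [mul_left_comm, mul_left_comm _ (2 ^ B), ← Nat.descFactorial_eq_factorial_mul_choose,
    ← Nat.descFactorial_eq_factorial_mul_choose, Nat.descFactorial_eq_prod_range,
    Nat.descFactorial_eq_prod_range, Finset.pow_eq_prod_const, Finset.pow_eq_prod_const,
    ← Finset.prod_mul_distrib, ← Finset.prod_mul_distrib]
  refine Finset.prod_le_prod' fun i hi => ?_
  have hi := Finset.mem_range.1 hi
  rw [Nat.mul_sub, Nat.mul_sub, mul_left_comm]
  exact Nat.sub_le_sub_left (Nat.mul_le_mul_right i hℓ) _

/-- The union bound over buckets, weighted with the chance 2^(-k) of k successful guesses. For ℓ ≥ 2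
the worst k is replaced by 2B, and C(2B,B)/C(ℓB,B) ≤ (2/ℓ)^B. -/
theorem mul_descFactorial_le {ℓ B ψ k : ℕ} (hℓ : 1 ≤ ℓ) (hB : 1 ≤ B)
    (hψ : 2 ^ ψ ≤ (2 * ℓ) ^ (B - 1)) (hk : k ≤ ℓ * B) :
    ℓ * k.descFactorial B * 2 ^ ψ ≤ 2 ^ k * (ℓ * B).descFactorial B := by
  obtain ⟨m, rfl⟩ : ∃ m, B = m + 1 := ⟨B - 1, by omega⟩
  rw [Nat.add_sub_cancel] at hψ
  rw [Nat.descFactorial_eq_factorial_mul_choose, Nat.descFactorial_eq_factorial_mul_choose]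
  suffices h : ℓ * k.choose (m + 1) * (2 * ℓ) ^ m ≤ 2 ^ k * (ℓ * (m + 1)).choose (m + 1) by
    have h1 := Nat.mul_le_mul_left (ℓ * k.choose (m + 1)) hψ
    nlinarith [Nat.mul_le_mul_left (m + 1).factorial (h1.trans h)]
  rcases hℓ.eq_or_lt with rfl | hℓ
  -- With a single bucket there are only B OTs, so the binomial coefficient vanishes unless k = B.
  · rw [one_mul] at hk
    rcases hk.eq_or_lt with rfl | hk
    · simp [Nat.pow_succ]
    · rw [Nat.choose_eq_zero_of_lt hk]
      simp
  · have h1 := choose_mul_four_pow_le k (m + 1)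
    have h2 := pow_mul_choose_le hℓ (m + 1)
    refine Nat.le_of_mul_le_mul_right ?_ (pow_pos (show 0 < 4 by norm_num) (m + 1))
    -- The leading factor 2 is not needed: the estimate holds with a factor two to spare.
    have e : (4 : ℕ) ^ (m + 1) = 2 * (2 ^ m * 2 ^ (m + 1)) := by
      rw [show (4 : ℕ) = 2 * 2 by norm_num, mul_pow, pow_succ]
      ring
    calc ℓ * k.choose (m + 1) * (2 * ℓ) ^ m * 4 ^ (m + 1)
        = ℓ ^ (m + 1) * 2 ^ m * (k.choose (m + 1) * 4 ^ (m + 1)) := by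
          rw [mul_pow, pow_succ ℓ]
          ring
      _ ≤ ℓ ^ (m + 1) * 2 ^ m * (2 ^ k * (2 * (m + 1)).choose (m + 1)) := Nat.mul_le_mul_left _ h1
      _ = 2 ^ m * 2 ^ k * (ℓ ^ (m + 1) * (2 * (m + 1)).choose (m + 1)) := by ring
      _ ≤ 2 ^ m * 2 ^ k * (2 ^ (m + 1) * (ℓ * (m + 1)).choose (m + 1)) := Nat.mul_le_mul_left _ h2
      _ ≤ 2 ^ k * (ℓ * (m + 1)).choose (m + 1) * 4 ^ (m + 1) := by
          rw [e]
          nlinarith [Nat.zero_le (2 ^ m * 2 ^ k * (2 ^ (m + 1) * (ℓ * (m + 1)).choose (m + 1)))]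

theorem two_pow_le_of_le_logb {ℓ B ψ : ℕ} (hℓ : 1 ≤ ℓ) (hB : 1 ≤ B)
    (h : (ψ : ℝ) ≤ (Real.logb 2 ℓ + 1) * ((B : ℝ) - 1)) : 2 ^ ψ ≤ (2 * ℓ) ^ (B - 1) := by
  have hℓ' : (0 : ℝ) < ℓ := by exact_mod_cast hℓ
  have h1 : (2 : ℝ) ^ (ψ : ℝ) ≤ 2 ^ ((Real.logb 2 ℓ + 1) * ((B : ℝ) - 1)) :=
    Real.rpow_le_rpow_of_exponent_le (by norm_num) h
  have e : ((B : ℝ) - 1) = ((B - 1 : ℕ) : ℝ) := by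
    rw [Nat.cast_sub hB, Nat.cast_one]
  rw [Real.rpow_natCast, e, Real.rpow_mul (by norm_num), Real.rpow_natCast,
    Real.rpow_add (by norm_num), Real.rpow_logb (by norm_num) (by norm_num) hℓ', Real.rpow_one,
    mul_comm] at h1
  exact_mod_cast h1

variable {ℓ B : ℕ}

/-- B-wise independence, applied to the B points of one bucket, makes their images a uniform
embedding; the embeddings into `L` are counted by a falling factorial. -/
theorem tsum_leakedBucket_le {D : PMF (Equiv.Perm (Fin (ℓ * B)))} (hD : IsWiseIndependent B D)
    (L : Finset (Fin (ℓ * B))) (j : Fin ℓ) [DecidablePred fun π => ∀ i, position π (j, i) ∈ L] :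
    ∑' π, D π * (if ∀ i, position π (j, i) ∈ L then 1 else 0) =
      (L.card.descFactorial B : ℝ≥0∞) / ((ℓ * B).descFactorial B : ℕ) := by
  classical
  let f : Fin B ↪ Fin (ℓ * B) := ⟨fun i => finProdFinEquiv (j, i), fun a b h => by
    simpa using finProdFinEquiv.injective h⟩
  have h1 := tsum_map_mul D (fun π => f.trans π.toEmbedding)
    (fun g => if ∀ i, g i ∈ L then 1 else 0)
  have h2 : ∀ π, (∀ i, position π (j, i) ∈ L) ↔ ∀ i, (f.trans π.toEmbedding) i ∈ L :=
    fun π => Iff.rfl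
  simp only [h2]
  rw [← h1]
  simp only [hD f]
  rw [ENNReal.tsum_mul_left, tsum_fintype, Finset.sum_boole, ← ENNReal.div_eq_inv_mul]
  have h3 : (Finset.univ.filter fun g : Fin B ↪ Fin (ℓ * B) => ∀ i, g i ∈ L).card =
      L.card.descFactorial B := by
    have := Fintype.card_embedding_eq (α := Fin B) (β := L)
    rw [Fintype.card_coe, Fintype.card_fin] at this
    rw [← this, ← Fintype.card_subtype]
    exact Fintype.card_congr ⟨fun g => ⟨fun i => ⟨g.1 i, g.2 i⟩, fun a b h => g.1.injective (by
      simpa using h)⟩, fun g => ⟨g.trans (Function.Embedding.subtype _), fun i => (g i).2⟩,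
      fun _ => rfl, fun _ => rfl⟩
  rw [h3, Fintype.card_embedding_eq, Fintype.card_fin, Fintype.card_fin]

-- Union bound over the buckets. The factor 2^|L| on the right is what the potential has gained when
-- the bits of `L` have been guessed successfully.
open Classical in
theorem tsum_leaked_le {ψ : ℕ} {D : PMF (Equiv.Perm (Fin (ℓ * B)))} (hℓ : 1 ≤ ℓ) (hB : 1 ≤ B)
    (hψ : 2 ^ ψ ≤ (2 * ℓ) ^ (B - 1)) (hD : IsWiseIndependent B D) (L : Finset (Fin (ℓ * B))) :
    ∑' π, D π * (if ∃ j, ∀ i, position π (j, i) ∈ L then 1 else 0) ≤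
      (2 ^ L.card / 2 ^ ψ : ℝ≥0∞) := by
  calc ∑' π, D π * (if ∃ j, ∀ i, position π (j, i) ∈ L then 1 else 0)
      ≤ ∑' π, ∑ j, D π * (if ∀ i, position π (j, i) ∈ L then 1 else 0) := by
        refine ENNReal.tsum_le_tsum fun π => ?_
        split_ifs with h
        · obtain ⟨j, hj⟩ := h
          refine le_trans ?_ (Finset.single_le_sum (fun _ _ => zero_le) (Finset.mem_univ j))
          rw [if_pos hj]
        · simp
    _ = ∑ j : Fin ℓ, (L.card.descFactorial B : ℝ≥0∞) / ((ℓ * B).descFactorial B : ℕ) := by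
        rw [Summable.tsum_finsetSum fun _ _ => ENNReal.summable]
        exact Finset.sum_congr rfl fun j _ => tsum_leakedBucket_le hD L j
    _ = (ℓ * L.card.descFactorial B : ℕ) / ((ℓ * B).descFactorial B : ℕ) := by
        rw [Finset.sum_const, Finset.card_univ, Fintype.card_fin, nsmul_eq_mul, Nat.cast_mul,
          mul_div_assoc]
    _ ≤ _ := by
        have hpos : (ℓ * B).descFactorial B ≠ 0 := by
          rw [Ne, Nat.descFactorial_eq_zero_iff_lt, not_lt]
          exact Nat.le_mul_of_pos_left B hℓ
        have h := mul_descFactorial_le hℓ hB hψ (k := L.card)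
          (by simpa using L.card_le_univ)
        rw [ENNReal.div_le_iff (by exact_mod_cast hpos) (by simp), ← ENNReal.mul_div_right_comm,
          ENNReal.le_div_iff_mul_le (Or.inl (by simp)) (Or.inl (by simp))]
        exact_mod_cast h

/-! ## Alice is corrupted -/

namespace CorruptAlice

variable {κ n ℓ B : ℕ}

/-- Whether Bob has started, whether Alice has chosen, and her choice (permuted once Bob has sent
the permutation); which choice bits she has guessed, and their values; whether `LaOT` has failed,
whether it has delivered Bob's output, and whether Bob waits for the revealed bits. -/
abbrev Memory (κ ℓ B : ℕ) :=
  (Bool × Bool × SenderOut κ (ℓ * B)) × ((Fin (ℓ * B) → Bool) × (Fin (ℓ * B) → Bit)) ×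
    (Bool × Bool × Bool)

/-- Choice bits are sampled lazily: the coin serves a first guess of a bit, and repeated guesses
reuse the stored value. Alice's inputs determine the only correct revealed pairs; anything else,
like a failure of `LaOT`, becomes an abort of `aOT`. Her combined values are input to `aOT` only
when she reveals correctly. -/
def strategy (κ ℓ B : ℕ) : Strategy κ ℓ B (Memory κ ℓ B) Bit where
  init := ((false, false, default), (fun _ => false, fun _ => 0), (false, false, false))
  start t _ := ((true, t.1.2), t.2)
  react t x c π := match x with
    | .chooseA v => ((((t.1.1, true, if t.1.2.1 then t.1.2.2 else v), t.2), false, false),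
        .reply .silent)
    | .guess i g =>
      if !t.2.2.2.1 && !t.2.2.1 then
        (((t.1, (fun k => t.2.1.1 k || decide (k = i), fun k => if decide (k = i) then
            (if t.2.1.1 i then t.2.1.2 i else c) else t.2.1.2 k),
          (!decide ((if t.2.1.1 i then t.2.1.2 i else c) = g), t.2.2.2)), false, false),
          .reply (.answer (decide ((if t.2.1.1 i then t.2.1.2 i else c) = g))))
      else ((t, false, false), .reply .silent)
    | .keyQuery P Δ =>
      if decide (P = .alice) then
        ((t, false, false), .reply (.answer (t.1.2.1 && decide (t.1.2.2.1 = Δ))))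
      else ((t, false, true), .call (.keyQuery P Δ))
    | .deliverBox P =>
      if decide (P = .bob) && t.1.1 && !t.2.2.2.1 then
        if t.2.2.1 then
          (((t.1, t.2.1, (t.2.2.1, true, t.2.2.2.2)), true, false), .call .abort)
        else if t.1.2.1 then
          ((((t.1.1, t.1.2.1, (t.1.2.2.1, fun i => t.1.2.2.2 (π i))), t.2.1, (t.2.2.1, true, true)),
            false, false), .reply (.perm π))
        else ((t, false, false), .reply .silent)
      else ((t, false, false), .reply .silent)
    | .sendReveals r =>
      if t.2.2.2.2 then
        (((t.1, t.2.1, (t.2.2.1, t.2.2.2.1, false)), true, false),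
          .call (if decide (r = aliceReveals 1 t.1.2.2.2) then
            .chooseA (t.1.2.2.1, aliceResult 1 t.1.2.2.2) else .abort))
      else ((t, false, false), .reply .silent)
    | _ => ((t, false, false), .reply .silent)
  finish _ _ := .silent
  honest := .bob

/-- What the environment knows, as long as Bob has not accepted. -/
structure Knowledge (κ ℓ B : ℕ) where
  started : Bool
  chosen : Option (SenderOut κ (ℓ * B))
  leaked : Fin (ℓ * B) → Option Bit
  failed : Bool
  delivered : Bool
  perm : Option (Equiv.Perm (Fin (ℓ * B)))
  /-- Bob has rejected. -/
  done : Bool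

namespace Knowledge

variable (s : Knowledge κ ℓ B)

def views : SenderOut κ (ℓ * B) :=
  ((s.chosen.getD default).1, fun i => (s.chosen.getD default).2 ((s.perm.getD 1) i))

def memory : Memory κ ℓ B :=
  ((s.started, s.chosen.isSome, s.views),
    (fun i => (s.leaked i).isSome, fun i => (s.leaked i).getD 0),
    (s.failed, s.delivered, s.perm.isSome && !s.done))

def Inv : Prop :=
  (s.perm.isSome = true → s.delivered = true ∧ s.chosen.isSome = true ∧ s.failed = false) ∧
  (s.done = true → s.perm.isSome = true) ∧
  (s.delivered = true → s.started = true ∧ (s.failed = true ∨ s.perm.isSome = true))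

/-- Bob has output `fail`. -/
def rejected : Bool := (s.delivered && s.failed) || s.done

end Knowledge

/-- Indicator of Bob. -/
def bobFlag (b : Bool) : Party → Bool := Function.update (fun _ => false) .bob b

/-- Overwriting the leaked bits of a uniform tape gives its law conditioned on them. -/
def override (l : Fin n → Option Bit) (t : Tape κ n) : Tape κ n :=
  { t with choice := fun i => (l i).getD (t.choice i) }

def realState (θ : Key κ) (s : Knowledge κ ℓ B)
    (u : Equiv.Perm (Fin (ℓ * B)) × Tape κ (ℓ * B)) : RealState κ ℓ B where
  box := ⟨{ u.2 with ΔA := θ }, bobFlag s.started, s.chosen, none, bobFlag s.delivered, s.failed⟩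
  perm := u.1
  gotA := none
  gotB := if s.perm.isSome then s.chosen.map fun v =>
    (θ, fun i => receiverOf θ v.1 (v.2 i) (u.2.choice i)) else none
  sent := none
  doneA := false
  doneB := s.done

noncomputable def idealState (θ : Key κ) (s : Knowledge κ ℓ B) (u : Tape κ ℓ) :
    (Wired.Wire (Memory κ ℓ B × Bool × Bool) → Bool) × Box κ ℓ :=
  (Wired.enc (s.memory, false, false),
    ⟨{ u with ΔA := θ }, bobFlag s.started, none, none, bobFlag s.rejected, s.rejected⟩)

/-- States after Bob has accepted. -/
def Match (t₁ : RealState κ ℓ B)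
    (t₂ : (Wired.Wire (Memory κ ℓ B × Bool × Bool) → Bool) × Box κ ℓ) : Prop :=
  ∃ (v : SenderOut κ (ℓ * B)) (w : Fin (ℓ * B) → SenderView κ) (started failed : Bool)
      (l : (Fin (ℓ * B) → Bool) × (Fin (ℓ * B) → Bit)),
    t₁.box.choiceA = some v ∧ t₁.box.delivered .bob = true ∧ t₁.doneB = true ∧
    t₂.1 = Wired.enc (((started, true, (v.1, w)), l, (failed, true, false)), false, false) ∧
    t₁.box.tape.ΔA = t₂.2.tape.ΔA

/-- Remembering the overwritten bit makes the map a bijection. -/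
theorem bijective_override (i : Fin n) : Regular fun p : Bit × Tape κ n =>
    ({ p.2 with choice := fun k => if k = i then p.1 else p.2.choice k } : Tape κ n) := by
  have h1 : Regular fun p : Bit × Tape κ n =>
      (({ p.2 with choice := fun k => if k = i then p.1 else p.2.choice k } : Tape κ n),
        p.2.choice i) := .of_bijective ⟨by
    rintro ⟨b, t⟩ ⟨b', t'⟩ h
    simp only [Prod.mk.injEq, Tape.mk.injEq] at h
    obtain ⟨⟨h1, h2, h3, h4, h5⟩, h6⟩ := h
    have h7 : b = b' := by simpa using congrFun h4 i
    have h8 : t.choice = t'.choice := by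
      funext k
      by_cases hk : k = i
      · rw [hk, h6]
      · simpa [hk] using congrFun h4 k
    cases t
    cases t'
    simp_all, by
    rintro ⟨t, b⟩
    refine ⟨(t.choice i, { t with choice := fun k => if k = i then b else t.choice k }), ?_⟩
    refine Prod.ext ?_ (if_pos rfl)
    cases t
    simp only [Tape.mk.injEq, true_and, and_true]
    funext k
    by_cases hk : k = i <;> simp [hk]⟩
  exact regular_fst.comp h1

/-- Justifies lazy sampling: a bit that has not leaked may be drawn at the moment when it is
guessed. -/
theorem map_override (l : Fin n → Option Bit) (i : Fin n) :
    (PMF.uniformOfFintype (Tape κ n)).map (override l) =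
      ((l i).elim (PMF.uniformOfFintype Bit) PMF.pure).bind fun b =>
        (PMF.uniformOfFintype (Tape κ n)).map
          (override fun k => if k = i then some b else l k) := by
  rcases hl : l i with _ | b
  · have h := (bijective_override (κ := κ) i).map_comp (override l)
    rw [← h, uniform_prod, PMF.map_bind]
    refine congrArg (PMF.bind _) (funext fun b => ?_)
    rw [PMF.map_comp]
    refine congrArg (fun f => PMF.map f _) (funext fun t => ?_)
    simp only [override, Function.comp_apply, Tape.mk.injEq, true_and, and_true]
    funext k
    by_cases hk : k = i
    · subst hk
      simp [hl]
    · simp [hk]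
  · rw [Option.elim, PMF.pure_bind]
    have : (fun k => if k = i then some b else l k) = l := by
      funext k
      by_cases hk : k = i
      · rw [if_pos hk, hk, hl]
      · rw [if_neg hk]
    rw [this]

section Simulation

variable (D : PMF (Equiv.Perm (Fin (ℓ * B))))

theorem matched (t₁ : (realWorld κ ℓ B D (some .alice)).State)
    (t₂ : (idealWorld (strategy κ ℓ B).toSimulator D (some .alice)).State) (x : EnvQuery κ ℓ B)
    (h : Match t₁ t₂) : ∃ t₁' t₂' r, (realWorld κ ℓ B D (some .alice)).step t₁ x =
      PMF.pure (t₁', r) ∧ (idealWorld (strategy κ ℓ B).toSimulator D (some .alice)).step t₂ x =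
        PMF.pure (t₂', r) ∧ Match t₁' t₂' := by
  obtain ⟨v, w, st, f, l, h1, h2, h3, h4, h5⟩ := h
  obtain ⟨t₂, b⟩ := t₂
  obtain rfl := h4
  rcases x with P | x
  · by_cases hP : P = .alice
    · subst hP
      refine ⟨t₁, _, ⟨.silent, []⟩, ?_, (Strategy.step_start _ _ _ _ _ _).trans (if_pos rfl),
        ⟨v, w, st, f, l, h1, h2, h3, rfl, h5⟩⟩
      simp [realWorld, RealState.step, Box.start]
      rfl
    · refine ⟨_, _, ⟨.silent, []⟩, rfl, (Strategy.step_start _ _ _ _ _ _).trans (if_neg ?_),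
        ⟨v, w, true, f, l, ?_, ?_, h3, rfl, ?_⟩⟩
      all_goals simp [Box.start, Ne.symm hP, h1, h2, h5]
  · have ideal : ∀ {o : (Memory κ ℓ B × Bool × Bool) × SimAction κ ℓ B},
        (∀ c π, (strategy κ ℓ B).react ((st, true, (v.1, w)), l, (f, true, false)) x c π = o) →
          _ :=
      fun h => (strategy κ ℓ B).step_attack_of_react (D := D) (cor := some .alice) (b := b) h
    cases x with
    | chooseA w' =>
      refine ⟨t₁, _, ⟨.silent, []⟩, ?_, ideal (fun _ _ => rfl),
        ⟨v, w, st, f, l, h1, h2, h3, rfl, h5⟩⟩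
      simp [realWorld, RealState.step, RealState.attack, Box.chooseA, h1]
      rfl
    | guess i g =>
      refine ⟨t₁, _, ⟨.silent, []⟩, ?_, ideal (fun _ _ => rfl),
        ⟨v, w, st, f, l, h1, h2, h3, rfl, h5⟩⟩
      simp [realWorld, RealState.step, RealState.attack, Box.guess, h2]
      rfl
    | chooseB w' =>
      refine ⟨t₁, _, ⟨.silent, []⟩, ?_, ideal (fun _ _ => rfl),
        ⟨v, w, st, f, l, h1, h2, h3, rfl, h5⟩⟩
      simp [realWorld, RealState.step, RealState.attack, Box.chooseB]
      rfl
    | keyQuery P Δ =>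
      cases P with
      | alice =>
        refine ⟨t₁, _, _, rfl, (ideal (fun _ _ => rfl)).trans ?_,
          ⟨v, w, st, f, l, h1, h2, h3, rfl, h5⟩⟩
        simp [Strategy.resolve, Box.keyQuery, Box.globalKey, h1]
        rfl
      | bob =>
        refine ⟨t₁, _, _, rfl, (ideal (fun _ _ => rfl)).trans ?_,
          ⟨v, w, st, f, l, h1, h2, h3, rfl, h5⟩⟩
        simp [Strategy.resolve, Box.command, Box.keyQuery, Box.globalKey, h5]
        rfl
    | deliverBox P =>
      refine ⟨t₁, _, ⟨.silent, []⟩, ?_, ideal (o := (_, .reply .silent)) (fun _ _ => ?_),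
        ⟨v, w, st, f, l, h1, h2, h3, rfl, h5⟩⟩
      · cases P <;> simp [realWorld, RealState.step, RealState.attack, Box.deliver, h2] <;> rfl
      · simp [strategy]
    | deliverPerm =>
      refine ⟨t₁, _, ⟨.silent, []⟩, ?_, ideal (fun _ _ => rfl),
        ⟨v, w, st, f, l, h1, h2, h3, rfl, h5⟩⟩
      simp [realWorld, RealState.step, RealState.attack]
    | deliverReveals =>
      refine ⟨t₁, _, ⟨.silent, []⟩, ?_, ideal (fun _ _ => rfl),
        ⟨v, w, st, f, l, h1, h2, h3, rfl, h5⟩⟩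
      simp [realWorld, RealState.step, RealState.attack]
    | sendPerm π =>
      refine ⟨t₁, _, ⟨.silent, []⟩, ?_, ideal (fun _ _ => rfl),
        ⟨v, w, st, f, l, h1, h2, h3, rfl, h5⟩⟩
      simp [realWorld, RealState.step, RealState.attack]
    | sendReveals r' =>
      refine ⟨t₁, _, ⟨.silent, []⟩, ?_, ideal (fun _ _ => rfl),
        ⟨v, w, st, f, l, h1, h2, h3, rfl, h5⟩⟩
      simp [realWorld, RealState.step, RealState.attack, RealState.receiveReveals, h3]

def leakedSet (l : Fin n → Option Bit) : Finset (Fin n) := Finset.univ.filter fun i => (l i).isSome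

open Classical in
/-- A bound for the probability that a bucket is or will be fully leaked while Bob can still
accept. -/
noncomputable def potential (ψ : ℕ) (s : Knowledge κ ℓ B) : ℝ≥0∞ :=
  if ¬ s.Inv then 1 else if s.failed || s.done then 0 else
    s.perm.elim (2 ^ (leakedSet s.leaked).card / 2 ^ ψ) fun π =>
      if ∃ j, ∀ i, position π (j, i) ∈ leakedSet s.leaked then 1 else 0

/-- The hidden part of the real state. -/
noncomputable def sample (s : Knowledge κ ℓ B) :
    PMF (Equiv.Perm (Fin (ℓ * B)) × Tape κ (ℓ * B)) :=
  (s.perm.elim D PMF.pure).bind fun π =>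
    ((PMF.uniformOfFintype (Tape κ (ℓ * B))).map (override s.leaked)).map fun t => (π, t)

abbrev Coupled (ψ : ℕ) (s : Knowledge κ ℓ B) (x : EnvQuery κ ℓ B) : Prop :=
  ∃ (X : Finset (Key κ)) (μ : PMF (Knowledge κ ℓ B × Response κ ℓ B)), X.card ≤ 1 ∧
    ∑' p, μ p * potential ψ p.1 ≤ potential ψ s ∧ ∀ θ ∉ X,
    Reacts (realWorld κ ℓ B D (some .alice)) (fun s => (sample D s).map (realState θ s)) s x μ ∧
    Reacts (idealWorld (strategy κ ℓ B).toSimulator D (some .alice))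
      (fun s => (PMF.uniformOfFintype (Tape κ ℓ)).map (idealState θ s)) s x μ

variable {D} {ψ : ℕ}

theorem sample_support {s : Knowledge κ ℓ B} {u : Equiv.Perm (Fin (ℓ * B)) × Tape κ (ℓ * B)}
    (hu : u ∈ (sample D s).support) :
    (∀ π, s.perm = some π → u.1 = π) ∧ ∀ i b, s.leaked i = some b → u.2.choice i = b := by
  simp only [sample, PMF.mem_support_bind_iff, PMF.support_map, Set.mem_image] at hu
  obtain ⟨π, h1, t, ⟨t', -, rfl⟩, rfl⟩ := hu
  refine ⟨fun π' hπ => ?_, fun i b hi => ?_⟩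
  · simpa [hπ] using h1
  · simp [override, hi]

theorem potential_of_failed {s : Knowledge κ ℓ B} (hs : s.Inv)
    (h : (s.failed || s.done) = true) : potential ψ s = 0 := by
  rw [potential, if_neg (not_not.2 hs), if_pos h]

theorem potential_eq {s : Knowledge κ ℓ B} (hs : s.Inv) (h : (s.failed || s.done) = false) :
    potential ψ s = s.perm.elim (2 ^ (leakedSet s.leaked).card / 2 ^ ψ) fun π => open Classical in
      if ∃ j, ∀ i, position π (j, i) ∈ leakedSet s.leaked then 1 else 0 := by
  rw [potential, if_neg (not_not.2 hs), if_neg (by simp [h])]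

theorem potential_congr {s s' : Knowledge κ ℓ B} (hs : s.Inv) (hs' : s'.Inv)
    (h1 : s'.failed = s.failed) (h2 : s'.done = s.done) (h3 : s'.perm = s.perm)
    (h4 : s'.leaked = s.leaked) : potential ψ s' = potential ψ s := by
  rw [potential, potential, h1, h2, h3, h4, if_neg (not_not.2 hs), if_neg (not_not.2 hs')]

theorem Coupled.of_pure {s : Knowledge κ ℓ B} {x : EnvQuery κ ℓ B} (s' : Knowledge κ ℓ B)
    (r : Response κ ℓ B) (hΦ : potential ψ s' ≤ potential ψ s) (hp : s'.perm = s.perm)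
    (hl : s'.leaked = s.leaked) (X : Finset (Key κ)) (hX : X.card ≤ 1)
    (h₁ : ∀ θ ∉ X, ∀ u ∈ (sample D s).support,
      (realState θ s u).step (some .alice) x = (realState θ s' u, r))
    (h₂ : ∀ θ ∉ X, ∀ u, (idealWorld (strategy κ ℓ B).toSimulator D (some .alice)).step
      (idealState θ s u) x = PMF.pure (idealState θ s' u, r)) : Coupled D ψ s x :=
  react_of_pure (m := sample D) s' r X hX hΦ (by rw [sample, sample, hp, hl])
    (fun θ hθ u hu => congrArg PMF.pure (h₁ θ hθ u hu)) h₂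

theorem Coupled.of_silent {s : Knowledge κ ℓ B} {x : AdvCmd κ ℓ B}
    (h₁ : ∀ θ u, (realState θ s u).attack (some .alice) x = (realState θ s u, ⟨.silent, []⟩))
    (h₂ : ∀ c π, (strategy κ ℓ B).react s.memory x c π =
      ((s.memory, false, false), .reply .silent)) : Coupled D ψ s (.attack x) :=
  .of_pure s ⟨.silent, []⟩ le_rfl rfl rfl ∅ (by simp) (fun θ _ u _ => h₁ θ u)
    fun θ _ u => Strategy.step_attack_of_react _ h₂

theorem coupled_start (s : Knowledge κ ℓ B) (P : Party) (hs : s.Inv) :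
    Coupled D ψ s (.start P) := by
  cases P with
  | alice =>
    exact .of_pure s ⟨.silent, []⟩ le_rfl rfl rfl ∅ (by simp) (fun θ _ u _ => rfl)
      fun θ _ u => (Strategy.step_start _ _ _ _ _ _).trans (if_pos rfl)
  | bob =>
    refine .of_pure { s with started := true } ⟨.silent, []⟩
      (potential_congr hs (s' := { s with started := true })
        ⟨hs.1, hs.2.1, fun h => ⟨rfl, (hs.2.2 h).2⟩⟩ rfl rfl rfl rfl).le
      rfl rfl ∅ (by simp)
      (fun θ _ u _ => ?_) fun θ _ u => (Strategy.step_start _ _ _ _ _ _).trans (if_neg (by simp)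
        |>.trans ?_)
    · simp [RealState.step, Box.start, realState, bobFlag]
    · simp [Box.start, bobFlag, idealState, Knowledge.memory, strategy, Knowledge.rejected]
      rfl

theorem coupled_chooseA (s : Knowledge κ ℓ B) (v : SenderOut κ (ℓ * B)) (hs : s.Inv) :
    Coupled D ψ s (.attack (.chooseA v)) := by
  obtain ⟨st, ch, l, f, d, p, o⟩ := s
  cases ch with
  | some w =>
    refine .of_silent (fun θ u => ?_) fun c π => rfl
    simp [RealState.attack, Box.chooseA, realState]
  | none =>
    have hp : p = none := by
      by_contra h
      have := hs.1 (Option.isSome_iff_ne_none.2 h)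
      simp at this
    subst hp
    refine .of_pure ⟨st, some v, l, f, d, none, o⟩ ⟨.silent, []⟩ (potential_congr hs
      (s' := ⟨st, some v, l, f, d, none, o⟩) ⟨fun h => by simp at h, hs.2.1, hs.2.2⟩
        rfl rfl rfl rfl).le rfl rfl ∅ (by simp)
      (fun θ _ u _ => ?_) fun θ _ u => (Strategy.step_attack_of_react _ (fun c π => rfl)).trans rfl
    simp [RealState.step, RealState.attack, Box.chooseA, realState]

theorem coupled_keyQuery (s : Knowledge κ ℓ B) (P : Party) (Δ : Key κ) :
    Coupled D ψ s (.attack (.keyQuery P Δ)) := by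
  cases P with
  | alice =>
    refine .of_pure s ⟨.answer (s.chosen.isSome && decide ((s.chosen.getD default).1 = Δ)), []⟩
      le_rfl rfl rfl ∅ (by simp) (fun θ _ u _ => ?_) fun θ _ u =>
        (Strategy.step_attack_of_react _ (fun c π => rfl)).trans rfl
    obtain ⟨st, _ | w, l, f, d, p, o⟩ := s <;>
      simp [RealState.step, RealState.attack, Box.keyQuery, Box.globalKey, realState]
  | bob =>
    refine .of_pure s ⟨.answer false, []⟩ le_rfl rfl rfl {Δ} (by simp) (fun θ hθ u _ => ?_)
      fun θ hθ u => (Strategy.step_attack_of_react _ (fun c π => rfl)).trans ?_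
    · have : θ ≠ Δ := by simpa using hθ
      simp [RealState.step, RealState.attack, Box.keyQuery, Box.globalKey, realState, this]
    · have : θ ≠ Δ := by simpa using hθ
      simp [Strategy.resolve, Box.command, Box.keyQuery, Box.globalKey, this]
      rfl

/-- A first guess of a bit is right with probability 1/2 and then doubles 2^|L|; a wrong guess makes
the box fail and the potential drop to 0. So the potential is preserved on average, and guessing a
known bit again cannot increase it. -/
theorem coupled_guess (s : Knowledge κ ℓ B) (i : Fin (ℓ * B)) (g : Bit) (hs : s.Inv) :
    Coupled D ψ s (.attack (.guess i g)) := by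
  by_cases h : s.delivered = false ∧ s.failed = false
  swap
  · refine .of_silent (fun θ u => ?_) fun c π => ?_
    · have : ¬(bobFlag s.delivered .bob = false ∧ s.failed = false) := by simpa [bobFlag] using h
      simp [RealState.attack, Box.guess, realState, this]
    · have : (!s.delivered && !s.failed) = false := by
        rw [Bool.eq_false_iff]
        intro h'
        simp only [Bool.and_eq_true, Bool.not_eq_true'] at h'
        exact h h'
      simp only [strategy, Knowledge.memory, this]
      rfl
  obtain ⟨st, ch, l, f, d, p, o⟩ := s
  obtain ⟨hd, hf⟩ := h
  simp only at hd hf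
  subst hd hf
  obtain rfl : p = none := by
    by_contra h
    have := (hs.1 (Option.isSome_iff_ne_none.2 h)).1
    simp at this
  obtain rfl : o = false := by
    by_contra h
    have := hs.2.1 (by simpa using h)
    simp at this
  let s' : Bit → Knowledge κ ℓ B := fun b =>
    ⟨st, ch, fun k => if k = i then some b else l k, !decide (b = g), false, none, false⟩
  have hs' : ∀ b, (s' b).Inv := fun b => by simp [Knowledge.Inv, s']
  refine react_of_bind (m := sample D) ((l i).elim (PMF.uniformOfFintype Bit) PMF.pure) s'
    (fun b => ⟨.answer (decide (b = g)), []⟩) ∅ (by simp) ?_ ?_ (fun θ _ b u hu => ?_)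
    fun θ _ u => ?_
  · rw [potential_eq hs rfl]
    have hne : ∀ b, b ≠ g → potential ψ (s' b) = 0 := fun b hb =>
      potential_of_failed (hs' b) (by simp [s', hb])
    have hg : potential ψ (s' g) =
        2 ^ (leakedSet fun k => if k = i then some g else l k).card / 2 ^ ψ :=
      potential_eq (hs' g) (by simp [s'])
    -- Only the value that agrees with the guess leaves the box running.
    rw [tsum_eq_single g fun b hb => by rw [hne b hb, mul_zero], hg, Option.elim]
    rcases hl : l i with _ | b
    · have hc : (leakedSet fun k => if k = i then some g else l k).card =
          (leakedSet l).card + 1 := by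
        have : (leakedSet fun k => if k = i then some g else l k) = insert i (leakedSet l) := by
          ext k
          by_cases hk : k = i <;> simp [leakedSet, hk]
        rw [this, Finset.card_insert_of_notMem (by simp [leakedSet, hl])]
      rw [Option.elim, hc, PMF.uniformOfFintype_apply, ZMod.card, pow_succ, mul_comm _ 2,
        mul_div_assoc, ← mul_assoc]
      rw [show (((2 : ℕ) : ℝ≥0∞))⁻¹ * 2 = 1 from ENNReal.inv_mul_cancel (by simp) (by simp),
        one_mul]
    · have hc : (leakedSet fun k => if k = i then some g else l k) = leakedSet l := by
        ext k
        by_cases hk : k = i <;> simp [leakedSet, hk, hl]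
      rw [hc]
      exact mul_le_of_le_one_left zero_le (PMF.coe_le_one _ _)
  · simp only [sample, Option.elim, s']
    rw [map_override l i]
    simp only [PMF.map_bind]
    exact PMF.bind_comm _ _ _
  · have hb := (sample_support hu).2 i b (if_pos rfl)
    refine congrArg PMF.pure ?_
    by_cases hbg : b = g
    · subst hbg
      simp [RealState.step, RealState.attack, Box.guess, realState, bobFlag, hb, s']
      rfl
    · simp [RealState.step, RealState.attack, Box.guess, realState, bobFlag, hb, s', hbg]
      rfl
  · refine (Strategy.step_attack _ _ _ _ _ _).trans ?_
    have hreact : ∀ c π, (strategy κ ℓ B).resolve (some .alice)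
        (idealState θ ⟨st, ch, l, false, false, none, false⟩ u).2 ((strategy κ ℓ B).react
          (Knowledge.memory ⟨st, ch, l, false, false, none, false⟩) (.guess i g) c π) =
        PMF.pure (idealState θ (s' ((l i).getD c)) u,
          ⟨.answer (decide ((l i).getD c = g)), []⟩) := by
      intro c π
      have e1 : (if (l i).isSome = true then (l i).getD 0 else c) = (l i).getD c := by
        rcases l i with _ | b <;> rfl
      have e2 : (fun k => (l k).isSome || decide (k = i)) =
          fun k => (if k = i then some ((l i).getD c) else l k).isSome := by
        funext k
        by_cases hk : k = i <;> simp [hk]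
      have e3 : (fun k => if decide (k = i) = true then (l i).getD c else (l k).getD 0) =
          fun k => (if k = i then some ((l i).getD c) else l k).getD 0 := by
        funext k
        by_cases hk : k = i <;> simp [hk]
      simp only [strategy, Knowledge.memory, e1, e2, e3]
      rfl
    have e : (fun c => PMF.bind D fun π => (strategy κ ℓ B).resolve (some .alice)
        (idealState θ ⟨st, ch, l, false, false, none, false⟩ u).2 ((strategy κ ℓ B).react
          (Knowledge.memory ⟨st, ch, l, false, false, none, false⟩) (.guess i g) c π)) = fun c =>
        PMF.pure (idealState θ (s' ((l i).getD c)) u,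
          ⟨.answer (decide ((l i).getD c = g)), []⟩) := by
      funext c
      simp only [hreact, PMF.bind_const]
    refine (congrArg (PMF.bind _) e).trans ?_
    rcases l i with _ | b
    · rfl
    · exact (PMF.bind_const _ (PMF.pure (idealState θ (s' b) u,
        (⟨.answer (decide (b = g)), []⟩ : Response κ ℓ B)))).trans (PMF.pure_map (fun i => (idealState θ (s' i) u,
          (⟨.answer (decide (i = g)), []⟩ : Response κ ℓ B))) b).symm

/-- The permutation becomes known after all guessing has ended, and the potential turns into the
indicator of a fully leaked bucket, whose expectation is bounded by `tsum_leaked_le`. -/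
theorem coupled_deliverBox (hℓ : 1 ≤ ℓ) (hB : 1 ≤ B) (hψ : 2 ^ ψ ≤ (2 * ℓ) ^ (B - 1))
    (hD : IsWiseIndependent B D) (s : Knowledge κ ℓ B) (P : Party) (hs : s.Inv) :
    Coupled D ψ s (.attack (.deliverBox P)) := by
  cases P with
  | alice =>
    refine .of_silent (fun θ u => ?_) fun c π => rfl
    simp [RealState.attack, Box.deliver, realState]
  | bob =>
  by_cases h : s.started = true ∧ s.delivered = false ∧ (s.failed = true ∨ s.chosen.isSome = true)
  swap
  · obtain ⟨st, ch, l, f, d, p, o⟩ := s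
    refine .of_silent (fun θ u => ?_) fun c π => ?_
    · cases st <;> cases d <;> cases f <;> cases ch <;>
        simp [RealState.attack, Box.deliver, Box.values, realState, bobFlag] at h ⊢
    · cases st <;> cases d <;> cases f <;> cases ch <;>
        simp [strategy, Knowledge.memory] at h ⊢
  obtain ⟨st, ch, l, f, d, p, o⟩ := s
  obtain ⟨hst, hd, h⟩ := h
  simp only at hst hd h
  subst hst hd
  obtain rfl : p = none := by
    by_contra h
    have := (hs.1 (Option.isSome_iff_ne_none.2 h)).1
    simp at this
  obtain rfl : o = false := by
    by_contra h
    have := hs.2.1 (by simpa using h)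
    simp at this
  cases f with
  | true =>
    refine .of_pure ⟨true, ch, l, true, true, none, false⟩ ⟨.silent, [.fail .bob]⟩ ?_ rfl rfl ∅
      (by simp) (fun θ _ u _ => ?_) fun θ _ u =>
        (Strategy.step_attack_of_react _ (fun c π => rfl)).trans ?_
    · rw [potential_of_failed (by simp [Knowledge.Inv]) rfl]
      exact zero_le
    · simp [RealState.step, RealState.attack, Box.deliver, realState, bobFlag]
    · simp [Strategy.resolve, Box.command, Box.abort, Box.deliver, strategy, bobFlag, idealState,
        Knowledge.rejected, PMF.bind_const, Knowledge.memory]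
      rfl
  | false =>
    obtain ⟨v, rfl⟩ := Option.isSome_iff_exists.1 (by simpa using h)
    refine react_of_bind (m := sample D) D (fun π => ⟨true, some v, l, false, true, some π, false⟩)
      (fun π => ⟨.perm π, []⟩) ∅ (by simp) ?_ ?_ (fun θ _ π u hu => ?_) fun θ _ u => ?_
    · rw [potential_eq hs rfl]
      refine le_trans (le_of_eq ?_) (tsum_leaked_le hℓ hB hψ hD (leakedSet l))
      refine tsum_congr fun π => ?_
      rw [potential_eq (by simp [Knowledge.Inv]) rfl]
      rfl
    · simp only [sample, Option.elim, PMF.pure_bind]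
    · have hπ := (sample_support hu).1 π rfl
      refine congrArg PMF.pure ?_
      simp [RealState.step, RealState.attack, Box.deliver, Box.values, realState, bobFlag, hπ]
      rfl
    · exact (Strategy.step_attack_of_perm _ (fun c π => rfl)).trans rfl

/-- If some bit is wrong, acceptance forces Δ_A to be the sum of two MACs known to Alice, which is
the one exceptional value of θ. If all bits are right, some MAC is wrong and Bob rejects in any
case. -/
theorem coupled_sendReveals_of_ne (s : Knowledge κ ℓ B) (hs : s.Inv)
    (v : SenderOut κ (ℓ * B)) (hv : s.chosen = some v) (π : Equiv.Perm (Fin (ℓ * B)))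
    (hπ : s.perm = some π) (hd : s.done = false) (r : Reveals κ ℓ B)
    (hr : r ≠ aliceReveals π v.2) : Coupled D ψ s (.attack (.sendReveals r)) := by
  obtain ⟨st, ch, l, f, d, p, o⟩ := s
  simp only at hv hπ hd
  subst hv hπ hd
  obtain ⟨hd, -, hf⟩ := hs.1 rfl
  simp only at hd hf
  subst hd hf
  obtain ⟨X, hX, hacc⟩ : ∃ X : Finset (Key κ), X.card ≤ 1 ∧ ∀ θ ∉ X, ∀ c : Fin (ℓ * B) → Bit,
      ¬BobAccepts θ π (fun i => receiverOf θ v.1 (v.2 i) (c i)) r := by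
    by_cases h : ∃ j k, (r j k).1 ≠ (aliceReveals π v.2 j k).1
    · obtain ⟨j, k, hjk⟩ := h
      refine ⟨{(r j k).2 + (aliceReveals π v.2 j k).2}, by simp, fun θ hθ c hacc => hθ ?_⟩
      have h1 := (bobAccepts_receiverOf π θ v.1 v.2 c r).1 hacc j k
      have h2 : (aliceReveals π v.2 j k).1 + (r j k).1 = 1 := by
        revert hjk
        generalize (aliceReveals π v.2 j k).1 = a
        generalize (r j k).1 = b
        revert a b
        decide
      rw [h2, one_smul] at h1
      rw [Finset.mem_singleton, h1, add_comm, ← add_assoc, key_add_self, zero_add]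
    · push Not at h
      refine ⟨∅, by simp, fun θ _ c hacc => hr ?_⟩
      rcases eq_of_bobAccepts π hacc with h1 | ⟨j, k, h1, -⟩
      · exact h1
      · exact (h1 (h j k)).elim
  have hs' : Knowledge.Inv (⟨st, some v, l, false, true, some π, true⟩ : Knowledge κ ℓ B) :=
    ⟨fun _ => ⟨rfl, rfl, rfl⟩, fun _ => rfl, hs.2.2⟩
  obtain ⟨rfl, -⟩ := hs.2.2 rfl
  refine .of_pure ⟨true, some v, l, false, true, some π, true⟩ ⟨.silent, [.fail .bob]⟩ ?_ rfl rfl X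
    hX (fun θ hθ u hu => ?_) fun θ hθ u =>
      (Strategy.step_attack_of_react _ (fun c π => rfl)).trans ?_
  · rw [potential_of_failed hs' rfl]
    exact zero_le
  · have hu := (sample_support hu).1 π rfl
    have := hacc θ hθ u.2.choice
    simp [RealState.step, RealState.attack, RealState.receiveReveals, realState, hu, this]
  · have : ¬ r = aliceReveals 1 (fun i => v.2 (π i)) := hr
    simp [Strategy.resolve, strategy, Knowledge.memory, Knowledge.views, this, Box.command,
      Box.abort, Box.deliver, bobFlag, idealState, Knowledge.rejected, PMF.bind_const]
    rfl

/-- The tape of `aOT`, given the tape of `LaOT`. -/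
def combineTape (π : Equiv.Perm (Fin (ℓ * B))) (l : Fin (ℓ * B) → Option Bit)
    (u : Tape κ (ℓ * B)) : Tape κ ℓ :=
  ⟨u.ΔA, u.ΔB, aliceResult π u.sender, bucketSum π fun i => (l i).getD (u.choice i),
    bucketSum π u.other⟩

theorem regular_combineTape (hB : 1 ≤ B) (π : Equiv.Perm (Fin (ℓ * B)))
    (l : Fin (ℓ * B) → Option Bit) (hl : ∀ j, ∃ i, l (position π (j, i)) = none) :
    Regular (combineTape (κ := κ) π l) := by
  have hs : Regular (bucketSum π) := by
    simpa using regular_bucketSum π (fun _ => none) fun _ => ⟨⟨0, hB⟩, rfl⟩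
  have h1 : Regular fun a : Tape κ (ℓ * B) => ((a.ΔA, a.ΔB), a.sender, a.choice, a.other) :=
    .of_bijective ⟨by
      rintro ⟨⟩ ⟨⟩ h
      simp_all, fun p => ⟨⟨p.1.1, p.1.2, p.2.1, p.2.2.1, p.2.2.2⟩, rfl⟩⟩
  have h2 := (regular_prodMap (Regular.of_bijective (Function.bijective_id :
    Function.Bijective (id : Key κ × Key κ → Key κ × Key κ)))
    (regular_prodMap (regular_fst.comp (regular_alice (κ := κ) π hB))
      (regular_prodMap (regular_bucketSum π l hl) hs))).comp h1
  have h3 : Regular fun p : (Key κ × Key κ) × (Fin ℓ → SenderView κ) × (Fin ℓ → Bit) ×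
      (Fin ℓ → Bit) => (⟨p.1.1, p.1.2, p.2.1, p.2.2.1, p.2.2.2⟩ : Tape κ ℓ) :=
    .of_bijective ⟨by
      rintro ⟨⟨_, _⟩, _, _, _⟩ ⟨⟨_, _⟩, _, _, _⟩ h
      simp_all, by
      rintro ⟨a, b, c, d, e⟩
      exact ⟨((a, b), c, d, e), rfl⟩⟩
  exact h3.comp h2

/-- Bob accepts and outputs θ, so the worlds pass to matched states. Since every bucket has an
unleaked bit, his combined choice bits are uniform, as in `aOT`. -/
theorem coupling_sendReveals (hB : 1 ≤ B) (v : SenderOut κ (ℓ * B))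
    (l : Fin (ℓ * B) → Option Bit) (π : Equiv.Perm (Fin (ℓ * B)))
    (hl : ∀ j, ∃ i, l (position π (j, i)) = none) (s : Knowledge κ ℓ B)
    (hs : s = ⟨true, some v, l, false, true, some π, false⟩)
    (θ : Key κ) : ∃ ν : PMF (((realWorld κ ℓ B D (some .alice)).State ×
        (idealWorld (strategy κ ℓ B).toSimulator D (some .alice)).State) × Response κ ℓ B),
      (∀ p ∈ ν.support, Match p.1.1 p.1.2) ∧
      (((sample D s).map (realState θ s)).bind fun t => (realWorld κ ℓ B D (some .alice)).step t
        (.attack (.sendReveals (aliceReveals π v.2)))) = ν.map (fun p => (p.1.1, p.2)) ∧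
      (((PMF.uniformOfFintype (Tape κ ℓ)).map (idealState θ s)).bind fun t =>
        (idealWorld (strategy κ ℓ B).toSimulator D (some .alice)).step t
          (.attack (.sendReveals (aliceReveals π v.2)))) = ν.map (fun p => (p.1.2, p.2)) := by
  let real : Tape κ (ℓ * B) → RealState κ ℓ B := fun u =>
    { realState θ s (π, override l u) with doneB := true }
  let w : Fin (ℓ * B) → SenderView κ := fun i => v.2 (π i)
  let ideal : Tape κ ℓ → (Wired.Wire (Memory κ ℓ B × Bool × Bool) → Bool) × Box κ ℓ := fun u =>
    (Wired.enc (((true, true, (v.1, w)), (fun i => (l i).isSome, fun i => (l i).getD 0),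
      (false, true, false)), false, false),
      ⟨{ u with ΔA := θ }, bobFlag true, some (v.1, aliceResult π v.2), none, bobFlag true, false⟩)
  let resp : Tape κ ℓ → Response κ ℓ B := fun u => ⟨.silent, [.receiver (θ, fun j =>
    receiverOf θ v.1 (aliceResult π v.2 j) (u.choice j))]⟩
  have hsample : sample D s = (PMF.uniformOfFintype (Tape κ (ℓ * B))).map fun u =>
      (π, override l u) := by
    rw [sample, hs, Option.elim, PMF.pure_bind, PMF.map_comp]
    rfl
  refine ⟨(PMF.uniformOfFintype (Tape κ (ℓ * B))).map fun u => ((real u,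
    ideal (combineTape π l u)), resp (combineTape π l u)), ?_, ?_, ?_⟩
  · intro p hp
    rw [PMF.support_map] at hp
    obtain ⟨u, -, rfl⟩ := hp
    exact ⟨v, w, true, false, _, by simp [real, realState, hs],
      by simp [real, realState, bobFlag, hs], rfl, rfl, rfl⟩
  · rw [hsample, PMF.map_comp, PMF.bind_map, PMF.map_comp]
    refine congrArg (PMF.bind _) (funext fun u => congrArg PMF.pure ?_)
    have hacc := bobAccepts_aliceReveals π θ v.1 v.2 (override l u).choice
    have hres := bobResult_receiverOf π hB θ v.1 v.2 (override l u).choice (aliceReveals π v.2)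
      fun _ _ => rfl
    simp only [Function.comp_apply, RealState.step, RealState.attack, RealState.receiveReveals,
      realState, hs, Option.isSome_some, if_true, Option.map_some, hacc, hres, real]
    rfl
  · have h1 : ∀ u, (idealWorld (strategy κ ℓ B).toSimulator D (some .alice)).step
        (idealState θ s u) (.attack (.sendReveals (aliceReveals π v.2))) =
          PMF.pure (ideal u, resp u) := by
      intro u
      subst hs
      have e1 : aliceReveals 1 w = aliceReveals π v.2 := rfl
      have e2 : aliceResult 1 w = aliceResult π v.2 := rfl
      refine (Strategy.step_attack_of_react _ (o := ((((true, true, (v.1, w)),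
        (fun i => (l i).isSome, fun i => (l i).getD 0), (false, true, false)), true, false),
          .call (.chooseA (v.1, aliceResult π v.2)))) (fun c π' => ?_)).trans ?_
      · change (_, SimAction.call (if decide (_ = aliceReveals 1 w) then
          .chooseA (v.1, aliceResult 1 w) else .abort)) = _
        rw [e1, e2, decide_eq_true rfl, if_pos rfl]
        rfl
      · simp [Strategy.resolve, strategy, Box.command, Box.chooseA, Box.deliver, Box.values,
          bobFlag, Knowledge.rejected, PMF.bind_const]
        rfl
    have h2 := (regular_combineTape (κ := κ) hB π l hl).map_comp fun u => (ideal u, resp u)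
    rw [PMF.bind_map, PMF.map_comp]
    refine Eq.trans ?_ h2.symm
    exact congrArg (PMF.bind _) (funext h1)

theorem coupling (hℓ : 1 ≤ ℓ) (hB : 1 ≤ B) (hψ : 2 ^ ψ ≤ (2 * ℓ) ^ (B - 1))
    (hD : IsWiseIndependent B D) : Coupling (W₁ := realWorld κ ℓ B D (some .alice))
    (W₂ := idealWorld (strategy κ ℓ B).toSimulator D (some .alice))
    (fun θ s => (sample D s).map (realState θ s))
    (fun θ s => (PMF.uniformOfFintype (Tape κ ℓ)).map (idealState θ s)) Match (potential ψ) 1 := by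
  refine ⟨matched D, fun s x => ?_⟩
  by_cases hs : s.Inv
  swap
  · exact Or.inl (by rw [potential, if_pos hs])
  rcases x with P | x
  · exact Or.inr (Or.inl (coupled_start s P hs))
  cases x with
  | chooseA v => exact Or.inr (Or.inl (coupled_chooseA s v hs))
  | guess i g => exact Or.inr (Or.inl (coupled_guess s i g hs))
  | keyQuery P Δ => exact Or.inr (Or.inl (coupled_keyQuery s P Δ))
  | deliverBox P => exact Or.inr (Or.inl (coupled_deliverBox hℓ hB hψ hD s P hs))
  | chooseB v => exact Or.inr (Or.inl (Coupled.of_silent (fun _ _ => rfl) fun _ _ => rfl))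
  | deliverPerm => exact Or.inr (Or.inl (Coupled.of_silent (fun _ _ => rfl) fun _ _ => rfl))
  | deliverReveals => exact Or.inr (Or.inl (Coupled.of_silent (fun _ _ => rfl) fun _ _ => rfl))
  | sendPerm π => exact Or.inr (Or.inl (Coupled.of_silent (fun _ _ => rfl) fun _ _ => rfl))
  | sendReveals r =>
    obtain ⟨st, ch, l, f, d, p, o⟩ := s
    cases p with
    | none => exact Or.inr (Or.inl (Coupled.of_silent (fun _ _ => rfl) fun _ _ => rfl))
    | some π =>
    obtain ⟨hd, hc, hf⟩ := hs.1 rfl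
    obtain ⟨v, rfl⟩ := Option.isSome_iff_exists.1 hc
    cases o with
    | true => exact Or.inr (Or.inl (Coupled.of_silent (fun _ _ => rfl) fun _ _ => rfl))
    | false =>
    by_cases hr : r = aliceReveals π v.2
    swap
    · exact Or.inr (Or.inl (coupled_sendReveals_of_ne _ hs v rfl π rfl rfl r hr))
    simp only at hd hf
    subst hd hf hr
    obtain ⟨rfl, -⟩ := hs.2.2 rfl
    -- With a fully leaked bucket the simulation may fail, but then the potential is already 1.
    by_cases hl : ∃ j, ∀ i, position π (j, i) ∈ leakedSet l
    · refine Or.inl (le_of_eq ?_)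
      rw [potential_eq hs rfl]
      exact (if_pos hl).symm
    · refine Or.inr (Or.inr (coupling_sendReveals hB v l π (fun j => ?_) _ rfl))
      simp only [not_exists, not_forall] at hl
      obtain ⟨i, hi⟩ := hl j
      exact ⟨i, by simpa [leakedSet] using hi⟩

theorem abs_acceptProb_sub_le (hℓ : 1 ≤ ℓ) (hB : 1 ≤ B) (hψ : 2 ^ ψ ≤ (2 * ℓ) ^ (B - 1))
    (hD : IsWiseIndependent B D)
    (Z : Env (EnvQuery κ ℓ B) (Response κ ℓ B)) (q : ℕ) :
    |acceptProb Z (realWorld κ ℓ B D (some .alice)) q -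
      acceptProb Z (idealWorld (strategy κ ℓ B).toSimulator D (some .alice)) q| ≤
        q / 2 ^ κ + 1 / 2 ^ ψ := by
  let s₀ : Knowledge κ ℓ B := ⟨false, none, fun _ => none, false, false, none, false⟩
  have hs₀ : s₀.Inv := by simp [Knowledge.Inv, s₀]
  have hflag : bobFlag false = fun _ => false := Function.update_eq_self _ _
  have h := AOT.abs_acceptProb_sub_le (σ := PMF.pure s₀) ?_ ?_
    (coupling (κ := κ) (D := D) hℓ hB hψ hD) (ε := 1 / 2 ^ ψ) ?_ (by simp) Z q
  · simpa using h
  · have ho : override (κ := κ) s₀.leaked = id := rfl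
    simp only [PMF.pure_bind, sample, PMF.map_comp, ho]
    refine Eq.trans (congrArg (fun p : PMF (Tape κ (ℓ * B)) => p.bind fun t => D.map fun π =>
      (⟨Box.create t, π, none, none, none, false, false⟩ : RealState κ ℓ B))
        uniform_tape_ΔA.symm) ?_
    rw [PMF.bind_bind]
    refine congrArg (PMF.bind _) (funext fun θ => ?_)
    rw [PMF.bind_map]
    refine (PMF.bind_comm _ _ _).trans (Eq.trans ?_ (PMF.map_bind _ _ _).symm)
    refine congrArg (PMF.bind _) (funext fun π => Eq.trans ?_ (PMF.map_comp _ _ _).symm)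
    refine congrArg (PMF.bind _) (funext fun u => congrArg PMF.pure ?_)
    change _ = (⟨⟨_, bobFlag false, _, _, bobFlag false, _⟩, _, _, _, _, _, _⟩ :
      RealState κ ℓ B)
    rw [hflag]
    rfl
  · simp only [PMF.pure_bind]
    refine Eq.trans (congrArg (PMF.map _) uniform_tape_ΔA.symm) ?_
    rw [PMF.map_bind]
    refine congrArg (PMF.bind _) (funext fun θ => ?_)
    rw [PMF.map_comp]
    refine congrArg (fun f => PMF.map f _) (funext fun u => ?_)
    change _ = (_, (⟨_, bobFlag false, _, _, bobFlag false, _⟩ : Box κ ℓ))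
    rw [hflag]
    rfl
  -- Nothing has leaked at the start, so the initial potential is 2^0/2^ψ.
  · rw [tsum_eq_single s₀]
    · rw [potential_eq hs₀ rfl]
      simp [s₀, leakedSet]
    · intro p hp
      simp [PMF.pure_apply, hp]

end Simulation

end CorruptAlice

/-! ## Circuits for the combiner -/

namespace Cx

variable {s k k' κ ℓ B : ℕ} {A : Type} [Wired A]

theorem senderTuple {f : A → SenderView κ} (h : Cx s k f) : Cx s k fun a => (f a).toTuple := h

theorem receiverTuple {f : A → ReceiverView κ} (h : Cx s k f) : Cx s k fun a => (f a).toTuple := h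

theorem senderView {x₀ x₁ : A → Bit} {m₀ m₁ kc kz : A → Key κ} (h₁ : Cx s k x₀) (h₂ : Cx s k x₁)
    (h₃ : Cx s k m₀) (h₄ : Cx s k m₁) (h₅ : Cx s k kc) (h₆ : Cx s k kz) :
    Cx s k fun a => (⟨x₀ a, x₁ a, m₀ a, m₁ a, kc a, kz a⟩ : SenderView κ) := by
  have h := h₁.prodMk (h₂.prodMk (h₃.prodMk (h₄.prodMk (h₅.prodMk h₆))))
  simp only [max_self] at h
  exact h

theorem receiverView {k₀ k₁ mc mz : A → Key κ} {c z : A → Bit} (h₁ : Cx s k k₀) (h₂ : Cx s k k₁)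
    (h₃ : Cx s k c) (h₄ : Cx s k mc) (h₅ : Cx s k z) (h₆ : Cx s k mz) :
    Cx s k fun a => (⟨k₀ a, k₁ a, c a, mc a, z a, mz a⟩ : ReceiverView κ) := by
  have h := h₁.prodMk (h₂.prodMk (h₃.prodMk (h₄.prodMk (h₅.prodMk h₆))))
  simp only [max_self] at h
  exact h

theorem or {f g : A → Bool} (hf : Cx s k f) (hg : Cx s k' g) :
    Cx s (max k k' + 4) fun a => f a || g a := by
  refine (congrArg (Cx s _) (funext fun a => ?_)).mp
    ((hf.not.and hg.not).not.mono (k' := max k k' + 4) (by omega))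
  cases f a <;> cases g a <;> rfl

theorem permute {β : Type} [Wired β] {m j : ℕ} (hm : m ≤ (s + 2) ^ j) {v : A → Fin m → β}
    {π : A → Equiv.Perm (Fin m)} (hv : Cx s k v) (hπ : Cx s k π) :
    Cx s (j + k + 6) fun a i => v a (π a i) := by
  have h : Cx s k fun a i => π a i := hπ
  refine pi fun i => (lookup hm hv (h.apply i)).mono ?_
  rw [max_self]
  omega

/-- For the identity permutation the positions of a bucket are constants, so no gates are needed for
the selection. -/
theorem bucket {α : Type} [Inhabited α] [Wired α] {v : A → Fin (ℓ * B) → α} (hv : Cx s k v)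
    (j : Fin ℓ) (i : ℕ) : Cx s k fun a => bucket 1 (v a) j i := by
  by_cases h : i < B
  · simp only [AOT.bucket, dif_pos h]
    exact hv.apply _
  · simp only [AOT.bucket, dif_neg h]
    exact (Cx.const (s := s) default).mono (by omega)

theorem revealed {f g : A → SenderView κ} (hf : Cx s k f) (hg : Cx s k g) :
    Cx s (k + 12) fun a => revealed (f a) (g a) := by
  have f' := hf.senderTuple
  have g' := hg.senderTuple
  have h1 := ((f'.fst.add f'.snd.fst).add g'.fst).add g'.snd.fst
  have h2 := ((f'.snd.snd.fst.add_key f'.snd.snd.snd.fst).add_key g'.snd.snd.fst).add_key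
    g'.snd.snd.snd.fst
  exact (h1.prodMk h2).mono (by omega)

theorem revealedKey {f g : A → ReceiverView κ} (hf : Cx s k f) (hg : Cx s k g) :
    Cx s (k + 12) fun a => revealedKey (f a) (g a) := by
  have f' := hf.receiverTuple
  have g' := hg.receiverTuple
  exact (((f'.fst.add_key f'.snd.fst).add_key g'.fst).add_key g'.snd.fst).mono (by omega)

theorem aliceReveals {v : A → Fin (ℓ * B) → SenderView κ} (hv : Cx s k v) :
    Cx s (k + 12) fun a => aliceReveals 1 (v a) := by
  refine pi fun j => pi fun i => ?_
  simp only [AOT.aliceReveals, revealed_foldA]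
  exact revealed (hv.bucket j i) (hv.bucket j (i + 1))

/-- The closed forms of the fold nest at most two sums of at most B terms, so the exponent grows by
a constant independent of B. -/
theorem aliceResult (hB : B ≤ s + 2) {v : A → Fin (ℓ * B) → SenderView κ} (hv : Cx s k v) :
    Cx s (k + 30) fun a => aliceResult 1 (v a) := by
  have hr : ∀ m ≤ B - 1 + 1, (Finset.range m).card ≤ (s + 2) ^ 1 := fun m hm => by
    rw [Finset.card_range, pow_one]
    omega
  refine pi fun j => ?_
  have hb : ∀ i, Cx s k fun a => (AOT.bucket 1 (v a) j i).toTuple := hv.bucket j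
  have h1 := sum _ (hr (B - 1 + 1) le_rfl) fun i _ => (hb i).fst
  have h2 := (sum _ (hr (B - 1) (by omega)) fun i _ => (hb i).fst).add (hb (B - 1)).snd.fst
  have h3 := sum_key _ (hr (B - 1 + 1) le_rfl) fun i _ => (hb i).snd.snd.fst
  have h4 := (sum_key _ (hr (B - 1) (by omega)) fun i _ => (hb i).snd.snd.fst).add_key
    (hb (B - 1)).snd.snd.snd.fst
  have h5 : ∀ m ≤ B - 1 + 1, Cx s (1 + k + 5) fun a => ∑ i ∈ Finset.range m,
      (AOT.bucket 1 (v a) j i).kc := fun m hm =>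
    sum_key _ (hr m hm) fun i _ => (hb i).snd.snd.snd.snd.fst
  have h6 := (sum_key _ (hr (B - 1 + 1) le_rfl) fun i _ => (hb i).snd.snd.snd.snd.snd).add_key
    (sum_key _ (hr (B - 1) (by omega)) (k := k + 14) fun i hi =>
      ((revealed (hv.bucket j i) (hv.bucket j (i + 1))).fst.smul_key (h5 (i + 1) (by
        have := Finset.mem_range.1 hi
        omega))).mono (by omega))
  have h := senderView (k := k + 30) (h1.mono (by omega)) (h2.mono (by omega))
    (h3.mono (by omega)) (h4.mono (by omega)) ((h5 (B - 1 + 1) le_rfl).mono (by omega))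
    (h6.mono (by omega))
  refine (congrArg (Cx s (k + 30)) (funext fun a => ?_)).mp h
  exact SenderView.ext' (foldA_x₀ _ _).symm (foldA_x₁ _ _).symm (foldA_m₀ _ _).symm
    (foldA_m₁ _ _).symm (foldA_kc _ _).symm (foldA_kz _ _).symm

theorem bobResult (hB : B ≤ s + 2) {v : A → Fin (ℓ * B) → ReceiverView κ}
    {d : A → Fin ℓ → Fin (B - 1) → Bit} (hv : Cx s k v) (hd : Cx s k d) :
    Cx s (k + 30) fun a => bobResult 1 (v a) fun j k => (d a j k, 0) := by
  have hr : ∀ m ≤ B - 1 + 1, (Finset.range m).card ≤ (s + 2) ^ 1 := fun m hm => by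
    rw [Finset.card_range, pow_one]
    omega
  refine pi fun j => ?_
  have hb : ∀ i, Cx s k fun a => (AOT.bucket 1 (v a) j i).toTuple := hv.bucket j
  have hd' : ∀ i, Cx s k fun a => revealedBits (κ := κ) (fun j k => (d a j k, 0)) j i := by
    intro i
    by_cases h : i < B - 1
    · simp only [revealedBits, dif_pos h]
      exact (hd.apply j).apply ⟨i, h⟩
    · simp only [revealedBits, dif_neg h]
      exact (Cx.const (s := s) (0 : Bit)).mono (by omega)
  have h1 := sum_key _ (hr (B - 1 + 1) le_rfl) fun i _ => (hb i).fst
  have h2 := (sum_key _ (hr (B - 1) (by omega)) fun i _ => (hb i).fst).add_key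
    (hb (B - 1)).snd.fst
  have h3 : ∀ m ≤ B - 1 + 1, Cx s (1 + k + 5) fun a => ∑ i ∈ Finset.range m,
      (AOT.bucket 1 (v a) j i).c := fun m hm =>
    sum _ (hr m hm) fun i _ => (hb i).snd.snd.fst
  have h4 : ∀ m ≤ B - 1 + 1, Cx s (1 + k + 5) fun a => ∑ i ∈ Finset.range m,
      (AOT.bucket 1 (v a) j i).mc := fun m hm =>
    sum_key _ (hr m hm) fun i _ => (hb i).snd.snd.snd.fst
  have hi : ∀ i ∈ Finset.range (B - 1), i + 1 ≤ B - 1 + 1 := fun i hi => by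
    have := Finset.mem_range.1 hi
    omega
  have h5 := (sum _ (hr (B - 1 + 1) le_rfl) fun i _ => (hb i).snd.snd.snd.snd.fst).add
    (sum _ (hr (B - 1) (by omega)) fun i h => (hd' i).mul (h3 (i + 1) (hi i h)))
  have h6 := (sum_key _ (hr (B - 1 + 1) le_rfl) fun i _ => (hb i).snd.snd.snd.snd.snd).add_key
    (sum_key _ (hr (B - 1) (by omega)) fun i h => (hd' i).smul_key (h4 (i + 1) (hi i h)))
  have h := receiverView (k := k + 30) (h1.mono (by omega)) (h2.mono (by omega))
    ((h3 (B - 1 + 1) le_rfl).mono (by omega)) ((h4 (B - 1 + 1) le_rfl).mono (by omega))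
    (h5.mono (by omega)) (h6.mono (by omega))
  refine (congrArg (Cx s (k + 30)) (funext fun a => ?_)).mp h
  exact ReceiverView.ext' (foldB_k₀ _ _ _).symm (foldB_k₁ _ _ _).symm (foldB_c _ _ _).symm
    (foldB_mc _ _ _).symm (foldB_z _ _ _).symm (foldB_mz _ _ _).symm

end Cx

/-! ### Cost of the simulator for a corrupted Bob. -/

namespace CorruptBob

variable {s κ ℓ B : ℕ}

theorem cx_forge {k : ℕ} {A : Type} [Wired A] {Δ : A → Key κ}
    {v : A → Fin (ℓ * B) → ReceiverView κ} {d : A → Fin ℓ → Fin (B - 1) → Bit} (hΔ : Cx s k Δ)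
    (hv : Cx s k v) (hd : Cx s k d) : Cx s (k + 16) fun a => forge (Δ a) (v a) (d a) := by
  refine Cx.pi fun j => Cx.pi fun i => ?_
  have hd' := (hd.apply j).apply i
  exact (hd'.prodMk ((Cx.revealedKey (hv.bucket j i) (hv.bucket j (i + 1))).add_key
    (hd'.smul_key hΔ))).mono (by omega)

section

variable {A : Type} [Wired A] {t : A → Memory κ ℓ B} (ht : Cx s 0 t)
include ht

theorem cx_chooseB {v : A → ReceiverOut κ (ℓ * B)} (hv : Cx s 0 v) :
    Cx s 100 fun a => ((((t a).1, true, if (t a).2.1 then (t a).2.2.1 else v a, (t a).2.2.2),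
      false, false), (SimAction.reply .silent : SimAction κ ℓ B)) := by
  have hT := ht.fst.prodMk ((Cx.const true).prodMk ((ht.snd.fst.ite ht.snd.snd.fst hv).prodMk
    ht.snd.snd.snd))
  exact ((hT.mono (k' := 60) (by omega)).react ((Cx.const (s := s) _).mono (by omega))
    false false).mono (by omega)

theorem cx_keyQuery (hκ : κ ≤ s + 2) {P : A → Party} {Δ : A → Key κ} (hP : Cx s 0 P)
    (hΔ : Cx s 0 Δ) :
    Cx s 100 fun a => if decide (P a = .bob) then
        ((t a, false, false), .reply (.answer ((t a).2.1 && decide ((t a).2.2.1.1 = Δ a))))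
      else ((t a, false, true), (SimAction.call (.keyQuery (P a) (Δ a)) : SimAction κ ℓ B)) := by
  have hb := Cx.eq (j := 0) FewWires.party hP (Cx.const (s := s) Party.bob)
  have he := ht.snd.fst.and (Cx.eq (FewWires.key hκ) ht.snd.snd.fst.fst hΔ)
  exact (hb.ite ((ht.mono (k' := 12) (by omega)).react he.answer.reply false false)
    (ht.react (Cx.boxKeyQuery hP hΔ).call false true)).mono (by omega)

theorem cx_deliverBox {P : A → Party} (hP : Cx s 0 P) :
    Cx s 100 fun a => ((((t a).1, (t a).2.1, (t a).2.2.1,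
      (t a).2.2.2.1 || (decide (P a = .alice) && (t a).1 && (t a).2.1), (t a).2.2.2.2),
        false, false), (SimAction.reply .silent : SimAction κ ℓ B)) := by
  have hb := Cx.eq (j := 0) FewWires.party hP (Cx.const (s := s) Party.alice)
  have ho := ht.snd.snd.snd.fst.or ((hb.and ht.fst).and ht.snd.fst)
  have hT := ht.fst.prodMk (ht.snd.fst.prodMk (ht.snd.snd.fst.prodMk (ho.prodMk
    ht.snd.snd.snd.snd)))
  exact ((hT.mono (k' := 60) (by omega)).react ((Cx.const (s := s) _).mono (by omega))
    false false).mono (by omega)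

theorem cx_sendPerm (h : Params s κ ℓ B) {π : A → Equiv.Perm (Fin (ℓ * B))}
    {d : A → Fin ℓ → Fin (B - 1) → Bit} (hπ : Cx s 0 π) (hd : Cx s 0 d) :
    Cx s 100 fun a => if (t a).2.2.2.1 && !(t a).2.2.2.2.1 then
        (((((t a).1, (t a).2.1, (t a).2.2.1, (t a).2.2.2.1, true,
            forge (t a).2.2.1.1 (fun i => (t a).2.2.1.2 (π a i)) (d a)), true, false) :
              Memory κ ℓ B × Bool × Bool),
          (SimAction.call (.chooseB ((t a).2.2.1.1, bobResult 1
            (fun i => (t a).2.2.1.2 (π a i)) fun j k => (d a j k, 0))) : SimAction κ ℓ B))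
      else ((t a, false, false), .reply .silent) := by
  have hv := Cx.permute h.mul ht.snd.snd.fst.snd hπ
  have hf := cx_forge (ht.snd.snd.fst.fst.mono (k' := 2 + 0 + 6) (by omega)) hv
    (hd.mono (by omega))
  have hr := Cx.bobResult h.size hv (hd.mono (by omega))
  have hT := ht.fst.prodMk (ht.snd.fst.prodMk (ht.snd.snd.fst.prodMk (ht.snd.snd.snd.fst.prodMk
    ((Cx.const (s := s) true).prodMk hf))))
  have hx := (ht.snd.snd.fst.fst.prodMk hr).mono (k' := 60) (by omega)
  have hc := ht.snd.snd.snd.fst.and ht.snd.snd.snd.snd.fst.not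
  exact (hc.ite ((hT.mono (k' := 60) (by omega)).react (Cx.boxChooseB hx).call true false)
    ht.silent).mono (by omega)

end

theorem costAtMost (h : Params s κ ℓ B) {N : ℕ} (hN : (s + 2) ^ 250 ≤ N) :
    (strategy κ ℓ B).toSimulator.CostAtMost N := by
  have hT : FewWires s 30 (Memory κ ℓ B × Bool × Bool) :=
    ((FewWires.bool.prod (FewWires.bool.prod ((FewWires.receiverOut h.key h.mul).prod
      (FewWires.bool.prod (FewWires.bool.prod (FewWires.reveals h)))))).prod
        (FewWires.bool.prod FewWires.bool)).mono (by omega)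
  have ht : ∀ {X : Type} [Wired X], Cx s 0 fun p : (Memory κ ℓ B × (Fin ℓ → Fin (B - 1) → Bit) ×
      Equiv.Perm (Fin (ℓ * B))) × X => p.1.1 := fun {X} _ => .of_isWiring isWiring_fst.fst
  have hx : ∀ {X : Type} [Wired X], Cx s 0 fun p : (Memory κ ℓ B × (Fin ℓ → Fin (B - 1) → Bit) ×
      Equiv.Perm (Fin (ℓ * B))) × X => p.2 := fun {X} _ => .of_isWiring isWiring_snd
  have triv : ∀ {X : Type} [Wired X], Cx s 100 fun p : (Memory κ ℓ B ×
      (Fin ℓ → Fin (B - 1) → Bit) × Equiv.Perm (Fin (ℓ * B))) × X => ((p.1.1, false, false),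
        (SimAction.reply .silent : SimAction κ ℓ B)) := fun {X} _ => ht.silent.mono (by omega)
  refine (strategy κ ℓ B).costAtMost (j := 30) (c := 2) (k := 140) h hT (FewWires.bits h)
    ?_ ?_ ?_ ((base_pow_mono s (by omega)).trans hN)
  · have hm : Cx s 0 fun p : Memory κ ℓ B × Party => p.1 := .of_isWiring isWiring_fst
    exact ((Cx.const (s := s) true).prodMk hm.snd).mono (k' := 140) (by omega)
  · refine Cx.mono (k := 100 + 32) (Cx.advCmd triv ?_ triv ?_ ?_ triv triv ?_ triv) (by omega)
    · exact cx_chooseB ht hx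
    · exact cx_keyQuery ht h.key hx.fst hx.snd
    · exact cx_deliverBox ht hx
    · exact cx_sendPerm ht h hx (.of_isWiring isWiring_fst.snd.fst)
  · have hm : Cx s 0 fun p : Memory κ ℓ B × (Fin ℓ → Fin (B - 1) → Bit) => p.1 :=
      .of_isWiring isWiring_fst
    exact hm.snd.snd.snd.snd.snd.replyReveals.mono (k' := 140) (by omega)

end CorruptBob

/-! ### Cost of the simulator for a corrupted Alice. -/

namespace CorruptAlice

variable {s κ ℓ B : ℕ}

section

variable {A : Type} [Wired A] {t : A → Memory κ ℓ B} (ht : Cx s 0 t)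
include ht

theorem cx_chooseA {v : A → SenderOut κ (ℓ * B)} (hv : Cx s 0 v) :
    Cx s 100 fun a => (((((t a).1.1, true, if (t a).1.2.1 then (t a).1.2.2 else v a), (t a).2),
      false, false), (SimAction.reply .silent : SimAction κ ℓ B)) := by
  have hT := (ht.fst.fst.prodMk ((Cx.const (s := s) true).prodMk
    (ht.fst.snd.fst.ite ht.fst.snd.snd hv))).prodMk ht.snd
  exact ((hT.mono (k' := 60) (by omega)).react ((Cx.const (s := s) _).mono (by omega))
    false false).mono (by omega)

theorem cx_guess (h : Params s κ ℓ B) {i : A → Fin (ℓ * B)} {g c : A → Bit} (hi : Cx s 0 i)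
    (hg : Cx s 0 g) (hc : Cx s 0 c) :
    Cx s 100 fun a => if !(t a).2.2.2.1 && !(t a).2.2.1 then
        ((((t a).1, (fun k => (t a).2.1.1 k || decide (k = i a), fun k => if decide (k = i a) then
            (if (t a).2.1.1 (i a) then (t a).2.1.2 (i a) else c a) else (t a).2.1.2 k),
          (!decide ((if (t a).2.1.1 (i a) then (t a).2.1.2 (i a) else c a) = g a), (t a).2.2.2)),
            false, false),
          (SimAction.reply (.answer (decide ((if (t a).2.1.1 (i a) then (t a).2.1.2 (i a)
            else c a) = g a))) : SimAction κ ℓ B))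
      else ((t a, false, false), .reply .silent) := by
  have hw : Cx s 12 fun a => if (t a).2.1.1 (i a) then (t a).2.1.2 (i a) else c a :=
    ((Cx.lookup h.mul ht.snd.fst.fst hi).ite (Cx.lookup h.mul ht.snd.fst.snd hi) hc).mono
      (by omega)
  have hk : ∀ k, Cx s 12 fun a => decide (k = i a) := fun k =>
    (Cx.eq (FewWires.fin h.mul) (Cx.const (s := s) k) hi).mono (by omega)
  have hl : Cx s 20 fun a => fun k => (t a).2.1.1 k || decide (k = i a) :=
    Cx.pi fun k => ((ht.snd.fst.fst.apply k).or (hk k)).mono (by omega)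
  have hv : Cx s 20 fun a => fun k => if decide (k = i a) then
      (if (t a).2.1.1 (i a) then (t a).2.1.2 (i a) else c a) else (t a).2.1.2 k :=
    Cx.pi fun k => ((hk k).ite hw (ht.snd.fst.snd.apply k)).mono (by omega)
  have he : Cx s 30 fun a => decide ((if (t a).2.1.1 (i a) then (t a).2.1.2 (i a)
      else c a) = g a) := (Cx.eq FewWires.bit hw hg).mono (by omega)
  have hT := ht.fst.prodMk ((hl.prodMk hv).prodMk (he.not.prodMk ht.snd.snd.snd))
  have hb := ht.snd.snd.snd.fst.not.and ht.snd.snd.fst.not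
  exact (hb.ite ((hT.mono (k' := 60) (by omega)).react (he.answer.reply.mono (by omega))
    false false) ht.silent).mono (by omega)

theorem cx_keyQuery (hκ : κ ≤ s + 2) {P : A → Party} {Δ : A → Key κ} (hP : Cx s 0 P)
    (hΔ : Cx s 0 Δ) :
    Cx s 100 fun a => if decide (P a = .alice) then
        ((t a, false, false), .reply (.answer ((t a).1.2.1 && decide ((t a).1.2.2.1 = Δ a))))
      else ((t a, false, true), (SimAction.call (.keyQuery (P a) (Δ a)) : SimAction κ ℓ B)) := by
  have hb := Cx.eq (j := 0) FewWires.party hP (Cx.const (s := s) Party.alice)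
  have he := ht.fst.snd.fst.and (Cx.eq (FewWires.key hκ) ht.fst.snd.snd.fst hΔ)
  exact (hb.ite ((ht.mono (k' := 12) (by omega)).react he.answer.reply false false)
    (ht.react (Cx.boxKeyQuery hP hΔ).call false true)).mono (by omega)

theorem cx_deliverBox (h : Params s κ ℓ B) {P : A → Party} {π : A → Equiv.Perm (Fin (ℓ * B))}
    (hP : Cx s 0 P) (hπ : Cx s 0 π) :
    Cx s 100 fun a => if decide (P a = .bob) && (t a).1.1 && !(t a).2.2.2.1 then
        if (t a).2.2.1 then
          ((((t a).1, (t a).2.1, ((t a).2.2.1, true, (t a).2.2.2.2)), true, false),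
            (SimAction.call .abort : SimAction κ ℓ B))
        else if (t a).1.2.1 then
          (((((t a).1.1, (t a).1.2.1, ((t a).1.2.2.1, fun i => (t a).1.2.2.2 (π a i))),
            (t a).2.1, ((t a).2.2.1, true, true)), false, false), .reply (.perm (π a)))
        else ((t a, false, false), .reply .silent)
      else ((t a, false, false), .reply .silent) := by
  have hb := ((Cx.eq (j := 0) FewWires.party hP (Cx.const (s := s) Party.bob)).and ht.fst.fst).and
    ht.snd.snd.snd.fst.not
  have h1 := ht.fst.prodMk (ht.snd.fst.prodMk (ht.snd.snd.fst.prodMk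
    ((Cx.const (s := s) true).prodMk ht.snd.snd.snd.snd)))
  have h2 := (ht.fst.fst.prodMk (ht.fst.snd.fst.prodMk (ht.fst.snd.snd.fst.prodMk
    (Cx.permute h.mul ht.fst.snd.snd.snd hπ)))).prodMk (ht.snd.fst.prodMk
      (ht.snd.snd.fst.prodMk ((Cx.const (s := s) true).prodMk (Cx.const (s := s) true))))
  exact (hb.ite (ht.snd.snd.fst.ite ((h1.mono (k' := 60) (by omega)).react
    ((Cx.const (s := s) _).mono (by omega)) true false) (ht.fst.snd.fst.ite
      ((h2.mono (k' := 60) (by omega)).react ((Cx.replyPerm hπ).reply.mono (by omega)) false false)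
        ht.silent)) ht.silent).mono (by omega)

theorem cx_sendReveals (h : Params s κ ℓ B) {r : A → Reveals κ ℓ B} (hr : Cx s 0 r) :
    Cx s 100 fun a => if (t a).2.2.2.2 then
        ((((t a).1, (t a).2.1, ((t a).2.2.1, (t a).2.2.2.1, false)), true, false),
          (SimAction.call (if decide (r a = aliceReveals 1 (t a).1.2.2.2) then
            .chooseA ((t a).1.2.2.1, aliceResult 1 (t a).1.2.2.2) else .abort) : SimAction κ ℓ B))
      else ((t a, false, false), .reply .silent) := by
  have he := Cx.eq (FewWires.reveals h) hr (Cx.aliceReveals ht.fst.snd.snd.snd)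
  have hx := (ht.fst.snd.snd.fst.prodMk (Cx.aliceResult h.size ht.fst.snd.snd.snd)).mono
    (k' := 40) (by omega)
  have hC := he.ite (Cx.boxChooseA hx) (Cx.const (s := s) BoxCmd.abort)
  have hT := ht.fst.prodMk (ht.snd.fst.prodMk (ht.snd.snd.fst.prodMk
    (ht.snd.snd.snd.fst.prodMk (Cx.const (s := s) false))))
  exact (ht.snd.snd.snd.snd.ite ((hT.mono (k' := 60) (by omega)).react
    (hC.call.mono (by omega)) true false) ht.silent).mono (by omega)

end

theorem costAtMost (h : Params s κ ℓ B) {N : ℕ} (hN : (s + 2) ^ 250 ≤ N) :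
    (strategy κ ℓ B).toSimulator.CostAtMost N := by
  have hl : Fintype.card (Fin (ℓ * B)) ≤ (s + 2) ^ 2 := by
    rw [Fintype.card_fin]
    exact h.mul
  have hT : FewWires s 30 (Memory κ ℓ B × Bool × Bool) :=
    (((FewWires.bool.prod (FewWires.bool.prod (FewWires.senderOut h.key h.mul))).prod
      (((FewWires.pi hl FewWires.bool).prod (FewWires.pi hl FewWires.bit)).prod
        (FewWires.bool.prod (FewWires.bool.prod FewWires.bool)))).prod
          (FewWires.bool.prod FewWires.bool)).mono (by omega)
  have ht : ∀ {X : Type} [Wired X], Cx s 0 fun p : (Memory κ ℓ B × Bit ×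
      Equiv.Perm (Fin (ℓ * B))) × X => p.1.1 := fun {X} _ => .of_isWiring isWiring_fst.fst
  have hx : ∀ {X : Type} [Wired X], Cx s 0 fun p : (Memory κ ℓ B × Bit ×
      Equiv.Perm (Fin (ℓ * B))) × X => p.2 := fun {X} _ => .of_isWiring isWiring_snd
  have triv : ∀ {X : Type} [Wired X], Cx s 100 fun p : (Memory κ ℓ B × Bit ×
      Equiv.Perm (Fin (ℓ * B))) × X => ((p.1.1, false, false),
        (SimAction.reply .silent : SimAction κ ℓ B)) := fun {X} _ => ht.silent.mono (by omega)
  refine (strategy κ ℓ B).costAtMost (j := 30) (c := 0) (k := 140) h hT FewWires.bit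
    ?_ ?_ ?_ ((base_pow_mono s (by omega)).trans hN)
  · have hm : Cx s 0 fun p : Memory κ ℓ B × Party => p.1 := .of_isWiring isWiring_fst
    exact (((Cx.const (s := s) true).prodMk hm.fst.snd).prodMk hm.snd).mono (k' := 140) (by omega)
  · refine Cx.mono (k := 100 + 32) (Cx.advCmd ?_ triv ?_ ?_ ?_ triv triv triv ?_) (by omega)
    · exact cx_chooseA ht hx
    · exact cx_guess ht h hx.fst hx.snd (.of_isWiring isWiring_fst.snd.fst)
    · exact cx_keyQuery ht h.key hx.fst hx.snd
    · exact cx_deliverBox ht h hx (.of_isWiring isWiring_fst.snd.snd)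
    · exact cx_sendReveals ht h hx
  · exact (Cx.const (s := s) Reply.silent).mono (k' := 140) (by omega)

end CorruptAlice

end AOT

/-! ### The security theorem. -/

theorem mainTheorem5 :
    ∃ p : Polynomial ℕ, ∀ (κ ℓ B ψ : ℕ) (D : PMF (Equiv.Perm (Fin (ℓ * B)))),
      1 ≤ ℓ → 1 ≤ B → ψ ≤ κ → AOT.IsWiseIndependent B D →
      (ψ : ℝ) ≤ (Real.logb 2 ℓ + 1) * ((B : ℝ) - 1) →
      AOT.SecurelyImplements κ ℓ B D ψ p := by
  -- The exponent dominates the cost of all three simulators. The same polynomial exceeds q + 1,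
  -- which covers the advantage q/2^κ + 1/2^ψ because ψ ≤ κ.
  refine ⟨(Polynomial.X + 2) ^ 250, fun κ ℓ B ψ D hℓ hB hψκ hD hψ cor => ?_⟩
  have hp : ∀ n : ℕ, ((Polynomial.X + 2) ^ 250 : Polynomial ℕ).eval n = (n + 2) ^ 250 := by
    intro n
    simp
  have h : AOT.FewWires.Params (κ + ℓ + B) κ ℓ B := ⟨by omega, by omega, by omega⟩
  have hq : ∀ q : ℕ, ((q : ℝ) + 1) / 2 ^ ψ ≤ (((q + 2) ^ 250 : ℕ) : ℝ) / 2 ^ ψ := fun q => by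
    gcongr
    have : q + 1 ≤ (q + 2) ^ 250 :=
      (Nat.le_succ _).trans (Nat.le_self_pow (by decide) _)
    exact_mod_cast this
  have hκ : ∀ q : ℕ, (q : ℝ) / 2 ^ κ ≤ q / 2 ^ ψ := fun q => by
    gcongr
    exact one_le_two
  simp only [hp]
  rcases cor with _ | _ | _
  · refine ⟨(AOT.Honest.strategy κ ℓ B).toSimulator,
      AOT.Honest.costAtMost h (AOT.base_pow_mono _ (by decide)), fun Z q => ?_⟩
    rw [AOT.Honest.acceptProb_eq hB, sub_self, abs_zero]
    positivity
  · refine ⟨(AOT.CorruptAlice.strategy κ ℓ B).toSimulator, AOT.CorruptAlice.costAtMost h le_rfl,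
      fun Z q => ?_⟩
    refine (AOT.CorruptAlice.abs_acceptProb_sub_le hℓ hB
      (AOT.two_pow_le_of_le_logb hℓ hB hψ) hD Z q).trans (le_trans ?_ (hq q))
    rw [add_div]
    exact add_le_add_left (hκ q) _
  · refine ⟨(AOT.CorruptBob.strategy κ ℓ B).toSimulator, AOT.CorruptBob.costAtMost h le_rfl,
      fun Z q => ?_⟩
    refine (AOT.CorruptBob.abs_acceptProb_sub_le hB D Z q).trans
      ((hκ q).trans (le_trans ?_ (hq q)))
    gcongr
    linarith
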